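/- **Setting.** A discrete memoryless (separated) two-way relay channel has finite alphabets, an uplink law $p(y_R\mid x_{12},x_{21})$ from nodes 1 and 2 to the relay, and a downlink law $p(y_1,y_2\mid x_R)=p(y_1\mid x_R)\,p(y_2\mid x_R)$ from the relay to the nodes. Node 1 has a message $W_{12}\in\{1,\dots,\lceil 2^{nR_{12}}\rceil\}$ for node 2 and node 2 has a message $W_{21}\in\{1,\dots,\lceil 2^{nR_{21}}\rceil\}$ for node 1; the messages are independent and uniform, the relay is strictly causal, and node $a$ decodes from $Y_a^n$ and its own message. The downlink is assumed to be (stochastically) degraded with node 1 the stronger receiver: $p(y_2\mid x_R)=\sum_{y_1}p(y_1\mid x_R)\,q(y_2\mid y_1)$ for some channel $q$. In a *hash-and-forward scheme* time is cut into blocks. The two nodes encode without using the downlink signal. The relay hashes each received block $y_R^m$ to a bin index $(i,j)$ and sends a codeword $x_R^m(i,j)$ during the next block. Node 1 decodes $(i,j)$ and node 2 decodes only $j$; each node then estimates the other node's message from the decoded indices of all blocks and its own message. A rate pair $(R_{12},R_{21})$ with $R_{12},R_{21}\ge 0$ is *achieved by hash-and-forward relaying* if for all large $n$ there are hash-and-forward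 schemes of length $n$ with these rates for which the average error probabilities of both messages, and the probabilities that node 1 decodes some $(i,j)$ or node 2 decodes some $j$ wrongly, tend to $0$. **Theorem.** Let $\mathcal D$ be the convex hull of all pairs $$(R_{R,1},R_{R,2})=\bigl(I(X_R;Y_1\mid U)+I(U;Y_2),\; I(U;Y_2)\bigr)$$ over all finite auxiliary alphabets and all joint laws $p(u,x_R)\,p(y_1\mid x_R)\,p(y_2\mid x_R)$. Let $\mathcal R$ be the set of all pairs $(R_{12},R_{21})$ of nonnegative reals such that, for some input laws $p(x_{12})$, $p(x_{21})$ and some $(R_{R,1},R_{R,2})\in\mathcal D$, $$R_{12}\le\min\bigl\{I(X_{12};Y_R\mid X_{21}),\,[R_{R,2}-H(Y_R\mid X_{12},X_{21})]^+\bigr\},$$ $$R_{21}\le\min\bigl\{I(X_{21};Y_R\mid X_{12}),\,[R_{R,1}-H(Y_R\mid X_{12},X_{21})]^+\bigr\},$$ where the uplink quantities are computed under $p(x_{12})\,p(x_{21})\,p(y_R\mid x_{12},x_{21})$, all logarithms are to base 2 and $[t]^+=\max\{t,0\}$. (In particular, $R_{R,2}=I(U;Y_2)$ and $R_{R,1}=I(X_R;Y_1\mid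 U)+I(U;Y_2)$ are allowed for every $p(u,x_R)$.) Then the closure of $\mathcal R$ is contained in the closure of the set of rate pairs achieved by hash-and-forward relaying. -/

import Mathlib

noncomputable section

namespace TwoWayRelay

/-! ### Finite information measures, in bits

A finite probability space is a finite type `Ω` with a mass function `p : Ω → ℝ`; a random variable
is a function on `Ω`. -/

section Information

variable {Ω α β γ : Type*} [Fintype Ω] [Fintype α] [Fintype β] [Fintype γ]

open Classical in
/-- The mass function of the random variable `f`. -/
def law (p : Ω → ℝ) (f : Ω → α) (a : α) : ℝ := ∑ ω, if f ω = a then p ω else 0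

/-- The Shannon entropy `H(f)`. -/
def entropy (p : Ω → ℝ) (f : Ω → α) : ℝ :=
  (∑ a, Real.negMulLog (law p f a)) / Real.log 2

/-- The conditional entropy `H(f | g)`. -/
def condEntropy (p : Ω → ℝ) (f : Ω → α) (g : Ω → β) : ℝ :=
  entropy p (fun ω => (f ω, g ω)) - entropy p g

/-- The mutual information `I(f ; g)`. -/
def mutualInfo (p : Ω → ℝ) (f : Ω → α) (g : Ω → β) : ℝ :=
  entropy p f - condEntropy p f g

/-- The conditional mutual information `I(f ; g | h)`. -/
def condMutualInfo (p : Ω → ℝ) (f : Ω → α) (g : Ω → β) (h : Ω → γ) : ℝ :=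
  condEntropy p f h - condEntropy p f (fun ω => (g ω, h ω))

end Information

/-! ### The channel -/

/-- A discrete memoryless separated two-way relay channel: the uplink law `p(y_R | x₁₂, x₂₁)` and
the two downlink laws `p(y₁ | x_R)`, `p(y₂ | x_R)`; the downlink outputs are conditionally
independent given the relay input. -/
structure Channel (X12 X21 XR YR Y1 Y2 : Type*) [Fintype YR] [Fintype Y1] [Fintype Y2] where
  up : X12 → X21 → YR → ℝ
  down1 : XR → Y1 → ℝ
  down2 : XR → Y2 → ℝ
  up_mem : ∀ a b, up a b ∈ stdSimplex ℝ YR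
  down1_mem : ∀ x, down1 x ∈ stdSimplex ℝ Y1
  down2_mem : ∀ x, down2 x ∈ stdSimplex ℝ Y2

section Codes

variable {X12 X21 XR YR Y1 Y2 : Type*} [Fintype YR] [Fintype Y1] [Fintype Y2]

/-- The downlink is a degraded broadcast channel, node `1` being the stronger receiver: the channel
to node `2` is the channel to node `1` followed by some channel `q(y₂ | y₁)`. -/
def Channel.IsDegraded (ch : Channel X12 X21 XR YR Y1 Y2) : Prop :=
  ∃ q : Y1 → Y2 → ℝ, (∀ y, q y ∈ stdSimplex ℝ Y2) ∧
    ∀ x y2, ch.down2 x y2 = ∑ y1, ch.down1 x y1 * q y1 y2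

/-- The past `y^{i-1}` of a sequence, seen just before time `i`. -/
def past {α : Type*} {n : ℕ} (y : Fin n → α) (i : Fin n) : Fin (i : ℕ) → α :=
  fun k => y (Fin.castLE i.isLt.le k)

/-- A code of length `n` with `M12` messages from node `1` to node `2` and `M21` messages from node
`2` to node `1`: causal encoders that may use the past downlink outputs, a strictly causal relay
map, and decoders that know the message sent by their own node. -/
structure Code (X12 X21 XR YR Y1 Y2 : Type*) (n M12 M21 : ℕ) where
  enc12 : (i : Fin n) → Fin M12 → (Fin (i : ℕ) → Y1) → X12
  enc21 : (i : Fin n) → Fin M21 → (Fin (i : ℕ) → Y2) → X21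
  relay : (i : Fin n) → (Fin (i : ℕ) → YR) → XR
  dec1 : (Fin n → Y1) → Fin M12 → Fin M21
  dec2 : (Fin n → Y2) → Fin M21 → Fin M12

/-- The joint probability of the messages and of the three output sequences, the messages being
independent and uniform. -/
def Code.jointProb {n M12 M21 : ℕ} (c : Code X12 X21 XR YR Y1 Y2 n M12 M21)
    (ch : Channel X12 X21 XR YR Y1 Y2) (w12 : Fin M12) (w21 : Fin M21)
    (yR : Fin n → YR) (y1 : Fin n → Y1) (y2 : Fin n → Y2) : ℝ :=
  (M12 : ℝ)⁻¹ * (M21 : ℝ)⁻¹ *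
    ∏ i, (ch.up (c.enc12 i w12 (past y1 i)) (c.enc21 i w21 (past y2 i)) (yR i) *
      ch.down1 (c.relay i (past yR i)) (y1 i) * ch.down2 (c.relay i (past yR i)) (y2 i))

open Classical in
/-- The probability of an event on the messages `w₁₂, w₂₁` and the outputs `y_R, y₁, y₂`. -/
def Code.prob {n M12 M21 : ℕ} (c : Code X12 X21 XR YR Y1 Y2 n M12 M21)
    (ch : Channel X12 X21 XR YR Y1 Y2)
    (E : Fin M12 → Fin M21 → (Fin n → YR) → (Fin n → Y1) → (Fin n → Y2) → Prop) : ℝ :=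
  ∑ w12, ∑ w21, ∑ yR, ∑ y1, ∑ y2,
    if E w12 w21 yR y1 y2 then c.jointProb ch w12 w21 yR y1 y2 else 0

/-- `P_{e,1}`: the probability that node `1` does not recover `W₂₁`. -/
def Code.err1 {n M12 M21 : ℕ} (c : Code X12 X21 XR YR Y1 Y2 n M12 M21)
    (ch : Channel X12 X21 XR YR Y1 Y2) : ℝ :=
  c.prob ch fun w12 w21 _ y1 _ => c.dec1 y1 w12 ≠ w21

/-- `P_{e,2}`: the probability that node `2` does not recover `W₁₂`. -/
def Code.err2 {n M12 M21 : ℕ} (c : Code X12 X21 XR YR Y1 Y2 n M12 M21)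
    (ch : Channel X12 X21 XR YR Y1 Y2) : ℝ :=
  c.prob ch fun w12 w21 _ _ y2 => c.dec2 y2 w21 ≠ w12

/-- A hash-and-forward scheme of length `n`. Time is cut into blocks of length `m`. The nodes do
not use the downlink signal for encoding. The relay hashes the block `y_R^m` that it has just
received to a bin index `(i, j)` and sends the codeword `x_R^m(i, j)` during the next block; it
sends fixed symbols while it has nothing to forward. Node `1` decodes the pair `(i, j)` of each
downlink block, node `2` decodes only `j` (successive refinement). From these decoded indices and
its own message, each node estimates the message sent by the other one. -/
structure HFScheme (X12 X21 XR YR Y1 Y2 : Type*) (n M12 M21 : ℕ) where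
  /-- block length -/
  m : ℕ
  /-- number of uplink blocks that are hashed and forwarded -/
  B : ℕ
  m_pos : 0 < m
  fits : (B + 1) * m ≤ n
  /-- numbers of values of the refinement index `i` and of the common index `j` -/
  numI : ℕ
  numJ : ℕ
  cb12 : Fin M12 → Fin n → X12
  cb21 : Fin M21 → Fin n → X21
  hash : (Fin m → YR) → Fin numI × Fin numJ
  cbR : Fin numI × Fin numJ → Fin m → XR
  idle : Fin n → XR
  index1 : (Fin m → Y1) → Fin numI × Fin numJ
  index2 : (Fin m → Y2) → Fin numJ
  dec1 : (Fin B → Fin numI × Fin numJ) → Fin M12 → Fin M21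
  dec2 : (Fin B → Fin numJ) → Fin M21 → Fin M12

theorem relay_index_lt {m t k : ℕ} (h : 1 ≤ t / m) (hk : k < m) : (t / m - 1) * m + k < t := by
  obtain ⟨b, hb⟩ := Nat.exists_eq_add_of_le' h
  have h2 : t / m * m ≤ t := Nat.div_mul_le_self t m
  rw [hb] at h2 ⊢
  simp only [Nat.add_sub_cancel]
  nlinarith

theorem decoder_index_lt {m n B b k : ℕ} (hf : (B + 1) * m ≤ n) (hb : b < B) (hk : k < m) :
    (b + 1) * m + k < n := by
  have : (b + 1) * m + m ≤ (B + 1) * m := by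
    have := Nat.mul_le_mul_right m (Nat.succ_le_succ (Nat.succ_le_of_lt hb))
    simpa [Nat.succ_eq_add_one, Nat.add_mul] using this
  omega

theorem uplink_index_lt {m n B b k : ℕ} (hf : (B + 1) * m ≤ n) (hb : b < B) (hk : k < m) :
    b * m + k < n := by
  have := decoder_index_lt hf hb hk
  have h2 : (b + 1) * m = b * m + m := by ring
  omega

/-- The `b`-th uplink block (of length `m`). -/
def HFScheme.upBlock {n M12 M21 : ℕ} (s : HFScheme X12 X21 XR YR Y1 Y2 n M12 M21)
    {α : Type*} (y : Fin n → α) (b : Fin s.B) : Fin s.m → α :=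
  fun k => y ⟨(b : ℕ) * s.m + k, uplink_index_lt s.fits b.isLt k.isLt⟩

/-- The downlink block (of length `m`) that carries the index of the `b`-th uplink block. -/
def HFScheme.downBlock {n M12 M21 : ℕ} (s : HFScheme X12 X21 XR YR Y1 Y2 n M12 M21)
    {α : Type*} (y : Fin n → α) (b : Fin s.B) : Fin s.m → α :=
  fun k => y ⟨((b : ℕ) + 1) * s.m + k, decoder_index_lt s.fits b.isLt k.isLt⟩

/-- The code of the system model that a hash-and-forward scheme defines. -/
def HFScheme.toCode {n M12 M21 : ℕ} (s : HFScheme X12 X21 XR YR Y1 Y2 n M12 M21) :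
    Code X12 X21 XR YR Y1 Y2 n M12 M21 where
  enc12 i w _ := s.cb12 w i
  enc21 i w _ := s.cb21 w i
  relay i y :=
    if h : 1 ≤ (i : ℕ) / s.m ∧ (i : ℕ) / s.m ≤ s.B then
      s.cbR (s.hash fun k => y ⟨((i : ℕ) / s.m - 1) * s.m + k, relay_index_lt h.1 k.isLt⟩)
        ⟨(i : ℕ) % s.m, Nat.mod_lt _ s.m_pos⟩
    else s.idle i
  dec1 y w := s.dec1 (fun b => s.index1 (s.downBlock y b)) w
  dec2 y w := s.dec2 (fun b => s.index2 (s.downBlock y b)) w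

/-- The probability that node `1` decodes the bin index `(i, j)` of some block wrongly. -/
def HFScheme.indexErr1 {n M12 M21 : ℕ} (s : HFScheme X12 X21 XR YR Y1 Y2 n M12 M21)
    (ch : Channel X12 X21 XR YR Y1 Y2) : ℝ :=
  s.toCode.prob ch fun _ _ yR y1 _ =>
    ∃ b, s.index1 (s.downBlock y1 b) ≠ s.hash (s.upBlock yR b)

/-- The probability that node `2` decodes the common index `j` of some block wrongly. -/
def HFScheme.indexErr2 {n M12 M21 : ℕ} (s : HFScheme X12 X21 XR YR Y1 Y2 n M12 M21)
    (ch : Channel X12 X21 XR YR Y1 Y2) : ℝ :=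
  s.toCode.prob ch fun _ _ yR _ y2 =>
    ∃ b, s.index2 (s.downBlock y2 b) ≠ (s.hash (s.upBlock yR b)).2

/-- The number `2^{nR}` of messages, rounded up. -/
def numMessages (n : ℕ) (R : ℝ) : ℕ := ⌈(2 : ℝ) ^ ((n : ℝ) * R)⌉₊

/-- The rate pair `(R₁₂, R₂₁)`, in bits per channel use, is achieved by hash-and-forward relaying:
for all large `n` there is a hash-and-forward scheme of length `n` with `2^{n R₁₂}` and `2^{n R₂₁}`
messages, such that the message error probabilities of both nodes tend to `0`, and so do the
probabilities that the forwarded indices (`(i, j)` at node `1`, `j` at node `2`) are decoded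
wrongly. -/
def HFAchievable (ch : Channel X12 X21 XR YR Y1 Y2) (R : ℝ × ℝ) : Prop :=
  0 ≤ R.1 ∧ 0 ≤ R.2 ∧ ∀ ε > 0, ∀ᶠ n : ℕ in Filter.atTop,
    ∃ s : HFScheme X12 X21 XR YR Y1 Y2 n (numMessages n R.1) (numMessages n R.2),
      s.toCode.err1 ch < ε ∧ s.toCode.err2 ch < ε ∧ s.indexErr1 ch < ε ∧ s.indexErr2 ch < ε

end Codes

/-! ### The rate region -/

section Region

variable {X12 X21 XR YR Y1 Y2 : Type*} [Fintype X12] [Fintype X21] [Fintype XR]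
  [Fintype YR] [Fintype Y1] [Fintype Y2]

/-- `p(x₁₂) p(x₂₁) p(y_R | x₁₂, x₂₁)`, on triples `(x₁₂, x₂₁, y_R)`. -/
def Channel.upJoint (ch : Channel X12 X21 XR YR Y1 Y2) (p12 : X12 → ℝ) (p21 : X21 → ℝ) :
    X12 × X21 × YR → ℝ :=
  fun ω => p12 ω.1 * p21 ω.2.1 * ch.up ω.1 ω.2.1 ω.2.2

/-- `p(u, x_R) p(y₁ | x_R) p(y₂ | x_R)`, on quadruples `(u, x_R, y₁, y₂)`. -/
def Channel.downJoint (ch : Channel X12 X21 XR YR Y1 Y2) {U : Type*} (p : U × XR → ℝ) :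
    U × XR × Y1 × Y2 → ℝ :=
  fun ω => p (ω.1, ω.2.1) * ch.down1 ω.2.1 ω.2.2.1 * ch.down2 ω.2.1 ω.2.2.2

/-- `I(U ; Y₂)`. -/
def Channel.commonRate (ch : Channel X12 X21 XR YR Y1 Y2) {U : Type*} [Fintype U]
    (p : U × XR → ℝ) : ℝ :=
  mutualInfo (ch.downJoint p) (fun ω => ω.1) (fun ω => ω.2.2.2)

/-- `I(X_R ; Y₁ | U)`. -/
def Channel.refinementRate (ch : Channel X12 X21 XR YR Y1 Y2) {U : Type*} [Fintype U]
    (p : U × XR → ℝ) : ℝ :=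
  condMutualInfo (ch.downJoint p) (fun ω => ω.2.1) (fun ω => ω.2.2.1) (fun ω => ω.1)

/-- The pairs `(R_{R,1}, R_{R,2})` of downlink rates with successive refinement: the convex hull,
over all finite auxiliary alphabets and all laws `p(u, x_R)`, of the pairs with
`R_{R,2} = I(U ; Y₂)` and `R_{R,1} - R_{R,2} = I(X_R ; Y₁ | U)`. -/
def Channel.downRates (ch : Channel X12 X21 XR YR Y1 Y2) : Set (ℝ × ℝ) :=
  convexHull ℝ {r | ∃ (k : ℕ) (p : Fin k × XR → ℝ), p ∈ stdSimplex ℝ (Fin k × XR) ∧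
    r = (ch.refinementRate p + ch.commonRate p, ch.commonRate p)}

/-- The pairs `(R₁₂, R₂₁)` of nonnegative rates that satisfy the hash-and-forward inequalities for
some input laws `p(x₁₂)`, `p(x₂₁)` and some pair `r = (R_{R,1}, R_{R,2})` of downlink rates. -/
def Channel.hfRegion (ch : Channel X12 X21 XR YR Y1 Y2) : Set (ℝ × ℝ) :=
  {R | 0 ≤ R.1 ∧ 0 ≤ R.2 ∧
    ∃ p12 ∈ stdSimplex ℝ X12, ∃ p21 ∈ stdSimplex ℝ X21, ∃ r ∈ ch.downRates,
      let p := ch.upJoint p12 p21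
      R.1 ≤ min (condMutualInfo p (fun ω => ω.1) (fun ω => ω.2.2) (fun ω => ω.2.1))
        (max (r.2 - condEntropy p (fun ω => ω.2.2) (fun ω => (ω.1, ω.2.1))) 0) ∧
      R.2 ≤ min (condMutualInfo p (fun ω => ω.2.1) (fun ω => ω.2.2) (fun ω => ω.1))
        (max (r.1 - condEntropy p (fun ω => ω.2.2) (fun ω => (ω.1, ω.2.1))) 0)}

end Region

end TwoWayRelay

end

/-! Achievability by random coding in two layers. In a block of length `m` the nodes use random
codebooks with laws p(x₁₂), p(x₂₁), and the relay hashes the received sequence uniformly at random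
to a pair `(i, j)`. A node that knows its own codeword and a hash of rate ρ searches for a message
of the other node whose codeword is jointly typical with some sequence in the bin. A wrong message
is accepted for one of two reasons. Its codeword may be typical with the true received sequence,
which has probability about 2^{-mI}, with I the conditional mutual information of the uplink. Or it
may be typical with another sequence of the same bin: there are about 2^{mH} typical sequences, with
H = H(Y_R | X₁₂, X₂₁), and each collides with probability about 2^{-mρ}. So every rate below I and
below ρ - H works (`hashMean_error_le`, `eventually_exists_hash_code`). Node 2 sees only `j`, so ρ =
R_{R,2}; node 1 sees the pair, so ρ = R_{R,1}.

The indices travel over the downlink by superposition coding, with `j` as the cloud and `i` as the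
satellite (`eventually_exists_superposition_code`). Degradedness enters once: I(U;Y₂) ≤ I(U;Y₁) lets
the stronger receiver find the cloud too (`kernelInfo_degraded_le`). The convex hull in the downlink
region adds nothing up to domination: time sharing is absorbed by an auxiliary variable that records
which law is in use (`exists_law_of_mem_downRates`).

A scheme strings `B` such blocks together, with `B` fixed, while `m` grows. Block messages are
obtained by splitting the messages injectively, hence need be neither uniform nor independent, and
the hash indices have whatever law the uplink code gives them. Both coding theorems are therefore
proved for arbitrary weights on messages and indices. The weights count the expected number of
blocks of each kind, so the union bound over blocks is built in (`HFScheme.exists_of_blocks`). The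
idle block costs a rate factor B/(B+1), and the closure absorbs all losses.

Coding bounds are first proved for one use of abstract alphabets, with typicality an abstract
predicate, and then applied to alphabets of sequences. Typicality asks only for lower bounds on
products of densities, so one-sided Chebyshev estimates suffice. -/

noncomputable section

set_option linter.unusedSectionVars false
set_option linter.unusedSimpArgs false

namespace TwoWayRelay

open Filter Topology

/-! ### Finite probability -/

section FiniteProbability

open Classical in
/-- The indicator of a proposition. -/
def ind (P : Prop) : ℝ := if P then 1 else 0

theorem ind_of {P : Prop} (h : P) : ind P = 1 := by simp [ind, h]

theorem ind_of_not {P : Prop} (h : ¬P) : ind P = 0 := by simp [ind, h]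

theorem ind_nonneg (P : Prop) : 0 ≤ ind P := by unfold ind; split_ifs <;> norm_num

theorem ind_le {P : Prop} {x : ℝ} (hx : 0 ≤ x) (h : P → 1 ≤ x) : ind P ≤ x := by
  by_cases hP : P
  · simpa [ind_of hP] using h hP
  · simpa [ind_of_not hP] using hx

theorem ind_mono {P Q : Prop} (h : P → Q) : ind P ≤ ind Q :=
  ind_le (ind_nonneg Q) fun hP => (ind_of (h hP)).ge

theorem ind_or_le (P Q : Prop) : ind (P ∨ Q) ≤ ind P + ind Q :=
  ind_le (add_nonneg (ind_nonneg _) (ind_nonneg _)) fun h => by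
    rcases h with h | h
    · rw [ind_of h]; linarith [ind_nonneg Q]
    · rw [ind_of h]; linarith [ind_nonneg P]

theorem ind_exists_le {ι : Type*} [Fintype ι] (P : ι → Prop) :
    ind (∃ i, P i) ≤ ∑ i, ind (P i) :=
  ind_le (Finset.sum_nonneg fun i _ => ind_nonneg _) fun ⟨i, hi⟩ => by
    rw [← ind_of hi]
    exact Finset.single_le_sum (f := fun i => ind (P i)) (fun i _ => ind_nonneg _)
      (Finset.mem_univ i)

theorem ind_and (P Q : Prop) : ind (P ∧ Q) = ind P * ind Q := by
  by_cases hP : P <;> by_cases hQ : Q <;> simp [ind, hP, hQ]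

theorem sum_ind_ne {S : Type*} [Fintype S] (s : S) :
    ∑ s', ind (s' ≠ s) = (Fintype.card S : ℝ) - 1 := by
  classical
  have h : ∀ s', ind (s' ≠ s) = 1 - if s' = s then 1 else 0 := by
    intro s'
    by_cases h : s' = s <;> simp [ind, h]
  simp [h]

variable {ι κ Ω Ω' : Type*} [Fintype ι] [Fintype κ] [Fintype Ω] [Fintype Ω']

/-- The mass function of independent random variables with mass functions `μ i`. -/
def prodLaw (μ : ι → Ω → ℝ) (x : ι → Ω) : ℝ := ∏ i, μ i (x i)

theorem prodLaw_nonneg {μ : ι → Ω → ℝ} (hμ : ∀ i a, 0 ≤ μ i a) (x : ι → Ω) :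
    0 ≤ prodLaw μ x := Finset.prod_nonneg fun i _ => hμ i _

theorem sum_prodLaw_eq_prod [DecidableEq ι] (μ : ι → Ω → ℝ) :
    ∑ x, prodLaw μ x = ∏ i, ∑ a, μ i a := by
  rw [Finset.prod_univ_sum, Fintype.piFinset_univ]; rfl

theorem sum_prodLaw [DecidableEq ι] {μ : ι → Ω → ℝ} (hμ : ∀ i, ∑ a, μ i a = 1) :
    ∑ x, prodLaw μ x = 1 := by
  simp [sum_prodLaw_eq_prod, hμ]

theorem prodLaw_mem [DecidableEq ι] {μ : ι → Ω → ℝ} (hμ : ∀ i, μ i ∈ stdSimplex ℝ Ω) :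
    prodLaw μ ∈ stdSimplex ℝ (ι → Ω) :=
  ⟨prodLaw_nonneg fun i => (hμ i).1, sum_prodLaw fun i => (hμ i).2⟩

/-- The marginal of a product law along an injection of the index set. -/
theorem sum_prodLaw_comp [DecidableEq ι] [DecidableEq κ] {μ : ι → Ω → ℝ}
    (hμ : ∀ i, ∑ a, μ i a = 1) {e : κ → ι} (he : Function.Injective e) (F : (κ → Ω) → ℝ) :
    ∑ x, prodLaw μ x * F (x ∘ e) = ∑ z, prodLaw (μ ∘ e) z * F z := by
  classical
  -- Coordinates split into those in the range of `e`, which `F` sees, and the rest, whose total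
  -- mass is one.
  let E := Equiv.piEquivPiSubtypeProd (fun i => i ∈ Set.range e) (fun _ : ι => Ω)
  let r : κ ≃ {i // i ∈ Set.range e} := Equiv.ofInjective e he
  rw [← E.symm.sum_comp, Fintype.sum_prod_type, ← (r.arrowCongr (Equiv.refl Ω)).sum_comp]
  refine Finset.sum_congr rfl fun z _ => ?_
  have hF : ∀ x2, (E.symm (r.arrowCongr (Equiv.refl Ω) z, x2)) ∘ e = z := by
    intro x2
    funext k
    have hk : e k ∈ Set.range e := ⟨k, rfl⟩
    have : r.symm ⟨e k, hk⟩ = k := by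
      rw [Equiv.symm_apply_eq]; rfl
    simp only [Function.comp, E, Equiv.piEquivPiSubtypeProd_symm_apply, hk, dif_pos,
      Equiv.arrowCongr_apply, Equiv.coe_refl, id, this]
  have hP : ∀ x2, prodLaw μ (E.symm (r.arrowCongr (Equiv.refl Ω) z, x2)) =
      prodLaw (μ ∘ e) z * prodLaw (fun i : {i // ¬ i ∈ Set.range e} => μ i) x2 := by
    intro x2
    unfold prodLaw
    rw [← Fintype.prod_subtype_mul_prod_subtype (fun i => i ∈ Set.range e)]
    refine congrArg₂ (· * ·) (Finset.prod_equiv r.symm (by simp) fun i _ => ?_)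
      (Finset.prod_congr rfl fun i _ => ?_)
    · obtain ⟨k, rfl⟩ := r.surjective i
      have := congrFun (hF x2) k
      simp only [Function.comp, Equiv.symm_apply_apply] at this ⊢
      rw [← this]; rfl
    · simp only [E, Equiv.piEquivPiSubtypeProd_symm_apply, i.2, dif_neg, not_false_eq_true]
  have hone : ∑ x2, prodLaw (fun i : {i // ¬ i ∈ Set.range e} => μ i) x2 = 1 := by
    convert sum_prodLaw (μ := fun i : {i // ¬ i ∈ Set.range e} => μ i) fun i => hμ i
  simp_rw [hF, hP]
  rw [← Finset.sum_mul, ← Finset.mul_sum]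
  refine congrArg₂ (· * ·) ?_ rfl
  convert mul_one _

theorem sum_prodLaw_eval [DecidableEq ι] {μ : ι → Ω → ℝ} (hμ : ∀ i, ∑ a, μ i a = 1) (i : ι)
    (F : Ω → ℝ) : ∑ x, prodLaw μ x * F (x i) = ∑ a, μ i a * F a := by
  have h := sum_prodLaw_comp hμ (e := fun _ : Unit => i) (fun _ _ _ => rfl) (fun z => F (z ()))
  simp only [Function.comp] at h
  rw [h, ← (Equiv.funUnique Unit Ω).symm.sum_comp]
  simp [prodLaw]

theorem sum_prodLaw_eval_pair [DecidableEq ι] {μ : ι → Ω → ℝ} (hμ : ∀ i, ∑ a, μ i a = 1)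
    {i j : ι} (hij : i ≠ j) (F : Ω → Ω → ℝ) :
    ∑ x, prodLaw μ x * F (x i) (x j) = ∑ a, ∑ b, μ i a * μ j b * F a b := by
  have he : Function.Injective ![i, j] := by
    intro k l
    fin_cases k <;> fin_cases l <;> simp [hij, hij.symm]
  have h := sum_prodLaw_comp hμ he (fun z => F (z 0) (z 1))
  simp only [Function.comp, Matrix.cons_val_zero, Matrix.cons_val_one] at h
  rw [h, ← (finTwoArrowEquiv Ω).symm.sum_comp, Fintype.sum_prod_type]
  simp [prodLaw, finTwoArrowEquiv, Fin.prod_univ_two]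

/-- A sequence of pairs is a pair of sequences. -/
theorem sum_arrow_prod [DecidableEq ι] (F : (ι → Ω) → (ι → Ω') → ℝ) :
    ∑ x, ∑ y, F x y = ∑ z : ι → Ω × Ω', F (fun i => (z i).1) (fun i => (z i).2) := by
  rw [← Fintype.sum_prod_type',
    ← (Equiv.arrowProdEquivProdArrow ι (fun _ => Ω) (fun _ => Ω')).sum_comp]
  rfl

/-- Variance of a sum of independent centred variables: the off-diagonal terms factor through the
vanishing mean. -/
theorem sum_prodLaw_sq [DecidableEq ι] {p : Ω → ℝ} (hp : ∑ a, p a = 1) {g : Ω → ℝ}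
    (hg : ∑ a, p a * g a = 0) :
    ∑ x : ι → Ω, prodLaw (fun _ => p) x * (∑ i, g (x i)) ^ 2 =
      Fintype.card ι * ∑ a, p a * g a ^ 2 := by
  have h : ∀ x : ι → Ω, prodLaw (fun _ => p) x * (∑ i, g (x i)) ^ 2 =
      ∑ i, ∑ j, prodLaw (fun _ => p) x * (g (x i) * g (x j)) := by
    intro x
    rw [sq, Finset.sum_mul_sum, Finset.mul_sum]
    simp_rw [Finset.mul_sum]
  simp_rw [h]
  rw [Finset.sum_comm]
  have h2 : ∀ i : ι, ∑ x : ι → Ω, ∑ j, prodLaw (fun _ => p) x * (g (x i) * g (x j)) =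
      ∑ a, p a * g a ^ 2 := by
    intro i
    rw [Finset.sum_comm, Finset.sum_eq_single i]
    · rw [sum_prodLaw_eval (μ := fun _ => p) (fun _ => hp) i (fun a => g a * g a)]
      simp_rw [sq]
    · intro j _ hj
      rw [sum_prodLaw_eval_pair (μ := fun _ => p) (fun _ => hp) hj.symm (fun a b => g a * g b)]
      have : ∀ a b, p a * p b * (g a * g b) = (p a * g a) * (p b * g b) := fun a b => by ring
      simp_rw [this, ← Finset.mul_sum, hg]
      simp
    · simp
  simp [h2]

/-- A one-sided weak law of large numbers. -/
theorem tendsto_prodLaw_sum_lt {p : Ω → ℝ} (hp : p ∈ stdSimplex ℝ Ω) (f : Ω → ℝ) {γ : ℝ}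
    (hγ : 0 < γ) :
    Tendsto (fun m : ℕ => ∑ z : Fin m → Ω, prodLaw (fun _ => p) z *
      ind (∑ i, f (z i) < m * (∑ a, p a * f a - γ))) atTop (𝓝 0) := by
  set μ := ∑ a, p a * f a with hμ
  set V := ∑ a, p a * (f a - μ) ^ 2 with hV
  have hlim : Tendsto (fun m : ℕ => V / γ ^ 2 * (1 / (m : ℝ))) atTop (𝓝 0) := by
    simpa using (tendsto_one_div_atTop_nhds_zero_nat (𝕜 := ℝ)).const_mul (V / γ ^ 2)
  refine squeeze_zero' (Eventually.of_forall fun m => Finset.sum_nonneg fun z _ =>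
    mul_nonneg (prodLaw_nonneg (fun _ => hp.1) z) (ind_nonneg _)) ?_ hlim
  filter_upwards [eventually_gt_atTop 0] with m hm
  have hm' : (0 : ℝ) < m := by exact_mod_cast hm
  have hg : ∑ a, p a * (f a - μ) = 0 := by
    simp_rw [mul_sub, Finset.sum_sub_distrib, ← Finset.sum_mul]
    rw [hp.2, ← hμ]; ring
  have h2 := sum_prodLaw_sq (ι := Fin m) hp.2 hg
  -- Chebyshev: on the event the deviation from the mean exceeds `m * γ`, so its square over `(m *
  -- γ) ^ 2` is at least one.
  have hle : ∀ z : Fin m → Ω, ind (∑ i, f (z i) < m * (μ - γ)) ≤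
      (∑ i, (f (z i) - μ)) ^ 2 / (m * γ) ^ 2 := by
    intro z
    refine ind_le (by positivity) fun h => ?_
    rw [one_le_div (by positivity)]
    have h3 : ∑ i, (f (z i) - μ) = ∑ i, f (z i) - m * μ := by
      simp [Finset.sum_sub_distrib]
    rw [h3]
    nlinarith [mul_pos hm' hγ]
  calc _ ≤ ∑ z : Fin m → Ω, prodLaw (fun _ => p) z *
        ((∑ i, (f (z i) - μ)) ^ 2 / (m * γ) ^ 2) :=
        Finset.sum_le_sum fun z _ =>
          mul_le_mul_of_nonneg_left (hle z) (prodLaw_nonneg (fun _ => hp.1) z)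
    _ = (m * V) / (m * γ) ^ 2 := by
        simp_rw [mul_div_assoc']
        rw [← Finset.sum_div, h2]
        simp [hV]
    _ = _ := by field_simp

/-- The asymptotic equipartition property: a product of independent positive factors is rarely much
smaller than its typical value. -/
theorem tendsto_prodLaw_prod_lt {p : Ω → ℝ} (hp : p ∈ stdSimplex ℝ Ω) (g : Ω → ℝ)
    (hg : ∀ a, 0 < p a → 0 < g a) {μ : ℝ} (hμ : μ = ∑ a, p a * Real.log (g a)) {γ : ℝ}
    (hγ : 0 < γ) :
    Tendsto (fun m : ℕ => ∑ z : Fin m → Ω, prodLaw (fun _ => p) z *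
      ind (∏ i, g (z i) < Real.exp (m * (μ - γ)))) atTop (𝓝 0) := by
  refine squeeze_zero (fun m => Finset.sum_nonneg fun z _ =>
    mul_nonneg (prodLaw_nonneg (fun _ => hp.1) z) (ind_nonneg _)) (fun m => ?_)
    (tendsto_prodLaw_sum_lt hp (fun a => Real.log (g a)) hγ)
  refine Finset.sum_le_sum fun z _ => ?_
  by_cases hz : ∀ i, 0 < p (z i)
  · refine mul_le_mul_of_nonneg_left (ind_mono fun h => ?_) (prodLaw_nonneg (fun _ => hp.1) z)
    have hpos : ∀ i, 0 < g (z i) := fun i => hg _ (hz i)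
    rw [← hμ, ← Real.log_prod (fun i _ => (hpos i).ne'),
      Real.log_lt_iff_lt_exp (Finset.prod_pos fun i _ => hpos i)]
    exact h
  -- A sequence with a letter of mass zero has mass zero, so the value of the logarithm outside the
  -- support is irrelevant.
  · push Not at hz
    obtain ⟨i, hi⟩ := hz
    have : prodLaw (fun _ => p) z = 0 :=
      Finset.prod_eq_zero (Finset.mem_univ i) (le_antisymm hi (hp.1 _))
    simp [this]

end FiniteProbability

end TwoWayRelay

namespace TwoWayRelay

open Filter Topology

/-! ### Random coding -/

section Picking

open Classical in
/-- Some element that satisfies `P`, if there is one. -/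
def pick {S : Type*} [Nonempty S] (P : S → Prop) : S :=
  if h : ∃ s, P s then h.choose else Classical.arbitrary S

/-- Every decoder built below from a typicality test is a `pick`. Which candidate it returns is
immaterial, because the analysis charges an error either to rejection of the truth or to acceptance
of an impostor. -/
theorem of_pick_ne {S : Type*} [Nonempty S] {P : S → Prop} {s : S} (h : pick P ≠ s) :
    ¬P s ∨ ∃ s', s' ≠ s ∧ P s' := by
  by_cases hs : P s
  · have hex : ∃ s, P s := ⟨s, hs⟩
    refine Or.inr ⟨_, h, ?_⟩
    unfold pick
    rw [dif_pos hex]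
    exact hex.choose_spec
  · exact Or.inl hs

theorem ind_pick_ne_le {S : Type*} [Nonempty S] [Fintype S] (P : S → Prop) (s : S) :
    ind (pick P ≠ s) ≤ ind (¬P s) + ∑ s', ind (s' ≠ s) * ind (P s') := by
  refine (ind_mono of_pick_ne).trans ((ind_or_le _ _).trans (add_le_add le_rfl ?_))
  exact (ind_exists_le _).trans_eq (Finset.sum_congr rfl fun _ _ => ind_and _ _)

theorem nonempty_of_mem_stdSimplex {X : Type*} [Fintype X] {p : X → ℝ} (hp : p ∈ stdSimplex ℝ X) :
    Nonempty X := by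
  by_contra h
  rw [not_nonempty_iff] at h
  have := hp.2
  simp at this

/-- Derandomisation: passes from a bound on the ensemble mean to a single code. -/
theorem exists_le_of_mean_le {Ω : Type*} [Fintype Ω] {w : Ω → ℝ} (hw : w ∈ stdSimplex ℝ Ω)
    {F : Ω → ℝ} {C : ℝ} (h : ∑ ω, w ω * F ω ≤ C) : ∃ ω, F ω ≤ C := by
  by_contra! hF
  have h1 : ∑ ω, w ω * (F ω - C) ≤ 0 := by
    simp_rw [mul_sub, Finset.sum_sub_distrib, ← Finset.sum_mul, hw.2]
    linarith
  have h2 : ∀ ω ∈ Finset.univ, 0 ≤ w ω * (F ω - C) := fun ω _ =>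
    mul_nonneg (hw.1 ω) (by linarith [hF ω])
  have h3 := (Finset.sum_eq_zero_iff_of_nonneg h2).1 (le_antisymm h1 (Finset.sum_nonneg h2))
  have h4 : ∀ ω, w ω = 0 := fun ω => by
    rcases mul_eq_zero.1 (h3 ω (Finset.mem_univ ω)) with h | h
    · exact h
    · linarith [hF ω]
  have := hw.2
  simp [h4] at this

end Picking

/-! ### Random uplink codebooks with a random hash, in one shot. -/

section Uplink

variable {A B Y S T K L : Type*} [Fintype A] [Fintype B] [Fintype Y] [Fintype S] [Fintype T]
  [Fintype K] [DecidableEq S] [DecidableEq T] [DecidableEq Y]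

/-- The uniform mass function. -/
def unif (K : Type*) [Fintype K] : K → ℝ := fun _ => (Fintype.card K : ℝ)⁻¹

theorem unif_mem [Nonempty K] : unif K ∈ stdSimplex ℝ K :=
  ⟨fun _ => by unfold unif; positivity, by simp [unif]⟩

/-- The mean over two random codebooks with independent letters and a uniformly random hash
function. -/
def hashMean (PA : A → ℝ) (PB : B → ℝ) (F : (S → A) → (T → B) → (Y → K) → ℝ) : ℝ :=
  ∑ cA, ∑ cB, ∑ h, prodLaw (fun _ => PA) cA * prodLaw (fun _ => PB) cB *
    prodLaw (fun _ => unif K) h * F cA cB h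

variable {PA : A → ℝ} {PB : B → ℝ}

theorem hashMean_mono (hA : PA ∈ stdSimplex ℝ A) (hB : PB ∈ stdSimplex ℝ B) [Nonempty K]
    {F G : (S → A) → (T → B) → (Y → K) → ℝ} (h : ∀ cA cB h, F cA cB h ≤ G cA cB h) :
    hashMean PA PB F ≤ hashMean PA PB G :=
  Finset.sum_le_sum fun cA _ => Finset.sum_le_sum fun cB _ => Finset.sum_le_sum fun k _ =>
    mul_le_mul_of_nonneg_left (h cA cB k) (mul_nonneg (mul_nonneg
      (prodLaw_nonneg (fun _ => hA.1) _) (prodLaw_nonneg (fun _ => hB.1) _))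
      (prodLaw_nonneg (fun _ => (unif_mem (K := K)).1) _))

theorem hashMean_add (F G : (S → A) → (T → B) → (Y → K) → ℝ) :
    hashMean PA PB (fun a b h => F a b h + G a b h) = hashMean PA PB F + hashMean PA PB G := by
  simp only [hashMean, mul_add, Finset.sum_add_distrib]

theorem hashMean_const_mul (c : ℝ) (F : (S → A) → (T → B) → (Y → K) → ℝ) :
    hashMean PA PB (fun a b h => c * F a b h) = c * hashMean PA PB F := by
  simp only [hashMean, Finset.mul_sum]
  refine Finset.sum_congr rfl fun _ _ => Finset.sum_congr rfl fun _ _ =>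
    Finset.sum_congr rfl fun _ _ => by ring

theorem hashMean_sum {ι : Type*} [Fintype ι] (F : ι → (S → A) → (T → B) → (Y → K) → ℝ) :
    hashMean PA PB (fun a b h => ∑ i, F i a b h) = ∑ i, hashMean PA PB (F i) := by
  simp only [hashMean, Finset.mul_sum]
  rw [Finset.sum_comm (γ := ι)]
  refine Finset.sum_congr rfl fun _ _ => ?_
  rw [Finset.sum_comm (γ := ι)]
  refine Finset.sum_congr rfl fun _ _ => ?_
  rw [Finset.sum_comm (γ := ι)]

theorem hashMean_swap (F : (S → A) → (T → B) → (Y → K) → ℝ) :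
    hashMean PA PB F = hashMean PB PA (fun b a h => F a b h) := by
  unfold hashMean
  rw [Finset.sum_comm]
  refine Finset.sum_congr rfl fun _ _ => Finset.sum_congr rfl fun _ _ =>
    Finset.sum_congr rfl fun _ _ => by ring

theorem hashMean_eval (hA : PA ∈ stdSimplex ℝ A) (hB : PB ∈ stdSimplex ℝ B) [Nonempty K]
    (s : S) (t : T) (G : A → B → ℝ) :
    hashMean (Y := Y) (K := K) PA PB (fun cA cB _ => G (cA s) (cB t)) =
      ∑ a, ∑ b, PA a * PB b * G a b := by
  have h1 : ∀ (cA : S → A) (cB : T → B), ∑ h : Y → K, prodLaw (fun _ => PA) cA *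
      prodLaw (fun _ => PB) cB * prodLaw (fun _ => unif K) h * G (cA s) (cB t) =
      prodLaw (fun _ => PA) cA * (prodLaw (fun _ => PB) cB * G (cA s) (cB t)) := by
    intro cA cB
    rw [← Finset.sum_mul, ← Finset.mul_sum, sum_prodLaw fun _ => unif_mem.2]
    ring
  unfold hashMean
  simp_rw [h1, ← Finset.mul_sum, sum_prodLaw_eval (μ := fun _ : T => PB) (fun _ => hB.2) t]
  rw [sum_prodLaw_eval (μ := fun _ : S => PA) (fun _ => hA.2) s
    (fun a => ∑ b, PB b * G a b)]
  simp_rw [Finset.mul_sum, mul_assoc]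

theorem hashMean_eval_pair (hA : PA ∈ stdSimplex ℝ A) (hB : PB ∈ stdSimplex ℝ B) [Nonempty K]
    {s s' : S} (hs : s ≠ s') (t : T) (G : A → A → B → ℝ) :
    hashMean (Y := Y) (K := K) PA PB (fun cA cB _ => G (cA s) (cA s') (cB t)) =
      ∑ a, ∑ a', ∑ b, PA a * PA a' * PB b * G a a' b := by
  have h1 : ∀ (cA : S → A) (cB : T → B), ∑ h : Y → K, prodLaw (fun _ => PA) cA *
      prodLaw (fun _ => PB) cB * prodLaw (fun _ => unif K) h * G (cA s) (cA s') (cB t) =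
      prodLaw (fun _ => PA) cA * (prodLaw (fun _ => PB) cB * G (cA s) (cA s') (cB t)) := by
    intro cA cB
    rw [← Finset.sum_mul, ← Finset.mul_sum, sum_prodLaw fun _ => unif_mem.2]
    ring
  unfold hashMean
  simp_rw [h1, ← Finset.mul_sum, sum_prodLaw_eval (μ := fun _ : T => PB) (fun _ => hB.2) t]
  rw [sum_prodLaw_eval_pair (μ := fun _ : S => PA) (fun _ => hA.2) hs
    (fun a a' => ∑ b, PB b * G a a' b)]
  simp_rw [Finset.mul_sum, mul_assoc]

/-- The hash values of two distinct sequences are independent of each other and of the codebooks, so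
the collision probability factors out. Distinctness is essential: a sequence always collides with
itself. -/
theorem hashMean_mul_hash {y y' : Y} (hy : y ≠ y') [Nonempty K] (F : (S → A) → (T → B) → ℝ)
    (H : K → K → ℝ) :
    hashMean (K := K) PA PB (fun cA cB h => F cA cB * H (h y) (h y')) =
      (∑ k, ∑ k', unif K k * unif K k' * H k k') *
        hashMean (Y := Y) (K := K) PA PB (fun cA cB _ => F cA cB) := by
  unfold hashMean
  rw [Finset.mul_sum]
  refine Finset.sum_congr rfl fun cA _ => ?_
  rw [Finset.mul_sum]
  refine Finset.sum_congr rfl fun cB _ => ?_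
  rw [← sum_prodLaw_eval_pair (μ := fun _ : Y => unif K) (fun _ => unif_mem.2) hy H,
    ← Finset.sum_mul, ← Finset.mul_sum, sum_prodLaw fun _ => unif_mem.2, Finset.sum_mul]
  refine Finset.sum_congr rfl fun h _ => by ring

/-- The decoder that knows the codeword `b` and the index `l` of the hashed sequence. -/
def hashDecode [Nonempty S] (Typ : A → B → Y → Prop) (π : K → L) (cA : S → A) (h : Y → K) (b : B)
    (l : L) : S :=
  pick fun s => ∃ y, π (h y) = l ∧ Typ (cA s) b y

/-- An impostor `s'` is accepted because of some witness in the bin. If the witness is the received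
sequence itself, this is an ordinary channel decoding error; otherwise two different sequences share
a bin. The two cases give the two rate constraints. -/
theorem ind_hashDecode_ne_le [Nonempty S] (Typ : A → B → Y → Prop) (π : K → L) (cA : S → A)
    (h : Y → K) (b : B) (s : S) (y : Y) :
    ind (hashDecode Typ π cA h b (π (h y)) ≠ s) ≤ ind (¬Typ (cA s) b y) +
      ∑ s', ind (s' ≠ s) * (ind (Typ (cA s') b y) +
        ∑ y', ind (y ≠ y') * (ind (Typ (cA s') b y') * ind (π (h y') = π (h y)))) := by
  refine (ind_pick_ne_le _ s).trans (add_le_add (ind_mono fun hn ht => hn ⟨y, rfl, ht⟩)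
    (Finset.sum_le_sum fun s' _ => mul_le_mul_of_nonneg_left ?_ (ind_nonneg _)))
  have h0 : ∀ y', 0 ≤ ind (y ≠ y') * (ind (Typ (cA s') b y') * ind (π (h y') = π (h y))) :=
    fun y' => mul_nonneg (ind_nonneg _) (mul_nonneg (ind_nonneg _) (ind_nonneg _))
  refine ind_le (add_nonneg (ind_nonneg _) (Finset.sum_nonneg fun y' _ => h0 y')) ?_
  rintro ⟨y', hy', ht⟩
  by_cases hyy : y = y'
  · subst hyy
    rw [ind_of ht]
    linarith [Finset.sum_nonneg fun y' (_ : y' ∈ Finset.univ) => h0 y']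
  · have := Finset.single_le_sum (fun y' _ => h0 y') (Finset.mem_univ y')
    rw [ind_of hyy, ind_of ht, ind_of hy'] at this
    linarith [ind_nonneg (Typ (cA s') b y)]

/-- The mean error probability of joint decoding from a hash value and one of the two codewords. -/
theorem hashMean_error_le (hA : PA ∈ stdSimplex ℝ A) (hB : PB ∈ stdSimplex ℝ B) [Nonempty K]
    [Nonempty S] {W : A → B → Y → ℝ} (hW : ∀ a b, W a b ∈ stdSimplex ℝ Y)
    (Typ : A → B → Y → Prop) (π : K → L) {θ N c : ℝ}
    (hθ : ∀ a b y, Typ a b y → ∑ a', PA a' * W a' b y ≤ θ * W a b y)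
    (hN : ∀ a b y, Typ a b y → 1 ≤ N * W a b y) (hθ0 : 0 ≤ θ) (hN0 : 0 ≤ N)
    (hc : ∑ k, ∑ k', unif K k * unif K k' * ind (π k' = π k) ≤ c) (s : S) (t : T) :
    hashMean (K := K) PA PB (fun cA cB h => ∑ y, W (cA s) (cB t) y *
        ind (hashDecode Typ π cA h (cB t) (π (h y)) ≠ s)) ≤
      (∑ a, ∑ b, PA a * PB b * ∑ y, W a b y * ind (¬Typ a b y)) +
        ((Fintype.card S : ℝ) - 1) * (θ + c * N) := by
  have hpos : ∀ a a' b, 0 ≤ PA a * PA a' * PB b := fun a a' b =>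
    mul_nonneg (mul_nonneg (hA.1 a) (hA.1 a')) (hB.1 b)
  have hone : ∑ a, ∑ a', ∑ b, PA a * PA a' * PB b = 1 := by
    simp_rw [← Finset.mul_sum, hB.2, mul_one, ← Finset.mul_sum, hA.2, mul_one]
    exact hA.2
  -- The wrong codeword is independent of the output given `b`. Averaging over the true codeword
  -- leaves the output law, which `hθ` compares with `W` at the wrong codeword: a change of measure
  -- at price `θ`.
  have hwrong : ∀ s', s' ≠ s → hashMean (Y := Y) (K := K) PA PB (fun cA (cB : T → B) _ =>
      ∑ y, W (cA s) (cB t) y * ind (Typ (cA s') (cB t) y)) ≤ θ := by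
    intro s' hs'
    rw [hashMean_eval_pair hA hB hs'.symm t
      (fun a a' b => ∑ y, W a b y * ind (Typ a' b y))]
    calc _ = ∑ a', ∑ b, PA a' * PB b * ∑ y, (∑ a, PA a * W a b y) * ind (Typ a' b y) := by
          rw [Finset.sum_comm]
          refine Finset.sum_congr rfl fun a' _ => ?_
          rw [Finset.sum_comm]
          refine Finset.sum_congr rfl fun b _ => ?_
          simp_rw [Finset.sum_mul, Finset.mul_sum]
          rw [Finset.sum_comm]
          refine Finset.sum_congr rfl fun y _ => Finset.sum_congr rfl fun a _ => by ring
      _ ≤ ∑ a', ∑ b, PA a' * PB b * ∑ y, θ * W a' b y := by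
          refine Finset.sum_le_sum fun a' _ => Finset.sum_le_sum fun b _ =>
            mul_le_mul_of_nonneg_left (Finset.sum_le_sum fun y _ => ?_)
              (mul_nonneg (hA.1 a') (hB.1 b))
          by_cases h : Typ a' b y
          · rw [ind_of h, mul_one]
            exact hθ _ _ _ h
          · rw [ind_of_not h, mul_zero]
            exact mul_nonneg hθ0 ((hW a' b).1 y)
      _ = θ := by
          simp_rw [← Finset.mul_sum, (hW _ _).2, mul_one, ← Finset.sum_mul, ← Finset.mul_sum,
            hB.2, mul_one, hA.2, one_mul]
  -- Collision probability, at most `c`, times the number of sequences typical with the wrong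
  -- codeword, at most `N`.
  have hcoll : ∀ s', s' ≠ s → hashMean (Y := Y) (K := K) PA PB (fun cA (cB : T → B) h =>
      ∑ y, W (cA s) (cB t) y * ∑ y', ind (y ≠ y') * (ind (Typ (cA s') (cB t) y') *
        ind (π (h y') = π (h y)))) ≤ c * N := by
    intro s' hs'
    have hc0 : 0 ≤ c := le_trans (Finset.sum_nonneg fun k _ => Finset.sum_nonneg fun k' _ =>
      mul_nonneg (mul_nonneg (unif_mem.1 k) (unif_mem.1 k')) (ind_nonneg _)) hc
    have hterm : ∀ y y', hashMean (Y := Y) (K := K) PA PB (fun cA (cB : T → B) h =>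
        ind (y ≠ y') * ((W (cA s) (cB t) y * ind (Typ (cA s') (cB t) y')) *
          ind (π (h y') = π (h y)))) ≤
        c * ∑ a, ∑ a', ∑ b, PA a * PA a' * PB b * (W a b y * ind (Typ a' b y')) := by
      intro y y'
      have h0 : 0 ≤ ∑ a, ∑ a', ∑ b, PA a * PA a' * PB b * (W a b y * ind (Typ a' b y')) :=
        Finset.sum_nonneg fun a _ => Finset.sum_nonneg fun a' _ => Finset.sum_nonneg fun b _ =>
          mul_nonneg (hpos a a' b) (mul_nonneg ((hW a b).1 y) (ind_nonneg _))
      by_cases hy : y = y'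
      · rw [ind_of_not (not_not.2 hy), hashMean_const_mul, zero_mul]
        exact mul_nonneg hc0 h0
      · rw [ind_of hy, hashMean_const_mul, one_mul,
          hashMean_mul_hash hy (fun cA cB => W (cA s) (cB t) y * ind (Typ (cA s') (cB t) y'))
            (fun k k' => ind (π k' = π k)),
          hashMean_eval_pair hA hB hs'.symm t (fun a a' b => W a b y * ind (Typ a' b y'))]
        exact mul_le_mul_of_nonneg_right hc h0
    calc _ = ∑ y, ∑ y', hashMean (Y := Y) (K := K) PA PB (fun cA (cB : T → B) h =>
          ind (y ≠ y') * ((W (cA s) (cB t) y * ind (Typ (cA s') (cB t) y')) *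
            ind (π (h y') = π (h y)))) := by
          simp_rw [← hashMean_sum]
          congr 1
          funext cA cB h
          simp_rw [Finset.mul_sum]
          refine Finset.sum_congr rfl fun y _ => Finset.sum_congr rfl fun y' _ => by ring
      _ ≤ ∑ y, ∑ y', c * ∑ a, ∑ a', ∑ b, PA a * PA a' * PB b *
          (W a b y * ind (Typ a' b y')) :=
          Finset.sum_le_sum fun y _ => Finset.sum_le_sum fun y' _ => hterm y y'
      _ = c * ∑ a, ∑ a', ∑ b, PA a * PA a' * PB b * ((∑ y, W a b y) *
          ∑ y', ind (Typ a' b y')) := by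
          simp_rw [← Finset.mul_sum]
          congr 1
          simp_rw [Finset.sum_mul_sum, Finset.mul_sum]
          rw [← Fintype.sum_prod_type', Finset.sum_comm]
          refine Finset.sum_congr rfl fun a _ => ?_
          rw [Finset.sum_comm]
          refine Finset.sum_congr rfl fun a' _ => ?_
          rw [Finset.sum_comm]
          refine Finset.sum_congr rfl fun b _ => ?_
          rw [← Fintype.sum_prod_type']
      -- Counting: each typical `y'` has mass at least `1 / N` under a law of total mass one.
      _ ≤ c * ∑ a, ∑ a', ∑ b, PA a * PA a' * PB b * N := by
          refine mul_le_mul_of_nonneg_left (Finset.sum_le_sum fun a _ => Finset.sum_le_sum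
            fun a' _ => Finset.sum_le_sum fun b _ =>
            mul_le_mul_of_nonneg_left ?_ (hpos a a' b)) hc0
          rw [(hW a b).2, one_mul, ← mul_one N, ← (hW a' b).2, Finset.mul_sum]
          exact Finset.sum_le_sum fun y _ => ind_le (mul_nonneg hN0 ((hW a' b).1 y)) (hN a' b y)
      _ = c * N := by
          simp_rw [← Finset.sum_mul]
          rw [hone, one_mul]
  calc _ ≤ hashMean (Y := Y) (K := K) PA PB (fun cA (cB : T → B) h =>
        (∑ y, W (cA s) (cB t) y * ind (¬Typ (cA s) (cB t) y)) +
        ∑ s', ind (s' ≠ s) * ((∑ y, W (cA s) (cB t) y * ind (Typ (cA s') (cB t) y)) +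
          ∑ y, W (cA s) (cB t) y * ∑ y', ind (y ≠ y') * (ind (Typ (cA s') (cB t) y') *
            ind (π (h y') = π (h y))))) := by
        refine hashMean_mono hA hB fun cA cB h => ?_
        refine (Finset.sum_le_sum fun y _ => mul_le_mul_of_nonneg_left
          (ind_hashDecode_ne_le Typ π cA h (cB t) s y) ((hW _ _).1 y)).trans_eq ?_
        simp_rw [mul_add (W _ _ _), Finset.sum_add_distrib]
        congr 1
        refine (Finset.sum_congr rfl fun y _ => Finset.mul_sum _ _ _).trans ?_
        rw [Finset.sum_comm]
        refine Finset.sum_congr rfl fun s' _ => ?_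
        rw [← Finset.sum_add_distrib, Finset.mul_sum]
        refine Finset.sum_congr rfl fun y _ => by ring
    _ = (∑ a, ∑ b, PA a * PB b * ∑ y, W a b y * ind (¬Typ a b y)) +
        ∑ s', ind (s' ≠ s) * (hashMean (Y := Y) (K := K) PA PB (fun cA (cB : T → B) _ =>
          ∑ y, W (cA s) (cB t) y * ind (Typ (cA s') (cB t) y)) +
        hashMean (Y := Y) (K := K) PA PB (fun cA (cB : T → B) h =>
          ∑ y, W (cA s) (cB t) y * ∑ y', ind (y ≠ y') * (ind (Typ (cA s') (cB t) y') *
            ind (π (h y') = π (h y))))) := by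
        rw [hashMean_add, hashMean_eval hA hB s t (fun a b => ∑ y, W a b y * ind (¬Typ a b y)),
          hashMean_sum]
        simp_rw [hashMean_const_mul, hashMean_add]
    _ ≤ _ := by
        rw [← sum_ind_ne s, Finset.sum_mul]
        refine add_le_add le_rfl (Finset.sum_le_sum fun s' _ => ?_)
        by_cases hs : s' ≠ s
        · exact mul_le_mul_of_nonneg_left (add_le_add (hwrong s' hs) (hcoll s' hs)) (ind_nonneg _)
        · simp [ind_of_not hs]

end Uplink

end TwoWayRelay

namespace TwoWayRelay

open Filter Topology

/-! ### Random superposition codes for the downlink, in one shot. -/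

section Superposition

variable {U X Y I J : Type*} [Fintype U] [Fintype X] [Fintype Y] [Fintype I] [Fintype J]
  [DecidableEq I] [DecidableEq J]

/-- The law of a random cloud: a centre `u` and, given `u`, independent satellites. -/
def cloudLaw (I : Type*) [Fintype I] (PU : U → ℝ) (κ : U → X → ℝ) (c : U × (I → X)) : ℝ :=
  PU c.1 * prodLaw (fun _ => κ c.1) c.2

variable {PU : U → ℝ} {κ : U → X → ℝ}

theorem sum_cloudLaw_mul (F : U → (I → X) → ℝ) :
    ∑ c, cloudLaw I PU κ c * F c.1 c.2 = ∑ u, PU u * ∑ xs, prodLaw (fun _ => κ u) xs * F u xs := by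
  rw [Fintype.sum_prod_type]
  simp_rw [cloudLaw, Finset.mul_sum, mul_assoc]

theorem cloudLaw_mem (hU : PU ∈ stdSimplex ℝ U) (hκ : ∀ u, κ u ∈ stdSimplex ℝ X) :
    cloudLaw I PU κ ∈ stdSimplex ℝ (U × (I → X)) := by
  refine ⟨fun c => mul_nonneg (hU.1 _) (prodLaw_nonneg (fun _ => (hκ _).1) _), ?_⟩
  have := sum_cloudLaw_mul (I := I) (PU := PU) (κ := κ) (fun _ _ => 1)
  simp only [mul_one] at this
  rw [this]
  simp_rw [sum_prodLaw (fun _ => (hκ _).2), mul_one, hU.2]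

theorem sum_cloudLaw_eval (hκ : ∀ u, κ u ∈ stdSimplex ℝ X) (i : I) (F : U → X → ℝ) :
    ∑ c, cloudLaw I PU κ c * F c.1 (c.2 i) = ∑ u, PU u * ∑ x, κ u x * F u x := by
  rw [sum_cloudLaw_mul (fun u xs => F u (xs i))]
  refine Finset.sum_congr rfl fun u _ => ?_
  rw [sum_prodLaw_eval (μ := fun _ : I => κ u) (fun _ => (hκ u).2) i (F u)]

theorem sum_cloudLaw_eval_pair (hκ : ∀ u, κ u ∈ stdSimplex ℝ X) {i i' : I} (hi : i ≠ i')
    (F : U → X → X → ℝ) :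
    ∑ c, cloudLaw I PU κ c * F c.1 (c.2 i) (c.2 i') =
      ∑ u, PU u * ∑ x, ∑ x', κ u x * κ u x' * F u x x' := by
  rw [sum_cloudLaw_mul (fun u xs => F u (xs i) (xs i'))]
  refine Finset.sum_congr rfl fun u _ => ?_
  rw [sum_prodLaw_eval_pair (μ := fun _ : I => κ u) (fun _ => (hκ u).2) hi (F u)]

/-- The mean over a random superposition codebook. -/
def cloudMean (PU : U → ℝ) (κ : U → X → ℝ) (F : (J → U × (I → X)) → ℝ) : ℝ :=
  ∑ c, prodLaw (fun _ => cloudLaw I PU κ) c * F c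

theorem cloudMean_mono (hU : PU ∈ stdSimplex ℝ U) (hκ : ∀ u, κ u ∈ stdSimplex ℝ X)
    {F G : (J → U × (I → X)) → ℝ} (h : ∀ c, F c ≤ G c) : cloudMean PU κ F ≤ cloudMean PU κ G :=
  Finset.sum_le_sum fun _ _ => mul_le_mul_of_nonneg_left (h _)
    (prodLaw_nonneg (fun _ => (cloudLaw_mem hU hκ).1) _)

theorem cloudMean_add (F G : (J → U × (I → X)) → ℝ) :
    cloudMean PU κ (fun c => F c + G c) = cloudMean PU κ F + cloudMean PU κ G := by
  simp only [cloudMean, mul_add, Finset.sum_add_distrib]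

theorem cloudMean_const_mul (a : ℝ) (F : (J → U × (I → X)) → ℝ) :
    cloudMean PU κ (fun c => a * F c) = a * cloudMean PU κ F := by
  simp only [cloudMean, Finset.mul_sum]
  refine Finset.sum_congr rfl fun _ _ => by ring

theorem cloudMean_sum {ι : Type*} [Fintype ι] (F : ι → (J → U × (I → X)) → ℝ) :
    cloudMean PU κ (fun c => ∑ i, F i c) = ∑ i, cloudMean PU κ (F i) := by
  simp only [cloudMean, Finset.mul_sum]
  rw [Finset.sum_comm]

theorem cloudMean_eval (hU : PU ∈ stdSimplex ℝ U) (hκ : ∀ u, κ u ∈ stdSimplex ℝ X) (i : I) (j : J)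
    (F : U → X → ℝ) :
    cloudMean PU κ (fun c => F (c j).1 ((c j).2 i)) = ∑ u, PU u * ∑ x, κ u x * F u x := by
  unfold cloudMean
  rw [sum_prodLaw_eval (μ := fun _ : J => cloudLaw I PU κ) (fun _ => (cloudLaw_mem hU hκ).2) j
    (fun c => F c.1 (c.2 i)), sum_cloudLaw_eval hκ]

theorem cloudMean_eval_pair (hU : PU ∈ stdSimplex ℝ U) (hκ : ∀ u, κ u ∈ stdSimplex ℝ X)
    {i i' : I} (hi : i ≠ i') (j : J) (F : U → X → X → ℝ) :
    cloudMean PU κ (fun c => F (c j).1 ((c j).2 i) ((c j).2 i')) =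
      ∑ u, PU u * ∑ x, ∑ x', κ u x * κ u x' * F u x x' := by
  unfold cloudMean
  rw [sum_prodLaw_eval (μ := fun _ : J => cloudLaw I PU κ) (fun _ => (cloudLaw_mem hU hκ).2) j
    (fun c => F c.1 (c.2 i) (c.2 i')), sum_cloudLaw_eval_pair hκ hi]

theorem cloudMean_eval_clouds (hU : PU ∈ stdSimplex ℝ U) (hκ : ∀ u, κ u ∈ stdSimplex ℝ X)
    (i : I) {j j' : J} (hj : j ≠ j') (F : U → X → U → ℝ) :
    cloudMean PU κ (fun c => F (c j).1 ((c j).2 i) (c j').1) =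
      ∑ u, PU u * ∑ x, κ u x * ∑ u', PU u' * F u x u' := by
  unfold cloudMean
  rw [sum_prodLaw_eval_pair (μ := fun _ : J => cloudLaw I PU κ) (fun _ => (cloudLaw_mem hU hκ).2)
    hj (fun c c' => F c.1 (c.2 i) c'.1)]
  simp_rw [mul_assoc, ← Finset.mul_sum]
  rw [← sum_cloudLaw_eval hκ i (fun u x => ∑ u', PU u' * F u x u')]
  refine Finset.sum_congr rfl fun c _ => ?_
  rw [sum_cloudLaw_eval hκ i (fun u' _ => F c.1 (c.2 i) u')]
  simp_rw [← Finset.sum_mul, (hκ _).2, one_mul]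

/-- The mean error probability of decoding the cloud centre. -/
theorem cloudMean_centre_error_le (hU : PU ∈ stdSimplex ℝ U) (hκ : ∀ u, κ u ∈ stdSimplex ℝ X)
    {V : X → Y → ℝ} (hV : ∀ x, V x ∈ stdSimplex ℝ Y) (T : U → Y → Prop) {θ : ℝ} (hθ0 : 0 ≤ θ)
    (hθ : ∀ u y, T u y → ∑ u', PU u' * ∑ x, κ u' x * V x y ≤ θ * ∑ x, κ u x * V x y)
    (i : I) (j : J) :
    cloudMean (I := I) PU κ (fun c => ∑ y, V ((c j).2 i) y *
        (ind (¬T (c j).1 y) + ∑ j', ind (j' ≠ j) * ind (T (c j').1 y))) ≤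
      (∑ u, PU u * ∑ x, κ u x * ∑ y, V x y * ind (¬T u y)) +
        ((Fintype.card J : ℝ) - 1) * θ := by
  -- A wrong centre is independent of the output, so only the law of the output given the centre
  -- matters, with the satellite averaged out; `hθ` is stated for this averaged channel.
  have hwrong : ∀ j', j' ≠ j → cloudMean (I := I) PU κ (fun c => ∑ y, V ((c j).2 i) y *
      ind (T (c j').1 y)) ≤ θ := by
    intro j' hj'
    rw [cloudMean_eval_clouds hU hκ i hj'.symm (fun _ x u' => ∑ y, V x y * ind (T u' y))]
    calc _ = ∑ u', PU u' * ∑ y, (∑ u, PU u * ∑ x, κ u x * V x y) * ind (T u' y) := by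
          simp_rw [Finset.sum_mul, Finset.mul_sum, Finset.sum_mul]
          simp_rw [Finset.mul_sum]
          calc _ = ∑ u, ∑ u', ∑ x, ∑ y, PU u * (κ u x * (PU u' * (V x y * ind (T u' y)))) :=
                Finset.sum_congr rfl fun u _ => Finset.sum_comm
            _ = ∑ u', ∑ u, ∑ x, ∑ y, PU u * (κ u x * (PU u' * (V x y * ind (T u' y)))) :=
                Finset.sum_comm
            _ = ∑ u', ∑ u, ∑ y, ∑ x, PU u * (κ u x * (PU u' * (V x y * ind (T u' y)))) :=
                Finset.sum_congr rfl fun u' _ => Finset.sum_congr rfl fun u _ => Finset.sum_comm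
            _ = ∑ u', ∑ y, ∑ u, ∑ x, PU u * (κ u x * (PU u' * (V x y * ind (T u' y)))) :=
                Finset.sum_congr rfl fun u' _ => Finset.sum_comm
            _ = _ := Finset.sum_congr rfl fun u' _ => Finset.sum_congr rfl fun y _ =>
                Finset.sum_congr rfl fun u _ => Finset.sum_congr rfl fun x _ => by ring
      _ ≤ ∑ u', PU u' * ∑ y, θ * ∑ x, κ u' x * V x y := by
          refine Finset.sum_le_sum fun u' _ => mul_le_mul_of_nonneg_left
            (Finset.sum_le_sum fun y _ => ?_) (hU.1 u')
          by_cases h : T u' y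
          · rw [ind_of h, mul_one]
            exact hθ _ _ h
          · rw [ind_of_not h, mul_zero]
            exact mul_nonneg hθ0 (Finset.sum_nonneg fun x _ =>
              mul_nonneg ((hκ u').1 x) ((hV x).1 y))
      _ = θ := by
          have : ∀ u', ∑ y, ∑ x, κ u' x * V x y = 1 := by
            intro u'
            rw [Finset.sum_comm]
            simp_rw [← Finset.mul_sum, (hV _).2, mul_one, (hκ u').2]
          simp_rw [← Finset.mul_sum, this, mul_one, ← Finset.sum_mul, hU.2, one_mul]
  calc _ = cloudMean (I := I) PU κ (fun c => (∑ y, V ((c j).2 i) y * ind (¬T (c j).1 y)) +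
        ∑ j', ind (j' ≠ j) * ∑ y, V ((c j).2 i) y * ind (T (c j').1 y)) := by
        congr 1
        funext c
        simp_rw [mul_add, Finset.sum_add_distrib, Finset.mul_sum]
        congr 1
        rw [Finset.sum_comm]
        refine Finset.sum_congr rfl fun _ _ => Finset.sum_congr rfl fun _ _ => by ring
    _ = (∑ u, PU u * ∑ x, κ u x * ∑ y, V x y * ind (¬T u y)) + ∑ j', ind (j' ≠ j) *
        cloudMean (I := I) PU κ (fun c => ∑ y, V ((c j).2 i) y * ind (T (c j').1 y)) := by
        rw [cloudMean_add, cloudMean_eval hU hκ i j (fun u x => ∑ y, V x y * ind (¬T u y)),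
          cloudMean_sum]
        simp_rw [cloudMean_const_mul]
    _ ≤ _ := by
        rw [← sum_ind_ne j, Finset.sum_mul]
        refine add_le_add le_rfl (Finset.sum_le_sum fun j' _ => ?_)
        by_cases hj : j' ≠ j
        · exact mul_le_mul_of_nonneg_left (hwrong j' hj) (ind_nonneg _)
        · simp [ind_of_not hj]

/-- The mean error probability of decoding the satellite, the cloud centre being known. -/
theorem cloudMean_satellite_error_le (hU : PU ∈ stdSimplex ℝ U) (hκ : ∀ u, κ u ∈ stdSimplex ℝ X)
    {V : X → Y → ℝ} (hV : ∀ x, V x ∈ stdSimplex ℝ Y) (T : U → X → Y → Prop) {θ : ℝ} (hθ0 : 0 ≤ θ)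
    (hθ : ∀ u x y, T u x y → ∑ x', κ u x' * V x' y ≤ θ * V x y) (i : I) (j : J) :
    cloudMean PU κ (fun c => ∑ y, V ((c j).2 i) y * (ind (¬T (c j).1 ((c j).2 i) y) +
        ∑ i', ind (i' ≠ i) * ind (T (c j).1 ((c j).2 i') y))) ≤
      (∑ u, PU u * ∑ x, κ u x * ∑ y, V x y * ind (¬T u x y)) +
        ((Fintype.card I : ℝ) - 1) * θ := by
  -- Satellites of the same cloud are independent only given the centre, so the change of measure is
  -- made conditionally on `u`. This is why the conditional information I(X_R;Y₁|U) will govern the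
  -- satellite rate.
  have hwrong : ∀ i', i' ≠ i → cloudMean PU κ (fun c : J → U × (I → X) =>
      ∑ y, V ((c j).2 i) y * ind (T (c j).1 ((c j).2 i') y)) ≤ θ := by
    intro i' hi'
    rw [cloudMean_eval_pair hU hκ hi'.symm j (fun u x x' => ∑ y, V x y * ind (T u x' y))]
    calc _ = ∑ u, PU u * ∑ x', κ u x' * ∑ y, (∑ x, κ u x * V x y) * ind (T u x' y) := by
          refine Finset.sum_congr rfl fun u _ => congrArg _ ?_
          rw [Finset.sum_comm]
          refine Finset.sum_congr rfl fun x' _ => ?_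
          simp_rw [Finset.sum_mul, Finset.mul_sum]
          rw [Finset.sum_comm]
          refine Finset.sum_congr rfl fun y _ => Finset.sum_congr rfl fun x _ => by ring
      _ ≤ ∑ u, PU u * ∑ x', κ u x' * ∑ y, θ * V x' y := by
          refine Finset.sum_le_sum fun u _ => mul_le_mul_of_nonneg_left
            (Finset.sum_le_sum fun x' _ => mul_le_mul_of_nonneg_left
            (Finset.sum_le_sum fun y _ => ?_) ((hκ u).1 x')) (hU.1 u)
          by_cases h : T u x' y
          · rw [ind_of h, mul_one]
            exact hθ _ _ _ h
          · rw [ind_of_not h, mul_zero]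
            exact mul_nonneg hθ0 ((hV x').1 y)
      _ = θ := by
          simp_rw [← Finset.mul_sum, (hV _).2, mul_one, ← Finset.sum_mul, (hκ _).2, one_mul,
            ← Finset.sum_mul, hU.2, one_mul]
  calc _ = cloudMean PU κ (fun c : J → U × (I → X) =>
        (∑ y, V ((c j).2 i) y * ind (¬T (c j).1 ((c j).2 i) y)) +
        ∑ i', ind (i' ≠ i) * ∑ y, V ((c j).2 i) y * ind (T (c j).1 ((c j).2 i') y)) := by
        congr 1
        funext c
        simp_rw [mul_add, Finset.sum_add_distrib, Finset.mul_sum]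
        congr 1
        rw [Finset.sum_comm]
        refine Finset.sum_congr rfl fun _ _ => Finset.sum_congr rfl fun _ _ => by ring
    _ = (∑ u, PU u * ∑ x, κ u x * ∑ y, V x y * ind (¬T u x y)) + ∑ i', ind (i' ≠ i) *
        cloudMean PU κ (fun c : J → U × (I → X) =>
          ∑ y, V ((c j).2 i) y * ind (T (c j).1 ((c j).2 i') y)) := by
        rw [cloudMean_add, cloudMean_eval hU hκ i j (fun u x => ∑ y, V x y * ind (¬T u x y)),
          cloudMean_sum]
        simp_rw [cloudMean_const_mul]
    _ ≤ _ := by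
        rw [← sum_ind_ne i, Finset.sum_mul]
        refine add_le_add le_rfl (Finset.sum_le_sum fun i' _ => ?_)
        by_cases hi : i' ≠ i
        · exact mul_le_mul_of_nonneg_left (hwrong i' hi) (ind_nonneg _)
        · simp [ind_of_not hi]

/-- Superposition coding for two receivers, the first of which decodes both indices. The pair of
indices may have any law. -/
theorem exists_superposition_code {Y1 Y2 : Type*} [Fintype Y1] [Fintype Y2] [Nonempty I]
    [Nonempty J] (hU : PU ∈ stdSimplex ℝ U) (hκ : ∀ u, κ u ∈ stdSimplex ℝ X)
    {V1 : X → Y1 → ℝ} (hV1 : ∀ x, V1 x ∈ stdSimplex ℝ Y1)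
    {V2 : X → Y2 → ℝ} (hV2 : ∀ x, V2 x ∈ stdSimplex ℝ Y2)
    (TU : U → Y1 → Prop) (TX : U → X → Y1 → Prop) (T2 : U → Y2 → Prop) {θU θX θ2 : ℝ}
    (hθU0 : 0 ≤ θU) (hθX0 : 0 ≤ θX) (hθ20 : 0 ≤ θ2)
    (hθU : ∀ u y, TU u y → ∑ u', PU u' * ∑ x, κ u' x * V1 x y ≤ θU * ∑ x, κ u x * V1 x y)
    (hθX : ∀ u x y, TX u x y → ∑ x', κ u x' * V1 x' y ≤ θX * V1 x y)
    (hθ2 : ∀ u y, T2 u y → ∑ u', PU u' * ∑ x, κ u' x * V2 x y ≤ θ2 * ∑ x, κ u x * V2 x y)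
    {Q : I × J → ℝ} (hQ : ∀ k, 0 ≤ Q k) :
    ∃ (cb : I × J → X) (d1 : Y1 → I × J) (d2 : Y2 → J),
      ∑ k, Q k * ((∑ y, V1 (cb k) y * ind (d1 y ≠ k)) + ∑ y, V2 (cb k) y * ind (d2 y ≠ k.2)) ≤
      (∑ k, Q k) * (((∑ u, PU u * ∑ x, κ u x * ∑ y, V1 x y * ind (¬TU u y)) +
          ((Fintype.card J : ℝ) - 1) * θU +
        ((∑ u, PU u * ∑ x, κ u x * ∑ y, V1 x y * ind (¬TX u x y)) +
          ((Fintype.card I : ℝ) - 1) * θX)) +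
        ((∑ u, PU u * ∑ x, κ u x * ∑ y, V2 x y * ind (¬T2 u y)) +
          ((Fintype.card J : ℝ) - 1) * θ2)) := by
  let D1 : (J → U × (I → X)) → Y1 → I × J := fun c y =>
    pick fun k => TU (c k.2).1 y ∧ TX (c k.2).1 ((c k.2).2 k.1) y
  let D2 : (J → U × (I → X)) → Y2 → J := fun c y => pick fun j => T2 (c j).1 y
  have h1 : ∀ c y k, ind (D1 c y ≠ k) ≤ (ind (¬TU (c k.2).1 y) +
      ∑ j', ind (j' ≠ k.2) * ind (TU (c j').1 y)) +
      (ind (¬TX (c k.2).1 ((c k.2).2 k.1) y) +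
      ∑ i', ind (i' ≠ k.1) * ind (TX (c k.2).1 ((c k.2).2 i') y)) := by
    rintro c y ⟨i, j⟩
    -- A wrong pair is charged to the cloud test when `j'` is wrong, and to the satellite test when
    -- `j'` is right, in which case the tested centre is the true one.
    have hsub : D1 c y ≠ (i, j) → (¬TU (c j).1 y ∨ ∃ j', j' ≠ j ∧ TU (c j').1 y) ∨
        (¬TX (c j).1 ((c j).2 i) y ∨ ∃ i', i' ≠ i ∧ TX (c j).1 ((c j).2 i') y) := by
      intro h
      rcases of_pick_ne h with h | ⟨⟨i', j'⟩, hne, hU', hX'⟩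
      · rcases not_and_or.1 h with h | h
        · exact Or.inl (Or.inl h)
        · exact Or.inr (Or.inl h)
      · by_cases hj : j' = j
        · subst hj
          refine Or.inr (Or.inr ⟨i', fun hi => hne (by rw [hi]), hX'⟩)
        · exact Or.inl (Or.inr ⟨j', hj, hU'⟩)
    refine (ind_mono hsub).trans ((ind_or_le _ _).trans (add_le_add
      ((ind_or_le _ _).trans (add_le_add le_rfl ?_))
      ((ind_or_le _ _).trans (add_le_add le_rfl ?_))))
    · refine (ind_exists_le _).trans_eq (Finset.sum_congr rfl fun _ _ => ind_and _ _)
    · refine (ind_exists_le _).trans_eq (Finset.sum_congr rfl fun _ _ => ind_and _ _)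
  have hmean : cloudMean PU κ (fun c => ∑ k, Q k *
      ((∑ y, V1 ((c k.2).2 k.1) y * ind (D1 c y ≠ k)) +
        ∑ y, V2 ((c k.2).2 k.1) y * ind (D2 c y ≠ k.2))) ≤
      (∑ k, Q k) * (((∑ u, PU u * ∑ x, κ u x * ∑ y, V1 x y * ind (¬TU u y)) +
          ((Fintype.card J : ℝ) - 1) * θU +
        ((∑ u, PU u * ∑ x, κ u x * ∑ y, V1 x y * ind (¬TX u x y)) +
          ((Fintype.card I : ℝ) - 1) * θX)) +
        ((∑ u, PU u * ∑ x, κ u x * ∑ y, V2 x y * ind (¬T2 u y)) +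
          ((Fintype.card J : ℝ) - 1) * θ2)) := by
    -- The mean bound is the same for every index pair, so it survives averaging with arbitrary
    -- weights `Q`.
    rw [cloudMean_sum, Finset.sum_mul]
    refine Finset.sum_le_sum fun k _ => ?_
    rw [cloudMean_const_mul, cloudMean_add]
    refine mul_le_mul_of_nonneg_left (add_le_add ?_ ?_) (hQ k)
    · refine le_trans (cloudMean_mono hU hκ fun c => Finset.sum_le_sum fun y _ =>
        mul_le_mul_of_nonneg_left (h1 c y k) ((hV1 _).1 y)) ?_
      simp_rw [mul_add (V1 _ _) (_ + _) (_ + _), Finset.sum_add_distrib]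
      rw [cloudMean_add]
      exact add_le_add (cloudMean_centre_error_le hU hκ hV1 TU hθU0 hθU k.1 k.2)
        (cloudMean_satellite_error_le hU hκ hV1 TX hθX0 hθX k.1 k.2)
    · refine le_trans (cloudMean_mono hU hκ fun c => Finset.sum_le_sum fun y _ =>
        mul_le_mul_of_nonneg_left (ind_pick_ne_le _ _) ((hV2 _).1 y)) ?_
      exact cloudMean_centre_error_le hU hκ hV2 T2 hθ20 hθ2 k.1 k.2
  obtain ⟨c, hc⟩ := exists_le_of_mean_le (prodLaw_mem fun _ : J => cloudLaw_mem hU hκ) hmean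
  exact ⟨fun k => (c k.2).2 k.1, D1 c, D2 c, hc⟩

end Superposition

end TwoWayRelay

namespace TwoWayRelay

open Filter Topology Real

/-! ### Information measures of kernels, in nats -/

section KernelInfo

variable {Z Y Y' : Type*} [Fintype Z] [Fintype Y] [Fintype Y']

/-- The mutual information between the input and the output of the channel `V` with input law `P`,
in nats. -/
def kernelInfo (P : Z → ℝ) (V : Z → Y → ℝ) : ℝ :=
  ∑ z, P z * ∑ y, V z y * log (V z y / ∑ z', P z' * V z' y)

variable {P : Z → ℝ} {V : Z → Y → ℝ}

theorem output_pos (hP : P ∈ stdSimplex ℝ Z) (hV : ∀ z, V z ∈ stdSimplex ℝ Y) {z : Z} {y : Y}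
    (hz : 0 < P z) (hy : 0 < V z y) : 0 < ∑ z', P z' * V z' y :=
  (mul_pos hz hy).trans_le (Finset.single_le_sum (f := fun z' => P z' * V z' y)
    (fun z' _ => mul_nonneg (hP.1 z') ((hV z').1 y)) (Finset.mem_univ z))

theorem output_mem (hP : P ∈ stdSimplex ℝ Z) (hV : ∀ z, V z ∈ stdSimplex ℝ Y) :
    (fun y => ∑ z, P z * V z y) ∈ stdSimplex ℝ Y := by
  refine ⟨fun y => Finset.sum_nonneg fun z _ => mul_nonneg (hP.1 z) ((hV z).1 y), ?_⟩
  rw [Finset.sum_comm]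
  simp_rw [← Finset.mul_sum, (hV _).2, mul_one, hP.2]

/-- Information as output entropy minus conditional entropy. The logarithm of the quotient splits
where the joint mass is positive; elsewhere both sides of the pointwise identity vanish. -/
theorem kernelInfo_eq (hP : P ∈ stdSimplex ℝ Z) (hV : ∀ z, V z ∈ stdSimplex ℝ Y) :
    kernelInfo P V = ∑ y, negMulLog (∑ z, P z * V z y) - ∑ z, P z * ∑ y, negMulLog (V z y) := by
  have h : ∀ z y, P z * (V z y * log (V z y / ∑ z', P z' * V z' y)) =
      -(P z * V z y) * log (∑ z', P z' * V z' y) - P z * negMulLog (V z y) := by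
    intro z y
    rcases (hP.1 z).eq_or_lt with hz | hz
    · simp [← hz]
    rcases ((hV z).1 y).eq_or_lt with hy | hy
    · simp [← hy]
    rw [log_div hy.ne' (output_pos hP hV hz hy).ne', negMulLog]
    ring
  unfold kernelInfo
  simp_rw [Finset.mul_sum, h, Finset.sum_sub_distrib]
  rw [Finset.sum_comm]
  simp_rw [← Finset.sum_mul, Finset.sum_neg_distrib]
  rfl

/-- Data processing. Over the joint law of input, output and degraded output, the difference of the
two densities is bounded by log t ≤ t - 1, and the resulting masses are both one. It supplies the
cloud rate at the stronger receiver. -/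
theorem kernelInfo_degraded_le (hP : P ∈ stdSimplex ℝ Z) (hV : ∀ z, V z ∈ stdSimplex ℝ Y)
    {q : Y → Y' → ℝ} (hq : ∀ y, q y ∈ stdSimplex ℝ Y') :
    kernelInfo P (fun z y' => ∑ y, V z y * q y y') ≤ kernelInfo P V := by
  set V2 : Z → Y' → ℝ := fun z y' => ∑ y, V z y * q y y' with hV2
  set R1 : Y → ℝ := fun y => ∑ z, P z * V z y with hR1
  set R2 : Y' → ℝ := fun y' => ∑ z, P z * V2 z y' with hR2
  have hV2m : ∀ z, V2 z ∈ stdSimplex ℝ Y' := fun z => output_mem (hV z) hq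
  have hR2m := output_mem hP hV2m
  have hR1m := output_mem hP hV
  have hR2' : ∀ y', R2 y' = ∑ y, R1 y * q y y' := by
    intro y'
    simp only [hR2, hV2, hR1, Finset.mul_sum, Finset.sum_mul]
    rw [Finset.sum_comm]
    refine Finset.sum_congr rfl fun _ _ => Finset.sum_congr rfl fun _ _ => by ring
  have e2 : kernelInfo P V2 = ∑ z, ∑ y, ∑ y', P z * V z y * q y y' * log (V2 z y' / R2 y') := by
    unfold kernelInfo
    refine Finset.sum_congr rfl fun z _ => ?_
    rw [Finset.mul_sum, Finset.sum_comm]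
    refine Finset.sum_congr rfl fun y' _ => ?_
    change P z * ((∑ y, V z y * q y y') * log (V2 z y' / R2 y')) = _
    rw [Finset.sum_mul, Finset.mul_sum]
    refine Finset.sum_congr rfl fun _ _ => by ring
  have e1 : kernelInfo P V = ∑ z, ∑ y, ∑ y', P z * V z y * q y y' * log (V z y / R1 y) := by
    unfold kernelInfo
    refine Finset.sum_congr rfl fun z _ => ?_
    rw [Finset.mul_sum]
    refine Finset.sum_congr rfl fun y _ => ?_
    rw [← Finset.sum_mul, ← Finset.mul_sum, (hq y).2]
    ring
  have hpt : ∀ z y y', P z * V z y * q y y' * log (V2 z y' / R2 y') -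
      P z * V z y * q y y' * log (V z y / R1 y) ≤
      P z * V2 z y' * (R1 y * q y y') / R2 y' - P z * V z y * q y y' := by
    intro z y y'
    have hnn : 0 ≤ P z * V2 z y' * (R1 y * q y y') / R2 y' :=
      div_nonneg (mul_nonneg (mul_nonneg (hP.1 z) ((hV2m z).1 y'))
        (mul_nonneg (hR1m.1 y) ((hq y).1 y'))) (hR2m.1 y')
    rcases (hP.1 z).eq_or_lt with hz | hz
    · simp [← hz]
    rcases ((hV z).1 y).eq_or_lt with hy | hy
    · simpa [← hy] using hnn
    rcases ((hq y).1 y').eq_or_lt with hqy | hqy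
    · simp [← hqy]
    have h2 : 0 < V2 z y' := output_pos (hV z) hq hy hqy
    have hR1p : 0 < R1 y := output_pos hP hV hz hy
    have hR2p : 0 < R2 y' := output_pos hP hV2m hz h2
    rw [← mul_sub, ← log_div (by positivity) (by positivity)]
    refine (mul_le_mul_of_nonneg_left (log_le_sub_one_of_pos (by positivity))
      (by positivity)).trans_eq ?_
    field_simp
  have hs1 : ∑ z, ∑ y, ∑ y', P z * V z y * q y y' = 1 := by
    simp_rw [← Finset.mul_sum, (hq _).2, mul_one, ← Finset.mul_sum, (hV _).2, mul_one, hP.2]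
  have hs2 : ∑ z, ∑ y, ∑ y', P z * V2 z y' * (R1 y * q y y') / R2 y' = 1 := by
    calc _ = ∑ y', (∑ z, P z * V2 z y') * (∑ y, R1 y * q y y') / R2 y' := by
          simp_rw [Finset.sum_mul_sum, Finset.sum_div]
          rw [Finset.sum_comm (γ := Y')]
          refine Finset.sum_congr rfl fun z _ => ?_
          rw [Finset.sum_comm]
      _ = ∑ y', R2 y' := by
          refine Finset.sum_congr rfl fun y' _ => ?_
          rw [← hR2']
          exact mul_self_div_self _
      _ = 1 := hR2m.2
  rw [← sub_nonpos, e1, e2]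
  simp_rw [← Finset.sum_sub_distrib]
  refine (Finset.sum_le_sum fun z _ => Finset.sum_le_sum fun y _ => Finset.sum_le_sum fun y' _ =>
    hpt z y y').trans ?_
  simp_rw [Finset.sum_sub_distrib]
  rw [hs1, hs2, sub_self]

theorem sum_negMulLog_mul (hV : ∀ z, V z ∈ stdSimplex ℝ Y) :
    ∑ z, ∑ y, negMulLog (P z * V z y) = ∑ z, negMulLog (P z) + ∑ z, P z * ∑ y, negMulLog (V z y) := by
  rw [← Finset.sum_add_distrib]
  refine Finset.sum_congr rfl fun z _ => ?_
  simp_rw [negMulLog_mul, Finset.sum_add_distrib]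
  rw [← Finset.sum_mul, (hV z).2, one_mul, Finset.mul_sum]

/-- Scaling a law adds a term that depends on the scale alone; such terms cancel between the
entropies that make up a rate. -/
theorem sum_negMulLog_const_mul {p : Z → ℝ} (hp : ∑ z, p z = 1) (c : ℝ) :
    ∑ z, negMulLog (c * p z) = negMulLog c + c * ∑ z, negMulLog (p z) := by
  simp_rw [negMulLog_mul, Finset.sum_add_distrib]
  rw [← Finset.sum_mul, hp, one_mul, Finset.mul_sum]

/-- A joint law is a marginal followed by a channel. -/
theorem exists_disintegration {p : Z × Y → ℝ} (hp : p ∈ stdSimplex ℝ (Z × Y)) :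
    ∃ (P : Z → ℝ) (κ : Z → Y → ℝ), P ∈ stdSimplex ℝ Z ∧ (∀ z, κ z ∈ stdSimplex ℝ Y) ∧
      p = fun w => P w.1 * κ w.1 w.2 := by
  have hne : Nonempty Y := (nonempty_of_mem_stdSimplex hp).map Prod.snd
  have hnn : ∀ z, 0 ≤ ∑ y, p (z, y) := fun z => Finset.sum_nonneg fun y _ => hp.1 _
  -- Inputs of marginal mass zero receive the uniform law, so that the conditional is a channel
  -- everywhere.
  refine ⟨fun z => ∑ y, p (z, y), fun z => if ∑ y, p (z, y) = 0 then unif Y else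
    fun y => p (z, y) / ∑ y, p (z, y), ⟨hnn, ?_⟩, fun z => ?_, ?_⟩
  · rw [← Fintype.sum_prod_type]
    exact hp.2
  · beta_reduce
    split_ifs with h
    · exact unif_mem
    · refine ⟨fun y => div_nonneg (hp.1 _) (hnn z), ?_⟩
      rw [← Finset.sum_div, div_self h]
  · funext ⟨z, y⟩
    simp only
    split_ifs with h
    · rw [h, zero_mul]
      exact (Finset.sum_eq_zero_iff_of_nonneg fun y _ => hp.1 _).1 h y (Finset.mem_univ y)
    · rw [mul_div_cancel₀ _ h]

end KernelInfo

/-! ### The rates of the theorem as kernel informations. -/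

section Rates

theorem law_eq_sum {Ω α : Type*} [Fintype Ω] [DecidableEq α] (p : Ω → ℝ) (f : Ω → α) (a : α) :
    law p f a = ∑ ω, if f ω = a then p ω else 0 := by
  unfold law
  congr!

theorem entropy_mul_log {Ω α : Type*} [Fintype Ω] [Fintype α] (p : Ω → ℝ) (f : Ω → α) :
    entropy p f * log 2 = ∑ a, negMulLog (law p f a) :=
  div_mul_cancel₀ _ (log_pos one_lt_two).ne'

variable {X12 X21 XR YR Y1 Y2 : Type*} [Fintype X12] [Fintype X21] [Fintype XR]
  [Fintype YR] [Fintype Y1] [Fintype Y2] (ch : Channel X12 X21 XR YR Y1 Y2)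

section Down

variable {U : Type*} [Fintype U] (p : U × XR → ℝ)

/-- The factor `log 2` passes from bits to nats. The explicit sums require no normalisation of `p`;
they serve both the kernel form of the rate and the time-sharing computation. -/
theorem commonRate_mul_log :
    ch.commonRate p * log 2 = ∑ u, negMulLog (∑ x, p (u, x)) +
      ∑ y, negMulLog (∑ u, ∑ x, p (u, x) * ch.down2 x y) -
      ∑ u, ∑ y, negMulLog (∑ x, p (u, x) * ch.down2 x y) := by
  classical
  have h1 : ∀ u, law (ch.downJoint p) (fun ω => ω.1) u = ∑ x, p (u, x) := by
    intro u
    simp only [law_eq_sum, Fintype.sum_prod_type, Finset.sum_ite_irrel, Finset.sum_const_zero,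
      Finset.sum_ite_eq', Finset.sum_ite_eq, Finset.mem_univ, if_true, Channel.downJoint,
      ← Finset.mul_sum, (ch.down1_mem _).2, (ch.down2_mem _).2, mul_one]
  have h2 : ∀ y, law (ch.downJoint p) (fun ω => ω.2.2.2) y =
      ∑ u, ∑ x, p (u, x) * ch.down2 x y := by
    intro y
    simp only [law_eq_sum, Fintype.sum_prod_type, Finset.sum_ite_irrel, Finset.sum_const_zero,
      Finset.sum_ite_eq', Finset.sum_ite_eq, Finset.mem_univ, if_true, Channel.downJoint,
      ← Finset.sum_mul, ← Finset.mul_sum, (ch.down1_mem _).2, (ch.down2_mem _).2, mul_one]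
  have h3 : ∀ u y, law (ch.downJoint p) (fun ω => (ω.1, ω.2.2.2)) (u, y) =
      ∑ x, p (u, x) * ch.down2 x y := by
    intro u y
    simp only [law_eq_sum, Fintype.sum_prod_type, Prod.mk.injEq, ite_and, Finset.sum_ite_irrel,
      Finset.sum_const_zero,
      Finset.sum_ite_eq', Finset.sum_ite_eq, Finset.mem_univ, if_true, Channel.downJoint,
      ← Finset.sum_mul, ← Finset.mul_sum, (ch.down1_mem _).2, (ch.down2_mem _).2, mul_one]
  unfold Channel.commonRate mutualInfo condEntropy
  simp only [sub_mul, entropy_mul_log, Fintype.sum_prod_type, h1, h2, h3]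
  ring

theorem refinementRate_mul_log :
    ch.refinementRate p * log 2 = ∑ u, ∑ x, negMulLog (p (u, x)) -
      ∑ u, negMulLog (∑ x, p (u, x)) -
      ∑ u, ∑ x, ∑ y, negMulLog (p (u, x) * ch.down1 x y) +
      ∑ u, ∑ y, negMulLog (∑ x, p (u, x) * ch.down1 x y) := by
  classical
  have h1 : ∀ u, law (ch.downJoint p) (fun ω => ω.1) u = ∑ x, p (u, x) := by
    intro u
    simp only [law_eq_sum, Fintype.sum_prod_type, Finset.sum_ite_irrel, Finset.sum_const_zero,
      Finset.sum_ite_eq', Finset.sum_ite_eq, Finset.mem_univ, if_true, Channel.downJoint,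
      ← Finset.mul_sum, (ch.down1_mem _).2, (ch.down2_mem _).2, mul_one]
  have h2 : ∀ x u, law (ch.downJoint p) (fun ω => (ω.2.1, ω.1)) (x, u) = p (u, x) := by
    intro x u
    simp only [law_eq_sum, Fintype.sum_prod_type, Prod.mk.injEq, ite_and, Finset.sum_ite_irrel,
      Finset.sum_const_zero,
      Finset.sum_ite_eq', Finset.sum_ite_eq, Finset.mem_univ, if_true, Channel.downJoint,
      ← Finset.sum_mul, ← Finset.mul_sum, (ch.down1_mem _).2, (ch.down2_mem _).2, mul_one]
  have h3 : ∀ x y u, law (ch.downJoint p) (fun ω => (ω.2.1, ω.2.2.1, ω.1)) (x, y, u) =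
      p (u, x) * ch.down1 x y := by
    intro x y u
    simp only [law_eq_sum, Fintype.sum_prod_type, Prod.mk.injEq, ite_and, Finset.sum_ite_irrel,
      Finset.sum_const_zero,
      Finset.sum_ite_eq', Finset.sum_ite_eq, Finset.mem_univ, if_true, Channel.downJoint,
      ← Finset.sum_mul, ← Finset.mul_sum, (ch.down1_mem _).2, (ch.down2_mem _).2, mul_one]
  have h4 : ∀ y u, law (ch.downJoint p) (fun ω => (ω.2.2.1, ω.1)) (y, u) =
      ∑ x, p (u, x) * ch.down1 x y := by
    intro y u
    simp only [law_eq_sum, Fintype.sum_prod_type, Prod.mk.injEq, ite_and, Finset.sum_ite_irrel,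
      Finset.sum_const_zero,
      Finset.sum_ite_eq', Finset.sum_ite_eq, Finset.mem_univ, if_true, Channel.downJoint,
      ← Finset.mul_sum, (ch.down1_mem _).2, (ch.down2_mem _).2, mul_one]
  unfold Channel.refinementRate condMutualInfo condEntropy
  simp only [sub_mul, entropy_mul_log, Fintype.sum_prod_type, h1, h2, h3, h4]
  rw [Finset.sum_comm (γ := U), Finset.sum_comm (s := (Finset.univ : Finset Y1))]
  have : ∑ x, ∑ y, ∑ u, negMulLog (p (u, x) * ch.down1 x y) =
      ∑ u, ∑ x, ∑ y, negMulLog (p (u, x) * ch.down1 x y) := by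
    rw [Finset.sum_comm (γ := U)]
    refine Finset.sum_congr rfl fun x _ => Finset.sum_comm
  rw [this]
  ring

variable {p}

theorem commonRate_eq_kernelInfo {PU : U → ℝ} {κ : U → XR → ℝ} (hU : PU ∈ stdSimplex ℝ U)
    (hκ : ∀ u, κ u ∈ stdSimplex ℝ XR) (hp : p = fun w => PU w.1 * κ w.1 w.2) :
    ch.commonRate p * log 2 = kernelInfo PU (fun u y => ∑ x, κ u x * ch.down2 x y) := by
  have hV : ∀ u, (fun y => ∑ x, κ u x * ch.down2 x y) ∈ stdSimplex ℝ Y2 := fun u =>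
    output_mem (hκ u) ch.down2_mem
  rw [commonRate_mul_log, kernelInfo_eq hU hV]
  simp only [hp, mul_assoc, ← Finset.mul_sum, (hκ _).2, mul_one]
  have := sum_negMulLog_mul (P := PU) hV
  rw [this]
  ring

theorem refinementRate_eq_kernelInfo {PU : U → ℝ} {κ : U → XR → ℝ}
    (hκ : ∀ u, κ u ∈ stdSimplex ℝ XR) (hp : p = fun w => PU w.1 * κ w.1 w.2) :
    ch.refinementRate p * log 2 = ∑ u, PU u * kernelInfo (κ u) ch.down1 := by
  have hV : ∀ u, (fun y => ∑ x, κ u x * ch.down1 x y) ∈ stdSimplex ℝ Y1 := fun u =>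
    output_mem (hκ u) ch.down1_mem
  have e1 := sum_negMulLog_mul (P := PU) hV
  have e2 := sum_negMulLog_mul (P := PU) hκ
  have e3 := sum_negMulLog_mul (P := fun w : U × XR => PU w.1 * κ w.1 w.2)
    (V := fun w => ch.down1 w.2) (fun w => ch.down1_mem w.2)
  simp only [Fintype.sum_prod_type] at e1 e2 e3
  rw [refinementRate_mul_log]
  simp only [hp, kernelInfo_eq (hκ _) ch.down1_mem]
  rw [e3, e2]
  simp only [mul_assoc, ← Finset.mul_sum, (hκ _).2, mul_one]
  rw [e1]
  simp only [mul_sub, Finset.sum_sub_distrib]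
  ring

end Down

section Up

variable {p12 : X12 → ℝ} {p21 : X21 → ℝ}

theorem condEntropy_upJoint :
    condEntropy (ch.upJoint p12 p21) (fun ω => ω.2.2) (fun ω => (ω.1, ω.2.1)) * log 2 =
      ∑ a, ∑ b, p12 a * p21 b * ∑ y, negMulLog (ch.up a b y) := by
  classical
  have h1 : ∀ a b y, law (ch.upJoint p12 p21) (fun ω => (ω.2.2, ω.1, ω.2.1)) (y, a, b) =
      p12 a * p21 b * ch.up a b y := by
    intro a b y
    simp only [law_eq_sum, Fintype.sum_prod_type, Prod.mk.injEq, ite_and, Finset.sum_ite_irrel,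
      Finset.sum_const_zero, Finset.sum_ite_eq', Finset.mem_univ, if_true, Channel.upJoint]
  have h2 : ∀ a b, law (ch.upJoint p12 p21) (fun ω => (ω.1, ω.2.1)) (a, b) = p12 a * p21 b := by
    intro a b
    simp only [law_eq_sum, Fintype.sum_prod_type, Prod.mk.injEq, ite_and, Finset.sum_ite_irrel,
      Finset.sum_const_zero, Finset.sum_ite_eq', Finset.mem_univ, if_true, Channel.upJoint,
      ← Finset.mul_sum, (ch.up_mem _ _).2, mul_one]
  unfold condEntropy
  simp only [sub_mul, entropy_mul_log, Fintype.sum_prod_type, h1, h2]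
  have e := sum_negMulLog_mul (P := fun w : X12 × X21 => p12 w.1 * p21 w.2)
    (V := fun w => ch.up w.1 w.2) (fun w => ch.up_mem w.1 w.2)
  simp only [Fintype.sum_prod_type] at e
  rw [Finset.sum_comm]
  simp_rw [Finset.sum_comm (s := (Finset.univ : Finset YR))]
  rw [e]
  ring

theorem condMutualInfo_upJoint_fst (h12 : p12 ∈ stdSimplex ℝ X12) :
    condMutualInfo (ch.upJoint p12 p21) (fun ω => ω.1) (fun ω => ω.2.2) (fun ω => ω.2.1) * log 2 =
      ∑ b, p21 b * kernelInfo p12 (fun a => ch.up a b) := by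
  classical
  have h1 : ∀ a b y, law (ch.upJoint p12 p21) (fun ω => (ω.1, ω.2.2, ω.2.1)) (a, y, b) =
      p12 a * p21 b * ch.up a b y := by
    intro a b y
    simp only [law_eq_sum, Fintype.sum_prod_type, Prod.mk.injEq, ite_and, Finset.sum_ite_irrel,
      Finset.sum_const_zero, Finset.sum_ite_eq', Finset.mem_univ, if_true, Channel.upJoint]
  have h2 : ∀ a b, law (ch.upJoint p12 p21) (fun ω => (ω.1, ω.2.1)) (a, b) = p12 a * p21 b := by
    intro a b
    simp only [law_eq_sum, Fintype.sum_prod_type, Prod.mk.injEq, ite_and, Finset.sum_ite_irrel,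
      Finset.sum_const_zero, Finset.sum_ite_eq', Finset.mem_univ, if_true, Channel.upJoint,
      ← Finset.mul_sum, (ch.up_mem _ _).2, mul_one]
  have h3 : ∀ b, law (ch.upJoint p12 p21) (fun ω => ω.2.1) b = p21 b := by
    intro b
    simp only [law_eq_sum, Fintype.sum_prod_type, Finset.sum_ite_irrel,
      Finset.sum_const_zero, Finset.sum_ite_eq', Finset.mem_univ, if_true, Channel.upJoint,
      ← Finset.mul_sum, (ch.up_mem _ _).2, mul_one, ← Finset.sum_mul, h12.2, one_mul]
  have h4 : ∀ b y, law (ch.upJoint p12 p21) (fun ω => (ω.2.2, ω.2.1)) (y, b) =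
      p21 b * ∑ a, p12 a * ch.up a b y := by
    intro b y
    simp only [law_eq_sum, Fintype.sum_prod_type, Prod.mk.injEq, ite_and, Finset.sum_ite_irrel,
      Finset.sum_const_zero, Finset.sum_ite_eq', Finset.mem_univ, if_true, Channel.upJoint,
      Finset.mul_sum]
    refine Finset.sum_congr rfl fun _ _ => by ring
  unfold condMutualInfo condEntropy
  simp only [sub_mul, entropy_mul_log, Fintype.sum_prod_type, h1, h2, h3, h4,
    kernelInfo_eq h12 (fun a => ch.up_mem a _)]
  have e := sum_negMulLog_mul (P := fun w : X12 × X21 => p12 w.1 * p21 w.2)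
    (V := fun w => ch.up w.1 w.2) (fun w => ch.up_mem w.1 w.2)
  have e' := sum_negMulLog_mul (P := p21) (V := fun b y => ∑ a, p12 a * ch.up a b y)
    (fun b => output_mem h12 (fun a => ch.up_mem a b))
  simp only [Fintype.sum_prod_type] at e e'
  simp_rw [Finset.sum_comm (s := (Finset.univ : Finset YR))]
  rw [e, e']
  simp only [mul_sub, Finset.sum_sub_distrib]
  have : ∑ a, ∑ b, p12 a * p21 b * ∑ y, negMulLog (ch.up a b y) =
      ∑ b, p21 b * ∑ a, p12 a * ∑ y, negMulLog (ch.up a b y) := by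
    rw [Finset.sum_comm]
    simp_rw [Finset.mul_sum]
    refine Finset.sum_congr rfl fun _ _ => Finset.sum_congr rfl fun _ _ =>
      Finset.sum_congr rfl fun _ _ => by ring
  rw [this]
  ring

theorem condMutualInfo_upJoint_snd (h21 : p21 ∈ stdSimplex ℝ X21) :
    condMutualInfo (ch.upJoint p12 p21) (fun ω => ω.2.1) (fun ω => ω.2.2) (fun ω => ω.1) * log 2 =
      ∑ a, p12 a * kernelInfo p21 (fun b => ch.up a b) := by
  classical
  have h1 : ∀ a b y, law (ch.upJoint p12 p21) (fun ω => (ω.2.1, ω.2.2, ω.1)) (b, y, a) =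
      p12 a * p21 b * ch.up a b y := by
    intro a b y
    simp only [law_eq_sum, Fintype.sum_prod_type, Prod.mk.injEq, ite_and, Finset.sum_ite_irrel,
      Finset.sum_const_zero, Finset.sum_ite_eq', Finset.mem_univ, if_true, Channel.upJoint]
  have h2 : ∀ a b, law (ch.upJoint p12 p21) (fun ω => (ω.2.1, ω.1)) (b, a) = p12 a * p21 b := by
    intro a b
    simp only [law_eq_sum, Fintype.sum_prod_type, Prod.mk.injEq, ite_and, Finset.sum_ite_irrel,
      Finset.sum_const_zero, Finset.sum_ite_eq', Finset.mem_univ, if_true, Channel.upJoint,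
      ← Finset.mul_sum, (ch.up_mem _ _).2, mul_one]
  have h3 : ∀ a, law (ch.upJoint p12 p21) (fun ω => ω.1) a = p12 a := by
    intro a
    simp only [law_eq_sum, Fintype.sum_prod_type, Finset.sum_ite_irrel,
      Finset.sum_const_zero, Finset.sum_ite_eq', Finset.mem_univ, if_true, Channel.upJoint,
      ← Finset.mul_sum, (ch.up_mem _ _).2, mul_one, h21.2]
  have h4 : ∀ a y, law (ch.upJoint p12 p21) (fun ω => (ω.2.2, ω.1)) (y, a) =
      p12 a * ∑ b, p21 b * ch.up a b y := by
    intro a y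
    simp only [law_eq_sum, Fintype.sum_prod_type, Prod.mk.injEq, ite_and, Finset.sum_ite_irrel,
      Finset.sum_const_zero, Finset.sum_ite_eq', Finset.mem_univ, if_true, Channel.upJoint,
      Finset.mul_sum]
    refine Finset.sum_congr rfl fun _ _ => by ring
  unfold condMutualInfo condEntropy
  simp only [sub_mul, entropy_mul_log, Fintype.sum_prod_type, h1, h2, h3, h4,
    kernelInfo_eq h21 (fun b => ch.up_mem _ b)]
  have e := sum_negMulLog_mul (P := fun w : X21 × X12 => p12 w.2 * p21 w.1)
    (V := fun w => ch.up w.2 w.1) (fun w => ch.up_mem w.2 w.1)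
  have e' := sum_negMulLog_mul (P := p12) (V := fun a y => ∑ b, p21 b * ch.up a b y)
    (fun a => output_mem h21 (fun b => ch.up_mem a b))
  simp only [Fintype.sum_prod_type] at e e'
  simp_rw [Finset.sum_comm (s := (Finset.univ : Finset YR))]
  rw [e, e']
  simp only [mul_sub, Finset.sum_sub_distrib]
  have : ∑ b, ∑ a, p12 a * p21 b * ∑ y, negMulLog (ch.up a b y) =
      ∑ a, p12 a * ∑ b, p21 b * ∑ y, negMulLog (ch.up a b y) := by
    rw [Finset.sum_comm]
    simp_rw [Finset.mul_sum]
    refine Finset.sum_congr rfl fun _ _ => Finset.sum_congr rfl fun _ _ =>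
      Finset.sum_congr rfl fun _ _ => by ring
  rw [this]
  ring

end Up

end Rates

end TwoWayRelay

namespace TwoWayRelay

open Filter Topology Real

/-! ### Time sharing: the convex hull is dominated by single laws. -/

section TimeSharing

variable {X12 X21 XR YR Y1 Y2 : Type*} [Fintype X12] [Fintype X21] [Fintype XR]
  [Fintype YR] [Fintype Y1] [Fintype Y2]
  (ch : Channel X12 X21 XR YR Y1 Y2)

/-- Time sharing between two joint laws, the auxiliary variable recording which one is used. -/
def timeShare {U V X : Type*} (a b : ℝ) (p : U × X → ℝ) (q : V × X → ℝ) : (U ⊕ V) × X → ℝ :=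
  fun w => Sum.elim (fun u => a * p (u, w.2)) (fun v => b * q (v, w.2)) w.1

variable {U V : Type} [Fintype U] [Fintype V] {a b : ℝ} {p : U × XR → ℝ} {q : V × XR → ℝ}

theorem timeShare_mem (hp : p ∈ stdSimplex ℝ (U × XR)) (hq : q ∈ stdSimplex ℝ (V × XR))
    (ha : 0 ≤ a) (hb : 0 ≤ b) (hab : a + b = 1) :
    timeShare a b p q ∈ stdSimplex ℝ ((U ⊕ V) × XR) := by
  refine ⟨?_, ?_⟩
  · rintro ⟨u | v, x⟩
    · exact mul_nonneg ha (hp.1 _)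
    · exact mul_nonneg hb (hq.1 _)
  · have h1 := hp.2
    have h2 := hq.2
    rw [Fintype.sum_prod_type] at h1 h2
    simp only [timeShare, Fintype.sum_prod_type, Fintype.sum_sum_type, Sum.elim_inl, Sum.elim_inr,
      ← Finset.mul_sum, h1, h2, mul_one, hab]

theorem sum_prod_mul_eq_one {Y : Type*} [Fintype Y] (hp : p ∈ stdSimplex ℝ (U × XR))
    {W : XR → Y → ℝ} (hW : ∀ x, W x ∈ stdSimplex ℝ Y) :
    ∑ w : U × Y, ∑ x, p (w.1, x) * W x w.2 = 1 := by
  rw [Fintype.sum_prod_type, ← hp.2, Fintype.sum_prod_type]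
  refine Finset.sum_congr rfl fun u _ => ?_
  rw [Finset.sum_comm]
  simp_rw [← Finset.mul_sum, (hW _).2, mul_one]

/-- I(X_R;Y₁|U) is an average over the values of U, hence affine when U records which law is used.
In entropies, each of the four sums gains the same scale terms, twice with each sign. -/
theorem refinementRate_timeShare (hp : p ∈ stdSimplex ℝ (U × XR)) (hq : q ∈ stdSimplex ℝ (V × XR)) :
    ch.refinementRate (timeShare a b p q) =
      a * ch.refinementRate p + b * ch.refinementRate q := by
  have hl : log 2 ≠ 0 := (log_pos one_lt_two).ne'
  refine mul_right_cancel₀ hl ?_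
  rw [add_mul, mul_assoc, mul_assoc]
  simp only [refinementRate_mul_log, timeShare, Fintype.sum_sum_type, Sum.elim_inl, Sum.elim_inr]
  have key : ∀ {U : Type} [Fintype U] {p : U × XR → ℝ}, p ∈ stdSimplex ℝ (U × XR) → ∀ a : ℝ,
      ∑ u, ∑ x, negMulLog (a * p (u, x)) = negMulLog a + a * ∑ u, ∑ x, negMulLog (p (u, x)) ∧
      ∑ u, negMulLog (∑ x, a * p (u, x)) =
        negMulLog a + a * ∑ u, negMulLog (∑ x, p (u, x)) ∧
      ∑ u, ∑ x, ∑ y, negMulLog (a * p (u, x) * ch.down1 x y) =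
        negMulLog a + a * ∑ u, ∑ x, ∑ y, negMulLog (p (u, x) * ch.down1 x y) ∧
      ∑ u, ∑ y, negMulLog (∑ x, a * p (u, x) * ch.down1 x y) =
        negMulLog a + a * ∑ u, ∑ y, negMulLog (∑ x, p (u, x) * ch.down1 x y) := by
    intro U _ p hp a
    have h1 := sum_negMulLog_const_mul hp.2 a
    have h2 := sum_negMulLog_const_mul (p := fun u => ∑ x, p (u, x))
      (by rw [← hp.2, Fintype.sum_prod_type]) a
    have h3 := sum_negMulLog_const_mul (p := fun w : U × XR × Y1 => p (w.1, w.2.1) *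
      ch.down1 w.2.1 w.2.2) (by
        simp only [Fintype.sum_prod_type, ← Finset.mul_sum, (ch.down1_mem _).2, mul_one]
        rw [← hp.2, Fintype.sum_prod_type]) a
    have h4 := sum_negMulLog_const_mul (sum_prod_mul_eq_one hp ch.down1_mem) a
    simp only [Fintype.sum_prod_type, ← mul_assoc] at h1 h2 h3 h4
    refine ⟨h1, ?_, h3, ?_⟩
    · simp_rw [← Finset.mul_sum]
      exact h2
    · simp_rw [mul_assoc, ← Finset.mul_sum]
      exact h4
  obtain ⟨a1, a2, a3, a4⟩ := key hp a
  obtain ⟨b1, b2, b3, b4⟩ := key hq b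
  rw [a1, a2, a3, a4, b1, b2, b3, b4]
  ring

/-- The conditional entropy H(Y₂|U) is affine under time sharing and H(Y₂) is concave, so I(U;Y₂)
can only gain. -/
theorem le_commonRate_timeShare (hp : p ∈ stdSimplex ℝ (U × XR)) (hq : q ∈ stdSimplex ℝ (V × XR))
    (ha : 0 ≤ a) (hb : 0 ≤ b) (hab : a + b = 1) :
    a * ch.commonRate p + b * ch.commonRate q ≤ ch.commonRate (timeShare a b p q) := by
  have hl : 0 < log 2 := log_pos one_lt_two
  refine le_of_mul_le_mul_right ?_ hl
  rw [add_mul, mul_assoc, mul_assoc]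
  simp only [commonRate_mul_log, timeShare, Fintype.sum_sum_type, Sum.elim_inl, Sum.elim_inr]
  have key : ∀ {U : Type} [Fintype U] {p : U × XR → ℝ}, p ∈ stdSimplex ℝ (U × XR) → ∀ a : ℝ,
      ∑ u, negMulLog (∑ x, a * p (u, x)) =
        negMulLog a + a * ∑ u, negMulLog (∑ x, p (u, x)) ∧
      ∑ u, ∑ y, negMulLog (∑ x, a * p (u, x) * ch.down2 x y) =
        negMulLog a + a * ∑ u, ∑ y, negMulLog (∑ x, p (u, x) * ch.down2 x y) ∧
      ∀ y, 0 ≤ ∑ u, ∑ x, p (u, x) * ch.down2 x y := by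
    intro U _ p hp a
    have h2 := sum_negMulLog_const_mul (p := fun u => ∑ x, p (u, x))
      (by rw [← hp.2, Fintype.sum_prod_type]) a
    have h4 := sum_negMulLog_const_mul (sum_prod_mul_eq_one hp ch.down2_mem) a
    simp only [Fintype.sum_prod_type] at h2 h4
    refine ⟨?_, ?_, fun y => Finset.sum_nonneg fun u _ => Finset.sum_nonneg fun x _ =>
      mul_nonneg (hp.1 _) ((ch.down2_mem x).1 y)⟩
    · simp_rw [← Finset.mul_sum]
      exact h2
    · simp_rw [mul_assoc, ← Finset.mul_sum]
      exact h4
  obtain ⟨a2, a4, a5⟩ := key hp a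
  obtain ⟨b2, b4, b5⟩ := key hq b
  have hconc : a * ∑ y, negMulLog (∑ u, ∑ x, p (u, x) * ch.down2 x y) +
      b * ∑ y, negMulLog (∑ u, ∑ x, q (u, x) * ch.down2 x y) ≤
      ∑ y, negMulLog ((∑ u, ∑ x, a * p (u, x) * ch.down2 x y) +
        ∑ u, ∑ x, b * q (u, x) * ch.down2 x y) := by
    rw [Finset.mul_sum, Finset.mul_sum, ← Finset.sum_add_distrib]
    refine Finset.sum_le_sum fun y _ => ?_
    have := concaveOn_negMulLog.2 (a5 y) (b5 y) ha hb hab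
    simp_rw [mul_assoc, ← Finset.mul_sum]
    simpa only [smul_eq_mul] using this
  rw [a2, a4, b2, b4]
  linarith

/-- Every pair of downlink rates is dominated by the pair of a single joint law. -/
theorem exists_law_of_mem_downRates {r : ℝ × ℝ} (hr : r ∈ ch.downRates) :
    ∃ (U : Type) (_ : Fintype U) (p : U × XR → ℝ), p ∈ stdSimplex ℝ (U × XR) ∧
      r.1 ≤ ch.refinementRate p + ch.commonRate p ∧ r.2 ≤ ch.commonRate p := by
  -- Domination, unlike equality, is preserved by mixtures, since the common rate is only concave
  -- under time sharing.
  refine convexHull_min (t := {r : ℝ × ℝ | ∃ (U : Type) (_ : Fintype U) (p : U × XR → ℝ),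
    p ∈ stdSimplex ℝ (U × XR) ∧ r.1 ≤ ch.refinementRate p + ch.commonRate p ∧
      r.2 ≤ ch.commonRate p}) ?_ ?_ hr
  · rintro _ ⟨k, p, hp, rfl⟩
    exact ⟨Fin k, inferInstance, p, hp, le_rfl, le_rfl⟩
  · rintro r ⟨U, _, p, hp, hr1, hr2⟩ s ⟨V, _, q, hq, hs1, hs2⟩ a b ha hb hab
    have h1 := refinementRate_timeShare ch (a := a) (b := b) hp hq
    have h2 := le_commonRate_timeShare ch hp hq ha hb hab
    refine ⟨U ⊕ V, inferInstance, timeShare a b p q, timeShare_mem hp hq ha hb hab, ?_, ?_⟩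
    · simp only [Prod.fst_add, Prod.smul_fst, smul_eq_mul]
      nlinarith
    · simp only [Prod.snd_add, Prod.smul_snd, smul_eq_mul]
      nlinarith

end TimeSharing

end TwoWayRelay

namespace TwoWayRelay

open Filter Topology Real

/-! ### Coding over many channel uses -/

section Asymptotics

variable {A B X Y ι : Type*} [Fintype A] [Fintype B] [Fintype X] [Fintype Y] [Fintype ι]
  [DecidableEq ι]

theorem sum_prodLaw_mul_prodLaw (μ : ι → A → ℝ) (V : ι → A → Y → ℝ) (y : ι → Y) :
    ∑ a, prodLaw μ a * prodLaw (fun i => V i (a i)) y =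
      prodLaw (fun i y => ∑ a, μ i a * V i a y) y := by
  have := sum_prodLaw_eq_prod (fun i a => μ i a * V i a (y i))
  simpa only [prodLaw, Finset.prod_mul_distrib] using this

theorem sum_prodLaw_triple (P : A → ℝ) (κ : A → B → ℝ) (W : A → B → Y → ℝ)
    (F : (ι → A) → (ι → B) → (ι → Y) → ℝ) :
    ∑ a, prodLaw (fun _ => P) a * ∑ b, prodLaw (fun i => κ (a i)) b *
      ∑ y, prodLaw (fun i => W (a i) (b i)) y * F a b y =
    ∑ z : ι → A × B × Y, prodLaw (fun _ w => P w.1 * κ w.1 w.2.1 * W w.1 w.2.1 w.2.2) z *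
      F (fun i => (z i).1) (fun i => (z i).2.1) (fun i => (z i).2.2) := by
  simp_rw [Finset.mul_sum]
  rw [← sum_arrow_prod (fun a (bc : ι → B × Y) =>
    prodLaw (fun _ (w : A × B × Y) => P w.1 * κ w.1 w.2.1 * W w.1 w.2.1 w.2.2)
      (fun i => (a i, bc i)) * F a (fun i => (bc i).1) (fun i => (bc i).2))]
  refine Finset.sum_congr rfl fun a _ => ?_
  rw [sum_arrow_prod]
  refine Finset.sum_congr rfl fun z _ => ?_
  simp only [prodLaw, Finset.prod_mul_distrib]
  ring

/-- The asymptotic equipartition property for a chain of channels. -/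
theorem tendsto_prob_atypical {P : A → ℝ} {κ : A → B → ℝ} {W : A → B → Y → ℝ}
    (hP : P ∈ stdSimplex ℝ A) (hκ : ∀ a, κ a ∈ stdSimplex ℝ B)
    (hW : ∀ a b, W a b ∈ stdSimplex ℝ Y) (g : A → B → Y → ℝ)
    (hg : ∀ a b y, 0 < P a → 0 < κ a b → 0 < W a b y → 0 < g a b y) {μ : ℝ}
    (hμ : μ = ∑ a, P a * ∑ b, κ a b * ∑ y, W a b y * log (g a b y)) {γ : ℝ} (hγ : 0 < γ) :
    Tendsto (fun m : ℕ => ∑ a : Fin m → A, prodLaw (fun _ => P) a *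
      ∑ b, prodLaw (fun i => κ (a i)) b * ∑ y, prodLaw (fun i => W (a i) (b i)) y *
        ind (¬exp (m * (μ - γ)) ≤ ∏ i, g (a i) (b i) (y i))) atTop (𝓝 0) := by
  simp_rw [not_le]
  have hmem : (fun w : A × B × Y => P w.1 * κ w.1 w.2.1 * W w.1 w.2.1 w.2.2) ∈
      stdSimplex ℝ (A × B × Y) := by
    refine ⟨fun w => mul_nonneg (mul_nonneg (hP.1 _) ((hκ _).1 _)) ((hW _ _).1 _), ?_⟩
    simp only [Fintype.sum_prod_type, ← Finset.mul_sum, (hW _ _).2, mul_one, (hκ _).2, hP.2]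
  refine (tendsto_prodLaw_prod_lt hmem (fun w => g w.1 w.2.1 w.2.2) (μ := μ) ?_ ?_ hγ).congr fun m => ?_
  · rintro ⟨a, b, y⟩ h
    have h3 : W a b y ≠ 0 := right_ne_zero_of_mul h.ne'
    have h12 := left_ne_zero_of_mul h.ne'
    exact hg a b y ((hP.1 a).lt_of_ne' (left_ne_zero_of_mul h12))
      (((hκ a).1 b).lt_of_ne' (right_ne_zero_of_mul h12)) (((hW a b).1 y).lt_of_ne' h3)
  · simp only [hμ, Fintype.sum_prod_type, Finset.mul_sum, mul_assoc]
  · exact (sum_prodLaw_triple P κ W (fun a b y =>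
      ind (∏ i, g (a i) (b i) (y i) < exp (m * (μ - γ))))).symm

/-- Converts a typicality threshold into the change-of-measure hypothesis of the one-shot bounds. A
vanishing `g i` makes the left side zero, so division by zero does no harm. -/
theorem prod_le_exp_mul_prod {f g : ι → ℝ} (hf : ∀ i, 0 ≤ f i) (hg : ∀ i, 0 ≤ g i) {t : ℝ}
    (h : exp t ≤ ∏ i, f i / g i) : ∏ i, g i ≤ exp (-t) * ∏ i, f i := by
  rcases (Finset.prod_nonneg fun i (_ : i ∈ Finset.univ) => hg i).eq_or_lt with h0 | h0
  · rw [← h0]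
    exact mul_nonneg (exp_pos _).le (Finset.prod_nonneg fun i _ => hf i)
  · rw [Finset.prod_div_distrib, le_div_iff₀ h0] at h
    rw [exp_neg, ← div_eq_inv_mul, le_div_iff₀ (exp_pos t), mul_comm]
    exact h

theorem one_le_ceil_exp (x : ℝ) : (1 : ℝ) ≤ ⌈exp x⌉₊ := by
  exact_mod_cast Nat.one_le_ceil_iff.2 (exp_pos x)

theorem tendsto_exp_neg_nat_mul {γ : ℝ} (hγ : 0 < γ) :
    Tendsto (fun m : ℕ => exp (-(m * γ))) atTop (𝓝 0) :=
  tendsto_exp_neg_atTop_nhds_zero.comp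
    (tendsto_natCast_atTop_atTop.atTop_mul_const hγ)

/-- Only wrong codewords are counted, and the subtracted one absorbs the ceiling: ⌈x⌉ - 1 ≤ x. -/
theorem tendsto_card_mul_exp {r s : ℝ} (h : r < s) :
    Tendsto (fun m : ℕ => ((⌈exp (m * r)⌉₊ : ℝ) - 1) * exp (-(m * s))) atTop (𝓝 0) := by
  refine squeeze_zero (fun m => mul_nonneg (by linarith [one_le_ceil_exp (m * r)])
    (exp_pos _).le) (fun m => ?_) (tendsto_exp_neg_nat_mul (sub_pos.2 h))
  have h1 := (Nat.ceil_lt_add_one (exp_pos (m * r)).le).le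
  refine (mul_le_mul_of_nonneg_right (by linarith) (exp_pos _).le).trans_eq
    (b := exp (m * r) * exp (-(m * s))) ?_
  rw [← exp_add]
  congr 1
  ring

end Asymptotics

/-! ### Superposition codes over long blocks. -/

section DownlinkCode

variable {U X Y1 Y2 : Type*} [Fintype U] [Fintype X] [Fintype Y1] [Fintype Y2]

theorem kernelInfo_density_pos {P : U → ℝ} {κ : U → X → ℝ} {V : X → Y1 → ℝ}
    (hP : P ∈ stdSimplex ℝ U) (hκ : ∀ u, κ u ∈ stdSimplex ℝ X) (hV : ∀ x, V x ∈ stdSimplex ℝ Y1)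
    {u : U} {x : X} {y : Y1} (hu : 0 < P u) (hx : 0 < κ u x) (hy : 0 < V x y) :
    0 < (∑ x, κ u x * V x y) / ∑ u, P u * ∑ x, κ u x * V x y := by
  have h1 := output_pos (hκ u) hV hx hy
  exact div_pos h1 (output_pos hP (V := fun u y => ∑ x, κ u x * V x y)
    (fun u => output_mem (hκ u) hV) hu h1)

/-- The density depends on `u` and `y` only, but keeping the letter `x` in the average fits it to
the chain U - X - Y of `tendsto_prob_atypical`. -/
theorem kernelInfo_comp_eq (P : U → ℝ) (κ : U → X → ℝ) (V : X → Y1 → ℝ) :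
    kernelInfo P (fun u y => ∑ x, κ u x * V x y) = ∑ u, P u * ∑ x, κ u x * ∑ y, V x y *
      log ((∑ x, κ u x * V x y) / ∑ u, P u * ∑ x, κ u x * V x y) := by
  unfold kernelInfo
  refine Finset.sum_congr rfl fun u _ => congrArg (P u * ·) ?_
  simp_rw [Finset.sum_mul, Finset.mul_sum]
  rw [Finset.sum_comm]
  refine Finset.sum_congr rfl fun x _ => Finset.sum_congr rfl fun y _ => by ring

/-- Reliable transmission of a pair of indices of any law over a degraded broadcast channel, the
weaker receiver decoding the second index. -/
theorem eventually_exists_superposition_code {PU : U → ℝ} {κ : U → X → ℝ}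
    (hU : PU ∈ stdSimplex ℝ U) (hκ : ∀ u, κ u ∈ stdSimplex ℝ X)
    {V1 : X → Y1 → ℝ} (hV1 : ∀ x, V1 x ∈ stdSimplex ℝ Y1)
    {V2 : X → Y2 → ℝ} (hV2 : ∀ x, V2 x ∈ stdSimplex ℝ Y2)
    {q : Y1 → Y2 → ℝ} (hq : ∀ y, q y ∈ stdSimplex ℝ Y2)
    (hdeg : ∀ x y2, V2 x y2 = ∑ y1, V1 x y1 * q y1 y2) {RI RJ : ℝ}
    (hJ : RJ < kernelInfo PU (fun u y => ∑ x, κ u x * V2 x y))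
    (hI : RI < ∑ u, PU u * kernelInfo (κ u) V1) {ε : ℝ} (hε : 0 < ε) :
    ∀ᶠ m : ℕ in atTop, ∀ Q : Fin ⌈exp (m * RI)⌉₊ × Fin ⌈exp (m * RJ)⌉₊ → ℝ, (∀ k, 0 ≤ Q k) →
      ∃ (cb : Fin ⌈exp (m * RI)⌉₊ × Fin ⌈exp (m * RJ)⌉₊ → Fin m → X)
        (d1 : (Fin m → Y1) → Fin ⌈exp (m * RI)⌉₊ × Fin ⌈exp (m * RJ)⌉₊)
        (d2 : (Fin m → Y2) → Fin ⌈exp (m * RJ)⌉₊),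
        ∑ k, Q k * ((∑ y, prodLaw (fun i => V1 (cb k i)) y * ind (d1 y ≠ k)) +
          ∑ y, prodLaw (fun i => V2 (cb k i)) y * ind (d2 y ≠ k.2)) ≤ (∑ k, Q k) * ε := by
  set I2 := kernelInfo PU (fun u y => ∑ x, κ u x * V2 x y) with hI2
  set I1 := kernelInfo PU (fun u y => ∑ x, κ u x * V1 x y) with hI1
  set IX := ∑ u, PU u * kernelInfo (κ u) V1 with hIX
  have hK1 : ∀ u, (fun y => ∑ x, κ u x * V1 x y) ∈ stdSimplex ℝ Y1 := fun u =>
    output_mem (hκ u) hV1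
  have hK2 : ∀ u, (fun y => ∑ x, κ u x * V2 x y) ∈ stdSimplex ℝ Y2 := fun u =>
    output_mem (hκ u) hV2
  -- The only use of degradedness: the stronger receiver must also identify the cloud, and data
  -- processing gives it at least the information of the weaker one.
  have hJ1 : RJ < I1 := by
    refine hJ.trans_le ?_
    have h := kernelInfo_degraded_le hU hK1 hq
    have e : (fun u (y' : Y2) => ∑ y, (∑ x, κ u x * V1 x y) * q y y') =
        fun u y => ∑ x, κ u x * V2 x y := by
      funext u y'
      simp_rw [hdeg, Finset.sum_mul, Finset.mul_sum]
      rw [Finset.sum_comm]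
      refine Finset.sum_congr rfl fun _ _ => Finset.sum_congr rfl fun _ _ => by ring
    rwa [e] at h
  -- Typicality thresholds lie strictly between rate and information: below the information the true
  -- codeword passes with high probability, above the rate the union over wrong codewords vanishes.
  obtain ⟨s1, hs1, hs1'⟩ := exists_between hJ1
  obtain ⟨s2, hs2, hs2'⟩ := exists_between hJ
  obtain ⟨sX, hsX, hsX'⟩ := exists_between hI
  have a1 := tendsto_prob_atypical hU hκ (fun _ => hV1)
    (fun u _ y => (∑ x, κ u x * V1 x y) / ∑ u, PU u * ∑ x, κ u x * V1 x y)
    (fun u x y hu hx hy => kernelInfo_density_pos hU hκ hV1 hu hx hy)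
    (hI1.trans (kernelInfo_comp_eq PU κ V1)) (sub_pos.2 hs1')
  have a2 := tendsto_prob_atypical hU hκ (fun _ => hV2)
    (fun u _ y => (∑ x, κ u x * V2 x y) / ∑ u, PU u * ∑ x, κ u x * V2 x y)
    (fun u x y hu hx hy => kernelInfo_density_pos hU hκ hV2 hu hx hy)
    (hI2.trans (kernelInfo_comp_eq PU κ V2)) (sub_pos.2 hs2')
  have aX := tendsto_prob_atypical hU hκ (fun _ => hV1)
    (fun u x y => V1 x y / ∑ x, κ u x * V1 x y)
    (fun u x y hu hx hy => div_pos hy (output_pos (hκ u) hV1 hx hy)) hIX (sub_pos.2 hsX')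
  simp only [sub_sub_cancel] at a1 a2 aX
  have hlim := ((a1.add (tendsto_card_mul_exp hs1)).add (aX.add (tendsto_card_mul_exp hsX))).add
    (a2.add (tendsto_card_mul_exp hs2))
  simp only [add_zero] at hlim
  filter_upwards [hlim.eventually_le_const hε] with m hm Q hQ
  have hne : ∀ x : ℝ, Nonempty (Fin ⌈exp x⌉₊) := fun x =>
    Fin.pos_iff_nonempty.1 (Nat.ceil_pos.2 (exp_pos x))
  have := hne (m * RI)
  have := hne (m * RJ)
  have hc1 : ∀ (u : Fin m → U) (y : Fin m → Y1),
      ∑ x, prodLaw (fun i => κ (u i)) x * prodLaw (fun i => V1 (x i)) y =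
        ∏ i, ∑ x, κ (u i) x * V1 x (y i) := fun u y =>
    sum_prodLaw_mul_prodLaw (fun i => κ (u i)) (fun _ => V1) y
  have hc2 : ∀ (u : Fin m → U) (y : Fin m → Y2),
      ∑ x, prodLaw (fun i => κ (u i)) x * prodLaw (fun i => V2 (x i)) y =
        ∏ i, ∑ x, κ (u i) x * V2 x (y i) := fun u y =>
    sum_prodLaw_mul_prodLaw (fun i => κ (u i)) (fun _ => V2) y
  obtain ⟨cb, d1, d2, h⟩ := exists_superposition_code
    (I := Fin ⌈exp (m * RI)⌉₊) (J := Fin ⌈exp (m * RJ)⌉₊)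
    (prodLaw_mem fun _ : Fin m => hU) (fun u => prodLaw_mem fun i : Fin m => hκ (u i))
    (V1 := fun x => prodLaw fun i => V1 (x i)) (fun x => prodLaw_mem fun i => hV1 (x i))
    (V2 := fun x => prodLaw fun i => V2 (x i)) (fun x => prodLaw_mem fun i => hV2 (x i))
    (fun u y => exp (m * s1) ≤
      ∏ i, ((∑ x, κ (u i) x * V1 x (y i)) / ∑ u, PU u * ∑ x, κ u x * V1 x (y i)))
    (fun u x y => exp (m * sX) ≤ ∏ i, (V1 (x i) (y i) / ∑ x, κ (u i) x * V1 x (y i)))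
    (fun u y => exp (m * s2) ≤
      ∏ i, ((∑ x, κ (u i) x * V2 x (y i)) / ∑ u, PU u * ∑ x, κ u x * V2 x (y i)))
    (exp_pos (-(m * s1))).le (exp_pos (-(m * sX))).le (exp_pos (-(m * s2))).le
    (fun u y hT => by
      simp_rw [hc1]
      refine (sum_prodLaw_mul_prodLaw (fun _ => PU)
        (fun _ u y => ∑ x, κ u x * V1 x y) y).trans_le ?_
      exact prod_le_exp_mul_prod (fun i => (hK1 (u i)).1 (y i))
        (fun i => (output_mem hU hK1).1 (y i)) hT)
    (fun u x y hT => by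
      simp_rw [hc1]
      exact prod_le_exp_mul_prod (fun i => (hV1 (x i)).1 (y i))
        (fun i => (hK1 (u i)).1 (y i)) hT)
    (fun u y hT => by
      simp_rw [hc2]
      refine (sum_prodLaw_mul_prodLaw (fun _ => PU)
        (fun _ u y => ∑ x, κ u x * V2 x y) y).trans_le ?_
      exact prod_le_exp_mul_prod (fun i => (hK2 (u i)).1 (y i))
        (fun i => (output_mem hU hK2).1 (y i)) hT) hQ
  refine ⟨cb, d1, d2, h.trans (mul_le_mul_of_nonneg_left ?_ (Finset.sum_nonneg fun k _ => hQ k))⟩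
  simpa only [Fintype.card_fin] using hm

end DownlinkCode

end TwoWayRelay

namespace TwoWayRelay

open Filter Topology Real

/-! ### Uplink codes with hashing over long blocks. -/

section UplinkCode

theorem exists_le_of_hashMean_le {A B Y S T K : Type*} [Fintype A] [Fintype B] [Fintype Y]
    [Fintype S] [Fintype T] [Fintype K] [DecidableEq S] [DecidableEq T] [DecidableEq Y] [Nonempty K]
    {PA : A → ℝ} {PB : B → ℝ} (hA : PA ∈ stdSimplex ℝ A) (hB : PB ∈ stdSimplex ℝ B)
    {F : (S → A) → (T → B) → (Y → K) → ℝ} {C : ℝ} (h : hashMean PA PB F ≤ C) :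
    ∃ cA cB h, F cA cB h ≤ C := by
  have hw : (fun w : (S → A) × (T → B) × (Y → K) => prodLaw (fun _ => PA) w.1 *
      prodLaw (fun _ => PB) w.2.1 * prodLaw (fun _ => unif K) w.2.2) ∈ stdSimplex ℝ _ := by
    have h1 := prodLaw_mem fun _ : S => hA
    have h2 := prodLaw_mem fun _ : T => hB
    have h3 := prodLaw_mem fun _ : Y => unif_mem (K := K)
    refine ⟨fun w => mul_nonneg (mul_nonneg (h1.1 _) (h2.1 _)) (h3.1 _), ?_⟩
    simp only [Fintype.sum_prod_type, ← Finset.mul_sum, h3.2, mul_one, h2.2, h1.2]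
  obtain ⟨w, hw⟩ := exists_le_of_mean_le hw (F := fun w => F w.1 w.2.1 w.2.2) (C := C)
    (by simpa only [Fintype.sum_prod_type, hashMean] using h)
  exact ⟨_, _, _, hw⟩

theorem sum_unif_collision {K : Type*} [Fintype K] [Nonempty K] :
    ∑ k : K, ∑ k', unif K k * unif K k' * ind (k' = k) = (Fintype.card K : ℝ)⁻¹ := by
  classical
  have h : ∀ k k' : K, ind (k' = k) = if k' = k then 1 else 0 := fun k k' => by
    by_cases hk : k' = k <;> simp [ind, hk]
  have : (Fintype.card K : ℝ) ≠ 0 := by exact_mod_cast Fintype.card_ne_zero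
  simp [h, unif]

theorem sum_unif_collision_snd {I J : Type*} [Fintype I] [Fintype J] [Nonempty I] [Nonempty J] :
    ∑ k : I × J, ∑ k', unif (I × J) k * unif (I × J) k' * ind (k'.2 = k.2) =
      (Fintype.card J : ℝ)⁻¹ := by
  have h1 : (Fintype.card I : ℝ) ≠ 0 := by exact_mod_cast Fintype.card_ne_zero
  have h2 : (Fintype.card J : ℝ) ≠ 0 := by exact_mod_cast Fintype.card_ne_zero
  have h := sum_unif_collision (K := J)
  have e : ∀ k k' : I × J, unif (I × J) k * unif (I × J) k' * ind (k'.2 = k.2) =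
      (Fintype.card I : ℝ)⁻¹ ^ 2 * (unif J k.2 * unif J k'.2 * ind (k'.2 = k.2)) := by
    intro k k'
    simp only [unif, Fintype.card_prod, Nat.cast_mul, mul_inv]
    ring
  simp_rw [e, ← Finset.mul_sum, Fintype.sum_prod_type]
  simp only [Finset.sum_const, Finset.card_univ, nsmul_eq_mul, ← Finset.mul_sum]
  rw [h]
  field_simp

variable {A B Y : Type*} [Fintype A] [Fintype B] [Fintype Y] [DecidableEq Y]

/-- Typical triples of codewords and received sequences, for which decoding from a hash value of
rate `ρ` succeeds on average. -/
theorem exists_typical_hashMean_error_le {PA : A → ℝ} {PB : B → ℝ} (hA : PA ∈ stdSimplex ℝ A)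
    (hB : PB ∈ stdSimplex ℝ B) {W : A → B → Y → ℝ} (hW : ∀ a b, W a b ∈ stdSimplex ℝ Y)
    {r ρ : ℝ} (hr : r = 0 ∨ r < ∑ b, PB b * kernelInfo PA (fun a => W a b) ∧
      r < ρ - ∑ a, ∑ b, PA a * PB b * ∑ y, negMulLog (W a b y)) :
    ∃ Typ : (m : ℕ) → (Fin m → A) → (Fin m → B) → (Fin m → Y) → Prop, ∀ ε > 0, ∀ᶠ m : ℕ in atTop,
      ∀ (T K L : Type) [Fintype T] [Fintype K] [DecidableEq T] [Nonempty K]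
        [Nonempty (Fin ⌈exp (m * r)⌉₊)] (pr : K → L),
        ∑ k, ∑ k', unif K k * unif K k' * ind (pr k' = pr k) ≤ exp (-(m * ρ)) →
        ∀ (s : Fin ⌈exp (m * r)⌉₊) (t : T),
          hashMean (K := K) (prodLaw fun _ : Fin m => PA) (prodLaw fun _ => PB) (fun cA cB h =>
            ∑ y, prodLaw (fun i => W (cA s i) (cB t i)) y *
              ind (hashDecode (Typ m) pr cA h (cB t) (pr (h y)) ≠ s)) ≤ ε := by
  set I := ∑ b, PB b * kernelInfo PA (fun a => W a b) with hI
  set H := ∑ a, ∑ b, PA a * PB b * ∑ y, negMulLog (W a b y) with hH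
  have hμI : I = ∑ a, PA a * ∑ b, PB b * ∑ y, W a b y *
      log (W a b y / ∑ a', PA a' * W a' b y) := by
    simp only [hI, kernelInfo, Finset.mul_sum]
    rw [Finset.sum_comm]
    refine Finset.sum_congr rfl fun _ _ => Finset.sum_congr rfl fun _ _ =>
      Finset.sum_congr rfl fun _ _ => by ring
  have hμH : -H = ∑ a, PA a * ∑ b, PB b * ∑ y, W a b y * log (W a b y) := by
    simp only [hH, Finset.mul_sum, ← Finset.sum_neg_distrib, negMulLog]
    refine Finset.sum_congr rfl fun _ _ => Finset.sum_congr rfl fun _ _ =>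
      Finset.sum_congr rfl fun _ _ => by ring
  -- When `r = 0` there is one codeword and no impostor, so the thresholds need only make the true
  -- triple typical; no relation to `ρ` is required.
  obtain ⟨sI, sH, hsI, hsH, hrs⟩ : ∃ sI sH, sI < I ∧ H < sH ∧ (r = 0 ∨ r < sI ∧ r < ρ - sH) := by
    rcases hr with hr | ⟨h1, h2⟩
    · exact ⟨I - 1, H + 1, by linarith, by linarith, Or.inl hr⟩
    · obtain ⟨sI, h3, h4⟩ := exists_between h1
      obtain ⟨s, h5, h6⟩ := exists_between h2
      exact ⟨sI, ρ - s, h4, by linarith, Or.inr ⟨h3, by linarith⟩⟩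
  -- The first test bounds the number of typical sequences by `exp (m * sH)`; the second is the
  -- density test against wrong codewords.
  refine ⟨fun m a b y => exp (m * -sH) ≤ ∏ i, W (a i) (b i) (y i) ∧
    exp (m * sI) ≤ ∏ i, (W (a i) (b i) (y i) / ∑ a', PA a' * W a' (b i) (y i)), fun ε hε => ?_⟩
  have aI := tendsto_prob_atypical hA (fun _ => hB) hW
    (fun a b y => W a b y / ∑ a', PA a' * W a' b y)
    (fun a b y ha hb hy => div_pos hy (output_pos hA (fun a => hW a b) ha hy)) hμI
    (sub_pos.2 hsI)
  have aH := tendsto_prob_atypical hA (fun _ => hB) hW (fun a b y => W a b y)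
    (fun a b y ha hb hy => hy) hμH (sub_pos.2 hsH)
  have hexp : -H - (sH - H) = -sH := by ring
  simp only [sub_sub_cancel, hexp] at aI aH
  have hcard : Tendsto (fun m : ℕ => ((⌈exp (m * r)⌉₊ : ℝ) - 1) *
      (exp (-(m * sI)) + exp (-(m * ρ)) * exp (m * sH))) atTop (𝓝 0) := by
    rcases hrs with hr | ⟨h1, h2⟩
    · simp [hr]
    · have := (tendsto_card_mul_exp h1).add (tendsto_card_mul_exp h2)
      rw [add_zero] at this
      refine this.congr fun m => ?_
      rw [← mul_add, ← exp_add]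
      congr 4
      ring
  have hlim := (aH.add aI).add hcard
  simp only [add_zero] at hlim
  filter_upwards [hlim.eventually_le_const hε] with m hm T K L _ _ _ _ _ pr hpr s t
  refine (hashMean_error_le (prodLaw_mem fun _ : Fin m => hA) (prodLaw_mem fun _ : Fin m => hB)
    (W := fun a b => prodLaw fun i => W (a i) (b i)) (fun a b => prodLaw_mem fun i => hW _ _)
    _ pr (θ := exp (-(m * sI))) (N := exp (m * sH)) (c := exp (-(m * ρ))) ?_ ?_ (exp_pos _).le
    (exp_pos _).le hpr s t).trans ?_
  · rintro a b y ⟨-, hT⟩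
    refine (sum_prodLaw_mul_prodLaw (fun _ => PA) (fun i a y => W a (b i) y) y).trans_le ?_
    exact prod_le_exp_mul_prod (fun i => (hW (a i) (b i)).1 (y i))
      (fun i => (output_mem hA fun a => hW a (b i)).1 (y i)) hT
  · rintro a b y ⟨hT, -⟩
    refine le_trans (le_of_eq ?_) (mul_le_mul_of_nonneg_left hT (exp_pos _).le)
    rw [← exp_add]
    simp
  · rw [Fintype.card_fin]
    refine le_trans (add_le_add ?_ le_rfl) hm
    simp_rw [mul_assoc, ← Finset.mul_sum, ← Finset.sum_add_distrib, ← mul_add]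
    refine Finset.sum_le_sum fun a _ => mul_le_mul_of_nonneg_left ?_
      (prodLaw_nonneg (fun _ => hA.1) a)
    rw [← Finset.sum_add_distrib]
    refine Finset.sum_le_sum fun b _ => ?_
    rw [← mul_add, ← Finset.sum_add_distrib]
    refine mul_le_mul_of_nonneg_left (Finset.sum_le_sum fun y _ => ?_)
      (prodLaw_nonneg (fun _ => hB.1) b)
    rw [← mul_add]
    refine mul_le_mul_of_nonneg_left ?_ (prodLaw_nonneg (fun i => (hW _ _).1) y)
    rw [not_and_or]
    exact ind_or_le _ _

/-- Uplink codes with a hash function: each node recovers the message of the other one from its own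
message and the hash value, or its second component. The pair of messages may have any law. -/
theorem eventually_exists_hash_code {PA : A → ℝ} {PB : B → ℝ} (hA : PA ∈ stdSimplex ℝ A)
    (hB : PB ∈ stdSimplex ℝ B) {W : A → B → Y → ℝ} (hW : ∀ a b, W a b ∈ stdSimplex ℝ Y)
    {r12 r21 RI RJ : ℝ}
    (h12 : r12 = 0 ∨ r12 < ∑ b, PB b * kernelInfo PA (fun a => W a b) ∧
      r12 < RJ - ∑ a, ∑ b, PA a * PB b * ∑ y, negMulLog (W a b y))
    (h21 : r21 = 0 ∨ r21 < ∑ a, PA a * kernelInfo PB (fun b => W a b) ∧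
      r21 < RI + RJ - ∑ a, ∑ b, PA a * PB b * ∑ y, negMulLog (W a b y)) {ε : ℝ} (hε : 0 < ε) :
    ∀ᶠ m : ℕ in atTop, ∀ Q : Fin ⌈exp (m * r12)⌉₊ → Fin ⌈exp (m * r21)⌉₊ → ℝ, (∀ s t, 0 ≤ Q s t) →
      ∃ (cA : Fin ⌈exp (m * r12)⌉₊ → Fin m → A) (cB : Fin ⌈exp (m * r21)⌉₊ → Fin m → B)
        (h : (Fin m → Y) → Fin ⌈exp (m * RI)⌉₊ × Fin ⌈exp (m * RJ)⌉₊)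
        (d1 : Fin ⌈exp (m * RI)⌉₊ × Fin ⌈exp (m * RJ)⌉₊ → Fin ⌈exp (m * r12)⌉₊ →
          Fin ⌈exp (m * r21)⌉₊)
        (d2 : Fin ⌈exp (m * RJ)⌉₊ → Fin ⌈exp (m * r21)⌉₊ → Fin ⌈exp (m * r12)⌉₊),
        ∑ s, ∑ t, Q s t * ((∑ y, prodLaw (fun i => W (cA s i) (cB t i)) y *
            ind (d1 (h y) s ≠ t)) + ∑ y, prodLaw (fun i => W (cA s i) (cB t i)) y *
            ind (d2 (h y).2 t ≠ s)) ≤ (∑ s, ∑ t, Q s t) * ε := by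
  -- Node 2 knows only the second component, so its hash rate is `RJ`; node 1 knows the pair, of
  -- hash rate `RI + RJ`.
  obtain ⟨T2, hT2⟩ := exists_typical_hashMean_error_le hA hB hW h12
  obtain ⟨T1, hT1⟩ := exists_typical_hashMean_error_le hB hA (W := fun b a => W a b)
    (fun b a => hW a b) (r := r21) (ρ := RI + RJ) (by
      rw [Finset.sum_comm] at h21
      simpa only [mul_comm (PB _) (PA _)] using h21)
  filter_upwards [hT2 (ε / 2) (half_pos hε), hT1 (ε / 2) (half_pos hε)] with m hm2 hm1 Q hQ
  have hne : ∀ x : ℝ, Nonempty (Fin ⌈exp x⌉₊) := fun x =>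
    Fin.pos_iff_nonempty.1 (Nat.ceil_pos.2 (exp_pos x))
  have := hne (m * RI)
  have := hne (m * RJ)
  have := hne (m * r12)
  have := hne (m * r21)
  have hinv : ∀ x : ℝ, (⌈exp x⌉₊ : ℝ)⁻¹ ≤ exp (-x) := fun x => by
    rw [exp_neg]
    exact inv_anti₀ (exp_pos x) (Nat.le_ceil _)
  have hc2 := hm2 (Fin ⌈exp (m * r21)⌉₊) (Fin ⌈exp (m * RI)⌉₊ × Fin ⌈exp (m * RJ)⌉₊) _ Prod.snd (by
    rw [sum_unif_collision_snd, Fintype.card_fin]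
    exact hinv _)
  have hc1 := hm1 (Fin ⌈exp (m * r12)⌉₊) (Fin ⌈exp (m * RI)⌉₊ × Fin ⌈exp (m * RJ)⌉₊) _ id (by
    simp only [id]
    rw [sum_unif_collision, Fintype.card_prod, Fintype.card_fin, Fintype.card_fin, Nat.cast_mul,
      mul_inv, mul_add, neg_add, exp_add]
    exact mul_le_mul (hinv _) (hinv _) (by positivity) (exp_pos _).le)
  -- Both errors are averaged over the same ensemble, so that one hash function and one pair of
  -- codebooks serve both nodes.
  have hmean : hashMean (K := Fin ⌈exp (m * RI)⌉₊ × Fin ⌈exp (m * RJ)⌉₊)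
      (S := Fin ⌈exp (m * r12)⌉₊) (T := Fin ⌈exp (m * r21)⌉₊)
      (prodLaw fun _ : Fin m => PA) (prodLaw fun _ : Fin m => PB) (fun cA cB h =>
        ∑ s, ∑ t, Q s t * ((∑ y, prodLaw (fun i => W (cA s i) (cB t i)) y *
            ind (hashDecode (T1 m) id cB h (cA s) (id (h y)) ≠ t)) +
          ∑ y, prodLaw (fun i => W (cA s i) (cB t i)) y *
            ind (hashDecode (T2 m) Prod.snd cA h (cB t) (h y).2 ≠ s))) ≤
      (∑ s, ∑ t, Q s t) * ε := by
    rw [hashMean_sum, Finset.sum_mul]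
    refine Finset.sum_le_sum fun s _ => ?_
    rw [hashMean_sum, Finset.sum_mul]
    refine Finset.sum_le_sum fun t _ => ?_
    rw [hashMean_const_mul, hashMean_add]
    refine mul_le_mul_of_nonneg_left ?_ (hQ s t)
    rw [← add_halves ε, hashMean_swap]
    exact add_le_add (hc1 t s) (hc2 s t)
  obtain ⟨cA, cB, h, hle⟩ := exists_le_of_hashMean_le (prodLaw_mem fun _ : Fin m => hA)
    (prodLaw_mem fun _ : Fin m => hB) hmean
  exact ⟨cA, cB, h, fun k s => hashDecode (T1 m) id cB h (cA s) k,
    fun l t => hashDecode (T2 m) Prod.snd cA h (cB t) l, hle⟩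

end UplinkCode

end TwoWayRelay

namespace TwoWayRelay

open Filter Topology

/-! ### Error probabilities of hash-and-forward schemes -/

theorem sum_mul_comp {Ω K : Type*} [Fintype Ω] [Fintype K] (c : Ω → ℝ) (f : Ω → K) (G : K → ℝ) :
    ∑ ω, c ω * G (f ω) = ∑ k, (∑ ω, c ω * ind (f ω = k)) * G k := by
  classical
  simp_rw [Finset.sum_mul]
  rw [Finset.sum_comm]
  refine Finset.sum_congr rfl fun ω _ => ?_
  rw [Finset.sum_eq_single (f ω)]
  · rw [ind_of rfl, mul_one]
  · intro k _ hk
    rw [ind_of_not hk.symm, mul_zero, zero_mul]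
  · simp

/-- The mean over independent uniform messages. -/
def messageMean {M12 M21 : ℕ} (F : Fin M12 → Fin M21 → ℝ) : ℝ :=
  ∑ w, ∑ w', (M12 : ℝ)⁻¹ * (M21 : ℝ)⁻¹ * F w w'

section MessageMean

variable {M12 M21 : ℕ}

theorem messageMean_mono {F G : Fin M12 → Fin M21 → ℝ} (h : ∀ w w', F w w' ≤ G w w') :
    messageMean F ≤ messageMean G :=
  Finset.sum_le_sum fun w _ => Finset.sum_le_sum fun w' _ =>
    mul_le_mul_of_nonneg_left (h w w') (by positivity)

theorem messageMean_const [Nonempty (Fin M12)] [Nonempty (Fin M21)] (c : ℝ) :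
    messageMean (fun (_ : Fin M12) (_ : Fin M21) => c) = c := by
  have h1 : (M12 : ℝ) ≠ 0 := by exact_mod_cast (Fin.pos_iff_nonempty.2 inferInstance).ne'
  have h2 : (M21 : ℝ) ≠ 0 := by exact_mod_cast (Fin.pos_iff_nonempty.2 inferInstance).ne'
  simp only [messageMean, Finset.sum_const, Finset.card_univ, Fintype.card_fin, nsmul_eq_mul]
  field_simp

theorem messageMean_sum {K : Type*} [Fintype K] (F : K → Fin M12 → Fin M21 → ℝ) (G : K → ℝ) :
    messageMean (fun w w' => ∑ k, F k w w' * G k) = ∑ k, messageMean (F k) * G k := by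
  simp only [messageMean, Finset.mul_sum, Finset.sum_mul]
  rw [Finset.sum_comm (γ := K)]
  refine Finset.sum_congr rfl fun w _ => ?_
  rw [Finset.sum_comm (γ := K)]
  refine Finset.sum_congr rfl fun _ _ => Finset.sum_congr rfl fun _ _ => by ring

theorem messageMean_nonneg {F : Fin M12 → Fin M21 → ℝ} (h : ∀ w w', 0 ≤ F w w') :
    0 ≤ messageMean F :=
  Finset.sum_nonneg fun w _ => Finset.sum_nonneg fun w' _ => mul_nonneg (by positivity) (h w w')

end MessageMean

section Scheme

variable {X12 X21 XR YR Y1 Y2 : Type*} [Fintype YR] [Fintype Y1] [Fintype Y2]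
  (ch : Channel X12 X21 XR YR Y1 Y2) {n M12 M21 : ℕ}

theorem Code.prob_eq_sum (c : Code X12 X21 XR YR Y1 Y2 n M12 M21)
    (E : Fin M12 → Fin M21 → (Fin n → YR) → (Fin n → Y1) → (Fin n → Y2) → Prop) :
    c.prob ch E = ∑ w12, ∑ w21, ∑ yR, ∑ y1, ∑ y2,
      c.jointProb ch w12 w21 yR y1 y2 * ind (E w12 w21 yR y1 y2) := by
  simp only [Code.prob, ind, mul_ite, mul_one, mul_zero]

theorem Code.jointProb_nonneg (c : Code X12 X21 XR YR Y1 Y2 n M12 M21) (w12 : Fin M12)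
    (w21 : Fin M21) (yR : Fin n → YR) (y1 : Fin n → Y1) (y2 : Fin n → Y2) :
    0 ≤ c.jointProb ch w12 w21 yR y1 y2 :=
  mul_nonneg (by positivity) (Finset.prod_nonneg fun i _ => mul_nonneg (mul_nonneg
    ((ch.up_mem _ _).1 _) ((ch.down1_mem _).1 _)) ((ch.down2_mem _).1 _))

theorem Code.prob_le_add (c : Code X12 X21 XR YR Y1 Y2 n M12 M21)
    {E F G : Fin M12 → Fin M21 → (Fin n → YR) → (Fin n → Y1) → (Fin n → Y2) → Prop}
    (h : ∀ w w' yR y1 y2, E w w' yR y1 y2 → F w w' yR y1 y2 ∨ G w w' yR y1 y2) :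
    c.prob ch E ≤ c.prob ch F + c.prob ch G := by
  simp only [Code.prob_eq_sum, ← Finset.sum_add_distrib, ← mul_add]
  exact Finset.sum_le_sum fun w _ => Finset.sum_le_sum fun w' _ => Finset.sum_le_sum fun yR _ =>
    Finset.sum_le_sum fun y1 _ => Finset.sum_le_sum fun y2 _ => mul_le_mul_of_nonneg_left
      ((ind_mono (h w w' yR y1 y2)).trans (ind_or_le _ _)) (c.jointProb_nonneg ch _ _ _ _ _)

namespace HFScheme

variable (s : HFScheme X12 X21 XR YR Y1 Y2 n M12 M21)

/-- The symbol that the relay sends at time `i`. -/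
def relayInput (yR : Fin n → YR) (i : Fin n) : XR := s.toCode.relay i (past yR i)

/-- Times in the downlink block have quotient `b + 1` and remainder `k`, so the relay is not idle
and reads the block that ended just before: the one-block delay makes it strictly causal. -/
theorem relayInput_block (yR : Fin n → YR) (b : Fin s.B) (k : Fin s.m) :
    s.relayInput yR ⟨((b : ℕ) + 1) * s.m + k, decoder_index_lt s.fits b.isLt k.isLt⟩ =
      s.cbR (s.hash (s.upBlock yR b)) k := by
  have hdiv : (((b : ℕ) + 1) * s.m + k) / s.m = b + 1 := by
    rw [mul_comm, Nat.mul_add_div s.m_pos, Nat.div_eq_of_lt k.isLt, add_zero]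
  have hmod : (((b : ℕ) + 1) * s.m + k) % s.m = k := by
    rw [mul_comm, Nat.mul_add_mod, Nat.mod_eq_of_lt k.isLt]
  have hcond : 1 ≤ (((b : ℕ) + 1) * s.m + k) / s.m ∧ (((b : ℕ) + 1) * s.m + k) / s.m ≤ s.B := by
    rw [hdiv]
    exact ⟨by omega, b.isLt⟩
  unfold relayInput
  simp only [toCode]
  rw [dif_pos hcond]
  congr 1
  · congr 1
    funext l
    simp only [past, upBlock]
    congr 1
    ext
    simp [hdiv]
  · ext
    exact hmod

theorem jointProb_toCode (w : Fin M12) (w' : Fin M21) (yR : Fin n → YR) (y1 : Fin n → Y1)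
    (y2 : Fin n → Y2) :
    s.toCode.jointProb ch w w' yR y1 y2 = (M12 : ℝ)⁻¹ * (M21 : ℝ)⁻¹ *
      (prodLaw (fun i => ch.up (s.cb12 w i) (s.cb21 w' i)) yR *
        prodLaw (fun i => ch.down1 (s.relayInput yR i)) y1 *
        prodLaw (fun i => ch.down2 (s.relayInput yR i)) y2) := by
  simp only [Code.jointProb, Finset.prod_mul_distrib]
  rfl

/-- The nodes encode without feedback, and given `yR` the two downlink outputs are independent, so
the unobserved one sums out. -/
theorem prob_node1 (E : Fin M12 → Fin M21 → (Fin n → YR) → (Fin n → Y1) → Prop) :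
    s.toCode.prob ch (fun w w' yR y1 _ => E w w' yR y1) = messageMean fun w w' =>
      ∑ yR, prodLaw (fun i => ch.up (s.cb12 w i) (s.cb21 w' i)) yR *
        ∑ y1, prodLaw (fun i => ch.down1 (s.relayInput yR i)) y1 * ind (E w w' yR y1) := by
  simp only [Code.prob_eq_sum, jointProb_toCode, messageMean, ← Finset.sum_mul, ← Finset.mul_sum,
    sum_prodLaw (fun i => (ch.down2_mem (s.relayInput _ i)).2), mul_one]
  simp only [mul_assoc, ← Finset.mul_sum]

theorem prob_node2 (E : Fin M12 → Fin M21 → (Fin n → YR) → (Fin n → Y2) → Prop) :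
    s.toCode.prob ch (fun w w' yR _ y2 => E w w' yR y2) = messageMean fun w w' =>
      ∑ yR, prodLaw (fun i => ch.up (s.cb12 w i) (s.cb21 w' i)) yR *
        ∑ y2, prodLaw (fun i => ch.down2 (s.relayInput yR i)) y2 * ind (E w w' yR y2) := by
  simp only [Code.prob_eq_sum, jointProb_toCode, messageMean]
  refine Finset.sum_congr rfl fun w _ => Finset.sum_congr rfl fun w' _ => ?_
  rw [Finset.mul_sum]
  refine Finset.sum_congr rfl fun yR _ => ?_
  rw [Finset.sum_comm]
  simp_rw [Finset.mul_sum]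
  refine Finset.sum_congr rfl fun y2 _ => ?_
  rw [← Finset.sum_mul, ← Finset.mul_sum, ← Finset.sum_mul, ← Finset.mul_sum,
    sum_prodLaw (fun i => (ch.down1_mem (s.relayInput _ i)).2)]
  ring

theorem prob_relay (E : Fin M12 → Fin M21 → (Fin n → YR) → Prop) :
    s.toCode.prob ch (fun w w' yR _ _ => E w w' yR) = messageMean fun w w' =>
      ∑ yR, prodLaw (fun i => ch.up (s.cb12 w i) (s.cb21 w' i)) yR * ind (E w w' yR) := by
  rw [prob_node1 ch s (fun w w' yR _ => E w w' yR)]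
  simp only [← Finset.sum_mul, sum_prodLaw (fun i => (ch.down1_mem (s.relayInput _ i)).2), one_mul]

/-- The law of the `b`-th received block at the relay, given the messages. -/
def blockLaw (w : Fin M12) (w' : Fin M21) (b : Fin s.B) : (Fin s.m → YR) → ℝ :=
  prodLaw fun k => ch.up (s.upBlock (s.cb12 w) b k) (s.upBlock (s.cb21 w') b k)

theorem sum_upBlock (w : Fin M12) (w' : Fin M21) (b : Fin s.B) (F : (Fin s.m → YR) → ℝ) :
    ∑ yR, prodLaw (fun i => ch.up (s.cb12 w i) (s.cb21 w' i)) yR * F (s.upBlock yR b) =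
      ∑ z, s.blockLaw ch w w' b z * F z := by
  refine sum_prodLaw_comp (e := fun k : Fin s.m =>
    (⟨(b : ℕ) * s.m + k, uplink_index_lt s.fits b.isLt k.isLt⟩ : Fin n))
    (fun i => (ch.up_mem _ _).2) ?_ F
  intro k l hkl
  ext
  simpa using hkl

/-- Given `yR`, the law of a downlink block depends only on the hash of the corresponding uplink
block. This lets the union bound treat blocks separately although they belong to one long
transmission. -/
theorem sum_downBlock {Y : Type*} [Fintype Y] {V : XR → Y → ℝ} (hV : ∀ x, V x ∈ stdSimplex ℝ Y)
    (yR : Fin n → YR) (b : Fin s.B) (F : (Fin s.m → Y) → ℝ) :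
    ∑ y, prodLaw (fun i => V (s.relayInput yR i)) y * F (s.downBlock y b) =
      ∑ z, prodLaw (fun k => V (s.cbR (s.hash (s.upBlock yR b)) k)) z * F z := by
  have h := sum_prodLaw_comp (e := fun k : Fin s.m =>
    (⟨((b : ℕ) + 1) * s.m + k, decoder_index_lt s.fits b.isLt k.isLt⟩ : Fin n))
    (μ := fun i => V (s.relayInput yR i)) (fun i => (hV _).2) (fun k l hkl => by
      ext
      simpa using hkl) F
  refine h.trans ?_
  simp only [Function.comp_def, relayInput_block]

/-- The mean number of blocks that are hashed to a given index. -/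
def hashLaw (k : Fin s.numI × Fin s.numJ) : ℝ :=
  messageMean fun w w' => ∑ b, ∑ z, s.blockLaw ch w w' b z * ind (s.hash z = k)

theorem blockLaw_mem (w : Fin M12) (w' : Fin M21) (b : Fin s.B) :
    s.blockLaw ch w w' b ∈ stdSimplex ℝ (Fin s.m → YR) :=
  prodLaw_mem fun _ => ch.up_mem _ _

theorem hashLaw_nonneg (k : Fin s.numI × Fin s.numJ) : 0 ≤ s.hashLaw ch k :=
  messageMean_nonneg fun w w' => Finset.sum_nonneg fun b _ => Finset.sum_nonneg fun z _ =>
    mul_nonneg ((s.blockLaw_mem ch w w' b).1 z) (ind_nonneg _)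

theorem sum_hashLaw_mul (G : Fin s.numI × Fin s.numJ → ℝ) :
    ∑ k, s.hashLaw ch k * G k =
      messageMean fun w w' => ∑ b, ∑ z, s.blockLaw ch w w' b z * G (s.hash z) := by
  simp only [hashLaw]
  rw [← messageMean_sum]
  congr 1
  funext w w'
  simp only [sum_mul_comp _ s.hash G, Finset.sum_mul (s := (Finset.univ : Finset (Fin s.B)))]
  rw [Finset.sum_comm]

/-- The total weight is `B`, not one: weighting a single-block error by `hashLaw` already sums it
over the blocks. -/
theorem sum_hashLaw [Nonempty (Fin M12)] [Nonempty (Fin M21)] : ∑ k, s.hashLaw ch k = s.B := by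
  have := s.sum_hashLaw_mul ch (fun _ => 1)
  simp only [mul_one, (s.blockLaw_mem ch _ _ _).2] at this
  rw [this, messageMean_const]
  simp

/-- The union bound over the blocks for an event on the hash value and the downlink block. -/
theorem messageMean_index_le {Y : Type*} [Fintype Y] {V : XR → Y → ℝ}
    (hV : ∀ x, V x ∈ stdSimplex ℝ Y) (bad : Fin s.numI × Fin s.numJ → (Fin s.m → Y) → Prop) :
    (messageMean fun w w' =>
      ∑ yR, prodLaw (fun i => ch.up (s.cb12 w i) (s.cb21 w' i)) yR *
        ∑ y, prodLaw (fun i => V (s.relayInput yR i)) y *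
          ind (∃ b, bad (s.hash (s.upBlock yR b)) (s.downBlock y b))) ≤
      ∑ k, s.hashLaw ch k * ∑ z, prodLaw (fun i => V (s.cbR k i)) z * ind (bad k z) := by
  rw [sum_hashLaw_mul]
  refine messageMean_mono fun w w' => ?_
  calc _ ≤ ∑ yR, prodLaw (fun i => ch.up (s.cb12 w i) (s.cb21 w' i)) yR *
        ∑ y, prodLaw (fun i => V (s.relayInput yR i)) y *
          ∑ b, ind (bad (s.hash (s.upBlock yR b)) (s.downBlock y b)) :=
        Finset.sum_le_sum fun yR _ => mul_le_mul_of_nonneg_left (Finset.sum_le_sum fun y _ =>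
          mul_le_mul_of_nonneg_left (ind_exists_le _) (prodLaw_nonneg (fun i => (hV _).1) y))
          (prodLaw_nonneg (fun i => (ch.up_mem _ _).1) yR)
    _ = ∑ b, ∑ yR, prodLaw (fun i => ch.up (s.cb12 w i) (s.cb21 w' i)) yR *
        ∑ z, prodLaw (fun i => V (s.cbR (s.hash (s.upBlock yR b)) i)) z *
          ind (bad (s.hash (s.upBlock yR b)) z) := by
        rw [Finset.sum_comm]
        refine Finset.sum_congr rfl fun yR _ => ?_
        rw [← Finset.mul_sum]
        refine congrArg _ ?_
        simp_rw [← s.sum_downBlock hV yR _ (fun z => ind (bad (s.hash (s.upBlock yR _)) z)),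
          Finset.mul_sum]
        rw [Finset.sum_comm]
    _ = _ := by
        refine Finset.sum_congr rfl fun b _ => ?_
        exact s.sum_upBlock ch w w' b (fun z => ∑ y, prodLaw (fun i => V (s.cbR (s.hash z) i)) y *
          ind (bad (s.hash z) y))

theorem indexErr1_le : s.indexErr1 ch ≤ ∑ k, s.hashLaw ch k *
    ∑ z, prodLaw (fun i => ch.down1 (s.cbR k i)) z * ind (s.index1 z ≠ k) := by
  unfold indexErr1
  rw [s.prob_node1 ch (fun _ _ yR y1 => ∃ b, s.index1 (s.downBlock y1 b) ≠ s.hash (s.upBlock yR b))]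
  exact s.messageMean_index_le ch ch.down1_mem (fun k z => s.index1 z ≠ k)

theorem indexErr2_le : s.indexErr2 ch ≤ ∑ k, s.hashLaw ch k *
    ∑ z, prodLaw (fun i => ch.down2 (s.cbR k i)) z * ind (s.index2 z ≠ k.2) := by
  unfold indexErr2
  rw [s.prob_node2 ch (fun _ _ yR y2 =>
    ∃ b, s.index2 (s.downBlock y2 b) ≠ (s.hash (s.upBlock yR b)).2)]
  exact s.messageMean_index_le ch ch.down2_mem (fun k z => s.index2 z ≠ k.2)

/-- The union bound over the blocks for an event on the messages and the uplink block. -/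
theorem prob_relay_le (bad : Fin M12 → Fin M21 → Fin s.B → (Fin s.m → YR) → Prop) :
    s.toCode.prob ch (fun w w' yR _ _ => ∃ b, bad w w' b (s.upBlock yR b)) ≤
      messageMean fun w w' => ∑ b, ∑ z, s.blockLaw ch w w' b z * ind (bad w w' b z) := by
  rw [s.prob_relay ch (fun w w' yR => ∃ b, bad w w' b (s.upBlock yR b))]
  refine messageMean_mono fun w w' => ?_
  refine (Finset.sum_le_sum fun yR _ => mul_le_mul_of_nonneg_left (ind_exists_le _)
    (prodLaw_nonneg (fun i => (ch.up_mem _ _).1) yR)).trans_eq ?_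
  simp_rw [Finset.mul_sum]
  rw [Finset.sum_comm]
  exact Finset.sum_congr rfl fun b _ => s.sum_upBlock ch w w' b (fun z => ind (bad w w' b z))

end HFScheme

end Scheme

/-! ### Schemes from block codes -/

/-- A code for a single block: uplink codebooks, hash function and decoders, downlink codebook and
index decoders. -/
structure BlockCode (X12 X21 XR YR Y1 Y2 : Type*) (m S T I J : ℕ) where
  cb12 : Fin S → Fin m → X12
  cb21 : Fin T → Fin m → X21
  hash : (Fin m → YR) → Fin I × Fin J
  dec1 : Fin I × Fin J → Fin S → Fin T
  dec2 : Fin J → Fin T → Fin S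
  cbR : Fin I × Fin J → Fin m → XR
  index1 : (Fin m → Y1) → Fin I × Fin J
  index2 : (Fin m → Y2) → Fin J

section BlockScheme

variable {X12 X21 XR YR Y1 Y2 : Type*} [Fintype YR] [Fintype Y1] [Fintype Y2]
  (ch : Channel X12 X21 XR YR Y1 Y2) {n M12 M21 m S T I J B : ℕ}

/-- The sequence that consists of the blocks `c (f b)`, padded with `x`. -/
def concatBlocks {S X : Type*} (hm : 0 < m) (c : S → Fin m → X) (f : Fin B → S) (x : X)
    (i : Fin n) : X :=
  if h : (i : ℕ) / m < B then c (f ⟨(i : ℕ) / m, h⟩) ⟨(i : ℕ) % m, Nat.mod_lt _ hm⟩ else x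

theorem concatBlocks_apply {S X : Type*} (hm : 0 < m) (c : S → Fin m → X) (f : Fin B → S) (x : X)
    (b : Fin B) (k : Fin m) (h : (b : ℕ) * m + k < n) :
    concatBlocks hm c f x ⟨(b : ℕ) * m + k, h⟩ = c (f b) k := by
  have hdiv : ((b : ℕ) * m + k) / m = b := by
    rw [mul_comm, Nat.mul_add_div hm, Nat.div_eq_of_lt k.isLt, add_zero]
  have hmod : ((b : ℕ) * m + k) % m = k := by
    rw [mul_comm, Nat.mul_add_mod, Nat.mod_eq_of_lt k.isLt]
  unfold concatBlocks
  simp only [hdiv, hmod, b.isLt, dif_pos]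

namespace BlockCode

variable (c : BlockCode X12 X21 XR YR Y1 Y2 m S T I J)

/-- The hash-and-forward scheme that sends `B` independently coded blocks, the messages being split
by `f` and `g`. -/
def toScheme [Nonempty (Fin M12)] [Nonempty (Fin M21)] (hm : 0 < m) (hf : (B + 1) * m ≤ n)
    (f : Fin M12 → Fin B → Fin S) (g : Fin M21 → Fin B → Fin T) (x12 : X12) (x21 : X21) (xR : XR) :
    HFScheme X12 X21 XR YR Y1 Y2 n M12 M21 where
  m := m
  B := B
  m_pos := hm
  fits := hf
  numI := I
  numJ := J
  cb12 w := concatBlocks hm c.cb12 (f w) x12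
  cb21 w := concatBlocks hm c.cb21 (g w) x21
  hash := c.hash
  cbR := c.cbR
  idle _ := xR
  index1 := c.index1
  index2 := c.index2
  dec1 k w := Function.invFun g fun b => c.dec1 (k b) (f w b)
  dec2 j w := Function.invFun f fun b => c.dec2 (j b) (g w b)

variable [Nonempty (Fin M12)] [Nonempty (Fin M21)] (hm : 0 < m) (hf : (B + 1) * m ≤ n)
  (f : Fin M12 → Fin B → Fin S) (g : Fin M21 → Fin B → Fin T) (x12 : X12) (x21 : X21) (xR : XR)

theorem blockLaw_toScheme (w : Fin M12) (w' : Fin M21) (b : Fin B) :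
    (c.toScheme hm hf f g x12 x21 xR).blockLaw ch w w' b =
      prodLaw fun k => ch.up (c.cb12 (f w b) k) (c.cb21 (g w' b) k) := by
  unfold HFScheme.blockLaw
  congr 1
  funext k
  exact congrArg₂ ch.up (concatBlocks_apply hm c.cb12 (f w) x12 b k _)
    (concatBlocks_apply hm c.cb21 (g w') x21 b k _)

/-- The mean number of blocks that carry a given pair of block messages. -/
def splitLaw (f : Fin M12 → Fin B → Fin S) (g : Fin M21 → Fin B → Fin T) (s : Fin S) (t : Fin T) :
    ℝ :=
  messageMean fun w w' => ∑ b, ind ((f w b, g w' b) = (s, t))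

theorem splitLaw_nonneg (s : Fin S) (t : Fin T) : 0 ≤ splitLaw f g s t :=
  messageMean_nonneg fun _ _ => Finset.sum_nonneg fun _ _ => ind_nonneg _

theorem sum_splitLaw_mul (G : Fin S → Fin T → ℝ) :
    ∑ s, ∑ t, splitLaw f g s t * G s t = messageMean fun w w' => ∑ b, G (f w b) (g w' b) := by
  rw [← Fintype.sum_prod_type']
  simp only [splitLaw]
  rw [← messageMean_sum (fun (k : Fin S × Fin T) w w' => ∑ b, ind ((f w b, g w' b) = (k.1, k.2)))
    (fun k => G k.1 k.2)]
  congr 1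
  funext w w'
  have := sum_mul_comp (fun _ : Fin B => (1 : ℝ)) (fun b => (f w b, g w' b)) (fun k => G k.1 k.2)
  simp only [one_mul] at this
  rw [this]

theorem sum_splitLaw : ∑ s, ∑ t, splitLaw f g s t = B := by
  have := sum_splitLaw_mul f g (fun _ _ => 1)
  simp only [mul_one] at this
  rw [this, messageMean_const]
  simp

variable {f g}

/-- If every index arrives correctly and every block decoder succeeds on the true hash, the node
holds all of `g w'`, and injectivity returns `w'`. The second kind of failure depends on the uplink
alone and is bounded block by block. -/
theorem err1_toScheme_le (hg : Function.Injective g) :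
    (c.toScheme hm hf f g x12 x21 xR).toCode.err1 ch ≤
      (c.toScheme hm hf f g x12 x21 xR).indexErr1 ch + ∑ s, ∑ t, splitLaw f g s t *
        ∑ y, prodLaw (fun i => ch.up (c.cb12 s i) (c.cb21 t i)) y *
          ind (c.dec1 (c.hash y) s ≠ t) := by
  rw [sum_splitLaw_mul f g (fun s t => ∑ y, prodLaw (fun i => ch.up (c.cb12 s i) (c.cb21 t i)) y *
          ind (c.dec1 (c.hash y) s ≠ t))]
  have h := (c.toScheme hm hf f g x12 x21 xR).prob_relay_le ch
    (fun w w' b z => c.dec1 (c.hash z) (f w b) ≠ g w' b)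
  refine (Code.prob_le_add ch _ fun w w' yR y1 y2 hE => ?_).trans (add_le_add le_rfl (h.trans_eq ?_))
  · by_contra! hcon
    obtain ⟨h1, h2⟩ := hcon
    apply hE
    change Function.invFun g (fun b => c.dec1 _ (f w b)) = w'
    rw [← Function.leftInverse_invFun hg w']
    congr 1
    funext b
    rw [← h2 b]
    exact congrArg (fun k => c.dec1 k (f w b)) (h1 b)
  · refine congrArg messageMean (funext fun w => funext fun w' => ?_)
    refine Finset.sum_congr rfl fun b _ => Finset.sum_congr rfl fun z _ => ?_
    exact congrArg (· * _) (congrFun (c.blockLaw_toScheme ch hm hf f g x12 x21 xR w w' b) z)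

theorem err2_toScheme_le (hinj : Function.Injective f) :
    (c.toScheme hm hf f g x12 x21 xR).toCode.err2 ch ≤
      (c.toScheme hm hf f g x12 x21 xR).indexErr2 ch + ∑ s, ∑ t, splitLaw f g s t *
        ∑ y, prodLaw (fun i => ch.up (c.cb12 s i) (c.cb21 t i)) y *
          ind (c.dec2 (c.hash y).2 t ≠ s) := by
  rw [sum_splitLaw_mul f g (fun s t => ∑ y, prodLaw (fun i => ch.up (c.cb12 s i) (c.cb21 t i)) y *
          ind (c.dec2 (c.hash y).2 t ≠ s))]
  have h := (c.toScheme hm hf f g x12 x21 xR).prob_relay_le ch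
    (fun w w' b z => c.dec2 (c.hash z).2 (g w' b) ≠ f w b)
  refine (Code.prob_le_add ch _ fun w w' yR y1 y2 hE => ?_).trans (add_le_add le_rfl (h.trans_eq ?_))
  · by_contra! hcon
    obtain ⟨h1, h2⟩ := hcon
    apply hE
    change Function.invFun f (fun b => c.dec2 _ (g w' b)) = w
    rw [← Function.leftInverse_invFun hinj w]
    congr 1
    funext b
    rw [← h2 b]
    exact congrArg (fun k => c.dec2 k (g w' b)) (h1 b)
  · refine congrArg messageMean (funext fun w => funext fun w' => ?_)
    refine Finset.sum_congr rfl fun b _ => Finset.sum_congr rfl fun z _ => ?_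
    exact congrArg (· * _) (congrFun (c.blockLaw_toScheme ch hm hf f g x12 x21 xR w w' b) z)

end BlockCode

end BlockScheme

end TwoWayRelay

namespace TwoWayRelay

open Filter Topology Real

/-! ### Choice of the block parameters, and achievability. -/

theorem numMessages_nonempty (n : ℕ) (R : ℝ) : Nonempty (Fin (numMessages n R)) :=
  Fin.pos_iff_nonempty.1 (Nat.ceil_pos.2 (by positivity))

/-- A message can be split into `B` block messages. -/
theorem exists_injective_split {n m B : ℕ} {R r : ℝ} (h : n * (R * log 2) ≤ m * B * r) :
    ∃ f : Fin (numMessages n R) → Fin B → Fin ⌈exp (m * r)⌉₊, Function.Injective f := by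
  have hcard : numMessages n R ≤ ⌈exp (m * r)⌉₊ ^ B := by
    refine Nat.ceil_le.2 ?_
    calc (2 : ℝ) ^ ((n : ℝ) * R) = exp (n * (R * log 2)) := by
          rw [rpow_def_of_pos two_pos]
          congr 1
          ring
      _ ≤ exp (m * B * r) := exp_le_exp.2 h
      _ = exp (m * r) ^ B := by
          rw [← exp_nat_mul]
          congr 1
          ring
      _ ≤ (⌈exp (m * r)⌉₊ : ℝ) ^ B := pow_le_pow_left₀ (exp_pos _).le (Nat.le_ceil _) B
      _ = _ := by push_cast; rfl
  obtain ⟨e⟩ := Function.Embedding.nonempty_of_card_le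
    (α := Fin (numMessages n R)) (β := Fin B → Fin ⌈exp (m * r)⌉₊) (by simpa using hcard)
  exact ⟨e, e.injective⟩

/-- The order of choice matters: `B` is first taken so large that `B * r` exceeds `(B + 1) * a`,
which pays for the idle block; then `m` pays for the rounding of n to a multiple of B + 1. Rate zero
needs no slack. -/
theorem eventually_block_rate_le {a r : ℝ} (ha : 0 ≤ a) (h : a = 0 ∧ r = 0 ∨ a < r) :
    ∀ᶠ B : ℕ in atTop, ∀ᶠ m : ℕ in atTop, ((m + 1) * (B + 1) : ℝ) * a ≤ m * B * r := by
  rcases h with ⟨rfl, rfl⟩ | h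
  · simp
  · obtain ⟨B0, hB0⟩ := exists_nat_gt (a / (r - a))
    filter_upwards [eventually_ge_atTop B0] with B hB
    have hBr : a / (r - a) < B := hB0.trans_le (by exact_mod_cast hB)
    rw [div_lt_iff₀ (sub_pos.2 h)] at hBr
    have hd : 0 < B * r - (B + 1) * a := by linarith
    obtain ⟨m0, hm0⟩ := exists_nat_gt ((B + 1) * a / (B * r - (B + 1) * a))
    filter_upwards [eventually_ge_atTop m0] with m hm
    have hmr : (B + 1) * a / (B * r - (B + 1) * a) < m := hm0.trans_le (by exact_mod_cast hm)
    rw [div_lt_iff₀ hd] at hmr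
    linarith

section Achievability

variable {X12 X21 XR YR Y1 Y2 : Type*} [Fintype X12] [Fintype X21] [Fintype XR]
  [Fintype YR] [Fintype Y1] [Fintype Y2] (ch : Channel X12 X21 XR YR Y1 Y2)

/-- With `B` fixed, single-block errors tending to zero may be summed over the blocks. The messages
enter only through the injections `f` and `g`; their effect on the block messages is carried by the
weights. -/
theorem HFScheme.exists_of_blocks (hdeg : ch.IsDegraded) {p12 : X12 → ℝ} {p21 : X21 → ℝ}
    (h12 : p12 ∈ stdSimplex ℝ X12) (h21 : p21 ∈ stdSimplex ℝ X21) {U : Type*} [Fintype U]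
    {PU : U → ℝ} {κ : U → XR → ℝ} (hU : PU ∈ stdSimplex ℝ U) (hκ : ∀ u, κ u ∈ stdSimplex ℝ XR)
    {r12 r21 RI RJ : ℝ}
    (hJ : RJ < kernelInfo PU (fun u y => ∑ x, κ u x * ch.down2 x y))
    (hI : RI < ∑ u, PU u * kernelInfo (κ u) ch.down1)
    (hr12 : r12 = 0 ∨ r12 < ∑ b, p21 b * kernelInfo p12 (fun a => ch.up a b) ∧
      r12 < RJ - ∑ a, ∑ b, p12 a * p21 b * ∑ y, negMulLog (ch.up a b y))
    (hr21 : r21 = 0 ∨ r21 < ∑ a, p12 a * kernelInfo p21 (fun b => ch.up a b) ∧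
      r21 < RI + RJ - ∑ a, ∑ b, p12 a * p21 b * ∑ y, negMulLog (ch.up a b y))
    (B : ℕ) {ε : ℝ} (hε : 0 < ε) :
    ∀ᶠ m : ℕ in atTop, ∀ (n M12 M21 : ℕ) [Nonempty (Fin M12)] [Nonempty (Fin M21)]
      (f : Fin M12 → Fin B → Fin ⌈exp (m * r12)⌉₊) (g : Fin M21 → Fin B → Fin ⌈exp (m * r21)⌉₊),
      Function.Injective f → Function.Injective g → (B + 1) * m ≤ n →
      ∃ s : HFScheme X12 X21 XR YR Y1 Y2 n M12 M21,
        s.toCode.err1 ch < ε ∧ s.toCode.err2 ch < ε ∧ s.indexErr1 ch < ε ∧ s.indexErr2 ch < ε := by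
  classical
  obtain ⟨q, hq, hqd⟩ := hdeg
  obtain ⟨x12⟩ := nonempty_of_mem_stdSimplex h12
  obtain ⟨x21⟩ := nonempty_of_mem_stdSimplex h21
  obtain ⟨u⟩ := nonempty_of_mem_stdSimplex hU
  obtain ⟨xR⟩ := nonempty_of_mem_stdSimplex (hκ u)
  -- A message error collects at most `B * δ` from the downlink and `B * δ` from the uplink; `B + 1`
  -- keeps the quotient meaningful for `B = 0`.
  set δ := ε / (2 * (B + 1)) with hδ
  have hδ0 : 0 < δ := by positivity
  have hBδ : B * δ + B * δ < ε := by
    have : (2 * (B + 1) : ℝ) * δ = ε := by rw [hδ]; field_simp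
    linarith
  filter_upwards [eventually_exists_hash_code h12 h21 ch.up_mem hr12 hr21 hδ0,
    eventually_exists_superposition_code hU hκ ch.down1_mem ch.down2_mem hq hqd hJ hI hδ0,
    eventually_gt_atTop 0] with m hup hdown hm n M12 M21 _ _ f g hf hg hn
  obtain ⟨cA, cB, h, d1, d2, hle⟩ := hup _ (BlockCode.splitLaw_nonneg f g)
  have hne : ∀ x : ℝ, 0 < ⌈exp x⌉₊ := fun x => Nat.ceil_pos.2 (exp_pos x)
  let k0 : Fin ⌈exp (m * RI)⌉₊ × Fin ⌈exp (m * RJ)⌉₊ := (⟨0, hne _⟩, ⟨0, hne _⟩)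
  let c0 : BlockCode X12 X21 XR YR Y1 Y2 m _ _ _ _ :=
    ⟨cA, cB, h, d1, d2, fun _ _ => xR, fun _ => k0, fun _ => k0.2⟩
  obtain ⟨cb, e1, e2, hle2⟩ := hdown _ ((c0.toScheme hm hn f g x12 x21 xR).hashLaw_nonneg ch)
  let c : BlockCode X12 X21 XR YR Y1 Y2 m _ _ _ _ := ⟨cA, cB, h, d1, d2, cb, e1, e2⟩
  have hsum := (c0.toScheme hm hn f g x12 x21 xR).sum_hashLaw ch
  rw [BlockCode.sum_splitLaw] at hle
  have i1 := (c.toScheme hm hn f g x12 x21 xR).indexErr1_le ch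
  have i2 := (c.toScheme hm hn f g x12 x21 xR).indexErr2_le ch
  have w1 := c.err1_toScheme_le ch hm hn x12 x21 xR (f := f) hg
  have w2 := c.err2_toScheme_le ch hm hn x12 x21 xR (g := g) hf
  have hup1 : ∀ s t, 0 ≤ ∑ y, prodLaw (fun i => ch.up (cA s i) (cB t i)) y *
      ind (d1 (h y) s ≠ t) := fun s t => Finset.sum_nonneg fun y _ =>
    mul_nonneg (prodLaw_nonneg (fun i => (ch.up_mem _ _).1) y) (ind_nonneg _)
  have hup2 : ∀ s t, 0 ≤ ∑ y, prodLaw (fun i => ch.up (cA s i) (cB t i)) y *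
      ind (d2 (h y).2 t ≠ s) := fun s t => Finset.sum_nonneg fun y _ =>
    mul_nonneg (prodLaw_nonneg (fun i => (ch.up_mem _ _).1) y) (ind_nonneg _)
  have hdn1 : ∀ k, 0 ≤ ∑ y, prodLaw (fun i => ch.down1 (cb k i)) y * ind (e1 y ≠ k) := fun k =>
    Finset.sum_nonneg fun y _ => mul_nonneg (prodLaw_nonneg (fun i => (ch.down1_mem _).1) y)
      (ind_nonneg _)
  have hdn2 : ∀ k, 0 ≤ ∑ y, prodLaw (fun i => ch.down2 (cb k i)) y * ind (e2 y ≠ k.2) := fun k =>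
    Finset.sum_nonneg fun y _ => mul_nonneg (prodLaw_nonneg (fun i => (ch.down2_mem _).1) y)
      (ind_nonneg _)
  have hd : ∀ a b : ℝ, 0 ≤ a → 0 ≤ b → a ≤ a + b ∧ b ≤ a + b := fun a b ha hb =>
    ⟨by linarith, by linarith⟩
  have hle2' := hle2.trans_eq (congrArg (· * δ) hsum)
  have j1 : (c.toScheme hm hn f g x12 x21 xR).indexErr1 ch ≤ B * δ :=
    (i1.trans (Finset.sum_le_sum fun k _ => mul_le_mul_of_nonneg_left
      (hd _ _ (hdn1 k) (hdn2 k)).1 (HFScheme.hashLaw_nonneg ch _ k))).trans hle2'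
  have j2 : (c.toScheme hm hn f g x12 x21 xR).indexErr2 ch ≤ B * δ :=
    (i2.trans (Finset.sum_le_sum fun k _ => mul_le_mul_of_nonneg_left
      (hd _ _ (hdn1 k) (hdn2 k)).2 (HFScheme.hashLaw_nonneg ch _ k))).trans hle2'
  have v1 := w1.trans (add_le_add j1 ((Finset.sum_le_sum fun s _ => Finset.sum_le_sum fun t _ =>
    mul_le_mul_of_nonneg_left (hd _ _ (hup1 s t) (hup2 s t)).1
      (BlockCode.splitLaw_nonneg f g s t)).trans hle))
  have v2 := w2.trans (add_le_add j2 ((Finset.sum_le_sum fun s _ => Finset.sum_le_sum fun t _ =>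
    mul_le_mul_of_nonneg_left (hd _ _ (hup1 s t) (hup2 s t)).2
      (BlockCode.splitLaw_nonneg f g s t)).trans hle))
  have hB0 : (0 : ℝ) ≤ B * δ := by positivity
  exact ⟨_, v1.trans_lt hBδ, v2.trans_lt hBδ, by linarith, by linarith⟩

theorem hfAchievable_of_rates (hdeg : ch.IsDegraded) {p12 : X12 → ℝ} {p21 : X21 → ℝ}
    (h12 : p12 ∈ stdSimplex ℝ X12) (h21 : p21 ∈ stdSimplex ℝ X21) {U : Type*} [Fintype U]
    {PU : U → ℝ} {κ : U → XR → ℝ} (hU : PU ∈ stdSimplex ℝ U) (hκ : ∀ u, κ u ∈ stdSimplex ℝ XR)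
    {r12 r21 RI RJ : ℝ}
    (hJ : RJ < kernelInfo PU (fun u y => ∑ x, κ u x * ch.down2 x y))
    (hI : RI < ∑ u, PU u * kernelInfo (κ u) ch.down1)
    (hr12 : r12 = 0 ∨ r12 < ∑ b, p21 b * kernelInfo p12 (fun a => ch.up a b) ∧
      r12 < RJ - ∑ a, ∑ b, p12 a * p21 b * ∑ y, negMulLog (ch.up a b y))
    (hr21 : r21 = 0 ∨ r21 < ∑ a, p12 a * kernelInfo p21 (fun b => ch.up a b) ∧
      r21 < RI + RJ - ∑ a, ∑ b, p12 a * p21 b * ∑ y, negMulLog (ch.up a b y))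
    {R : ℝ × ℝ} (hR1 : 0 ≤ R.1) (hR2 : 0 ≤ R.2)
    (h1 : R.1 * log 2 = 0 ∧ r12 = 0 ∨ R.1 * log 2 < r12)
    (h2 : R.2 * log 2 = 0 ∧ r21 = 0 ∨ R.2 * log 2 < r21) : HFAchievable ch R := by
  have hl : 0 < log 2 := log_pos one_lt_two
  refine ⟨hR1, hR2, fun ε hε => ?_⟩
  -- One `B` for both rates, fixed before `n`; the block length is then n / (B + 1), which tends to
  -- infinity.
  obtain ⟨B, hB1, hB2⟩ := ((eventually_block_rate_le (by positivity) h1).and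
    (eventually_block_rate_le (by positivity) h2)).exists
  have hall := (HFScheme.exists_of_blocks ch hdeg h12 h21 hU hκ hJ hI hr12 hr21 B hε).and
    (hB1.and hB2)
  have hdiv : Tendsto (fun n : ℕ => n / (B + 1)) atTop atTop :=
    Nat.tendsto_div_const_atTop (Nat.succ_ne_zero B)
  filter_upwards [hdiv.eventually hall] with n hn
  obtain ⟨hs, hm1, hm2⟩ := hn
  set m := n / (B + 1) with hm
  have hnm : (n : ℝ) ≤ (m + 1) * (B + 1) := by
    have : n < (B + 1) * (m + 1) := Nat.lt_mul_div_succ n (Nat.succ_pos B)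
    have h : (n : ℝ) ≤ ((B + 1) * (m + 1) : ℕ) := by exact_mod_cast this.le
    push_cast at h
    linarith
  obtain ⟨f, hf⟩ := exists_injective_split (n := n) (R := R.1) (r := r12) (m := m) (B := B)
    ((mul_le_mul_of_nonneg_right hnm (by positivity)).trans hm1)
  obtain ⟨g, hg⟩ := exists_injective_split (n := n) (R := R.2) (r := r21) (m := m) (B := B)
    ((mul_le_mul_of_nonneg_right hnm (by positivity)).trans hm2)
  have := numMessages_nonempty n R.1
  have := numMessages_nonempty n R.2
  exact hs n _ _ f g hf hg (by rw [hm, mul_comm]; exact Nat.div_mul_le_self n (B + 1))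

/-- A rate can be lowered slightly to leave room in the hash-and-forward inequalities. -/
theorem exists_slack_rate {R η I a : ℝ} (hR : 0 ≤ R) (hη : 0 < η)
    (h : R ≤ min I (max a 0)) :
    ∃ R' r, 0 ≤ R' ∧ |R - R'| ≤ η ∧ (R' * log 2 = 0 ∧ r * log 2 = 0 ∨ R' * log 2 < r * log 2) ∧
      (r * log 2 = 0 ∨ r * log 2 < I * log 2 ∧ r * log 2 < (a - η / 2) * log 2) := by
  have hl : 0 < log 2 := log_pos one_lt_two
  -- A rate at most `η` is replaced by zero, which needs no constraint even if `a < 0`. A larger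
  -- rate is positive, so the bound by `max a 0` is a bound by `a`.
  rcases le_or_gt R η with hRη | hRη
  · refine ⟨0, 0, le_rfl, ?_, Or.inl (by simp), Or.inl (by simp)⟩
    rwa [sub_zero, abs_of_nonneg hR]
  · have hI : R ≤ I := h.trans (min_le_left _ _)
    have ha : R ≤ a := by
      rcases le_max_iff.1 (h.trans (min_le_right _ _)) with h | h
      · exact h
      · linarith
    -- The block rate `R - 3 / 4 * η` lies above the rate `R - η` and, as `R ≤ a`, below `a - η /
    -- 2`.
    refine ⟨R - η, R - 3 / 4 * η, by linarith, ?_,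
      Or.inr (mul_lt_mul_of_pos_right (by linarith) hl),
      Or.inr ⟨mul_lt_mul_of_pos_right (by linarith) hl, mul_lt_mul_of_pos_right (by linarith) hl⟩⟩
    rw [sub_sub_cancel, abs_of_pos hη]

end Achievability

end TwoWayRelay

end

theorem theorem2 {X12 X21 XR YR Y1 Y2 : Type*} [Fintype X12] [Fintype X21] [Fintype XR]
    [Fintype YR] [Fintype Y1] [Fintype Y2]
    (ch : TwoWayRelay.Channel X12 X21 XR YR Y1 Y2) (hdeg : ch.IsDegraded) :
    closure ch.hfRegion ⊆ closure {R : ℝ × ℝ | TwoWayRelay.HFAchievable ch R} := by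
  open TwoWayRelay in
  refine closure_minimal ?_ isClosed_closure
  rintro R ⟨hR1, hR2, p12, h12, p21, h21, r, hr, hb1, hb2⟩
  have hl : 0 < Real.log 2 := Real.log_pos one_lt_two
  obtain ⟨U, _, p, hp, hr1, hr2⟩ := exists_law_of_mem_downRates ch hr
  obtain ⟨PU, κ, hU, hκ, hpe⟩ := exists_disintegration hp
  have eJ := commonRate_eq_kernelInfo ch hU hκ hpe
  have eI := refinementRate_eq_kernelInfo ch hκ hpe
  have eH := condEntropy_upJoint ch (p12 := p12) (p21 := p21)
  have e12 := condMutualInfo_upJoint_fst ch (p21 := p21) h12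
  have e21 := condMutualInfo_upJoint_snd ch (p12 := p12) h21
  rw [Metric.mem_closure_iff]
  intro ε hε
  obtain ⟨R1, r12, hR1', hd1, hs1, hc1⟩ := exists_slack_rate hR1 (half_pos hε) hb1
  obtain ⟨R2, r21, hR2', hd2, hs2, hc2⟩ := exists_slack_rate hR2 (half_pos hε) hb2
  -- Each downlink rate is lowered by ε/8. Their sum thus loses ε/4, exactly the reserve η/2 of the
  -- slack lemma at η = ε/2.
  refine ⟨(R1, R2), hfAchievable_of_rates ch hdeg h12 h21 hU hκ
    (RI := (ch.refinementRate p - ε / 8) * Real.log 2)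
    (RJ := (ch.commonRate p - ε / 8) * Real.log 2)
    (r12 := r12 * Real.log 2) (r21 := r21 * Real.log 2) ?_ ?_ ?_ ?_ hR1' hR2' hs1 hs2, ?_⟩
  · rw [← eJ]
    exact mul_lt_mul_of_pos_right (by linarith) hl
  · rw [← eI]
    exact mul_lt_mul_of_pos_right (by linarith) hl
  · refine hc1.imp id fun h => ⟨h.1.trans_eq e12, h.2.trans_le ?_⟩
    rw [← eH, ← sub_mul]
    exact mul_le_mul_of_nonneg_right (by linarith) hl.le
  · refine hc2.imp id fun h => ⟨h.1.trans_eq e21, h.2.trans_le ?_⟩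
    rw [← eH, ← add_mul, ← sub_mul]
    exact mul_le_mul_of_nonneg_right (by linarith) hl.le
  · rw [Prod.dist_eq, Real.dist_eq, Real.dist_eq]
    exact (max_le hd1 hd2).trans_lt (half_lt_self hε)
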